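/- Let $p$ be a prime and $n\ge 1$. Let $K$ be a local field of characteristic $p$, i.e. a field of characteristic $p$ that is complete with respect to a discrete valuation, with perfect residue field $\kappa=\mathfrak O_K/\mathfrak P_K$. Let $L/K$ be a totally ramified Galois extension of degree $p^n$ with group $G$ which is weakly ramified, i.e. its second ramification group $G_2=\{\sigma\in G:(\sigma-1)\mathfrak O_L\subseteq\mathfrak P_L^{3}\}$ is trivial. For $h\in\mathbb Z$ let $\mathfrak A=\mathfrak A(h)=\{\alpha\in K[G]:\alpha\cdot\mathfrak P_L^h\subseteq\mathfrak P_L^h\}$ be the associated order of the fractional ideal $\mathfrak P_L^h$. Then every $\mathfrak A(h)$ is a local ring with residue field $\kappa$; writing $\mathfrak M$ for its maximal ideal, the embedding dimension of $\mathfrak A(h)$ is $\dim_\kappa(\mathfrak M/\mathfrak M^2)$. Moreover: (i) (a) If $p>2$, the maximum over $h\in\mathbb Z$ of the minimal number of generators of $\mathfrak P_L^h$ as an $\mathfrak A(h)$-module is $n+1$, and the minimum of this number over those $h$ for which $\mathfrak P_L^h$ is not free over $\mathfrak A(h)$ is $2$; the latter is attained, for example, at $h=\frac12(p^n+1)$.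 (b) If $p=2$ and $n>1$, the maximum over $h$ of the minimal number of generators of $\mathfrak P_L^h$ over $\mathfrak A(h)$ is again $n+1$. There is no $h$ for which the minimal number of generators is exactly $2$, and its minimum over those $h$ for which $\mathfrak P_L^h$ is not free is $3$, attained, for example, at $h=2^{n-1}$. (ii) (a) If $p\ne 2$, the set of values of the embedding dimension of $\mathfrak A(h)$, $h\in\mathbb Z$, is $\{n+1,n+2,\dots,2n+1\}$. The value $n+1$ occurs if and only if $h\equiv 1 \pmod{p^n}$. The value $n+2$ occurs, for example, if $h=2$ or $h=p^n$, and the value $2n+1$ occurs, for example, if $h=\frac12(p^n+1)$. (b) If $p=2$, the minimum over $h$ of the embedding dimension of $\mathfrak A(h)$ is $n+1$, attained if and only if $h\equiv 1$ or $h\equiv 2^{n-1}+1\pmod{2^n}$. The maximum is $2n$, attained whenever $h\equiv 2^{n-1}$ or $h\equiv 2^{n-1}+2\pmod{2^n}$ and, if $n>1$, only for these $h$. -/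

import Mathlib

/-! Totally and weakly ramified extensions of local fields and the Galois module structure of
fractional ideals over their associated orders.

Throughout, `OK` is the valuation ring of the local field `K`, and `OL` the valuation ring of the
finite extension `L` of `K` (so `OL` is the integral closure of `OK` in `L`). -/

noncomputable section

open IsLocalRing nonZeroDivisors

namespace GaloisModule

universe u v w x

/-- The fractional ideal `𝔓_L ^ h` of `OL`, for `h ∈ ℤ`, as an `OL`-submodule of `L`. -/
def idealPow (OL : Type u) (L : Type v) [CommRing OL] [IsDomain OL] [IsDiscreteValuationRing OL]
    [Field L] [Algebra OL L] [IsFractionRing OL L] (h : ℤ) : Submodule OL L :=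
  (((maximalIdeal OL : FractionalIdeal OL⁰ L) ^ h : FractionalIdeal OL⁰ L) : Submodule OL L)

/-- The natural action of the group algebra `K[G]`, `G = Gal(L/K)`, on `L`:
`∑ a_σ σ` acts as `y ↦ ∑ a_σ σ(y)`. -/
def galAction (K : Type u) (L : Type v) [Field K] [Field L] [Algebra K L] :
    MonoidAlgebra K Gal(L/K) →ₐ[K] Module.End K L :=
  (Representation.ofDistribMulAction K Gal(L/K) L).asAlgebraHom

section Setting

variable (OK : Type u) (K : Type v) (OL : Type w) (L : Type x)
  [CommRing OK] [IsDomain OK] [IsDiscreteValuationRing OK] [Field K] [Algebra OK K]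
  [IsFractionRing OK K] [CommRing OL] [IsDomain OL] [IsDiscreteValuationRing OL] [Field L]
  [Algebra OL L] [IsFractionRing OL L] [Algebra K L] [Algebra OK OL] [Algebra OK L]
  [IsScalarTower OK K L] [IsScalarTower OK OL L]

/-- `L/K` is totally ramified: `𝔓_K OL = 𝔓_L ^ [L : K]`, i.e. the ramification index is the
degree. -/
def IsTotallyRamified : Prop :=
  (maximalIdeal OK).map (algebraMap OK OL) = maximalIdeal OL ^ Module.finrank K L

/-- The `i`-th ramification group (lower numbering) of the Galois extension `L/K`:
`G_i = {σ ∈ Gal(L/K) : (σ - 1) OL ⊆ 𝔓_L ^ (i + 1)}`. -/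
def ramificationGroup [IsIntegralClosure OL OK L] [FiniteDimensional K L] (i : ℕ) :
    Subgroup Gal(L/K) :=
  ((maximalIdeal OL ^ (i + 1)).toAddSubgroup.inertia (OL ≃ₐ[OK] OL)).comap
    (galRestrict OK K L OL).toMonoidHom

/-- `L/K` is weakly ramified: the second ramification group is trivial. -/
def IsWeaklyRamified [IsIntegralClosure OL OK L] [FiniteDimensional K L] : Prop :=
  ramificationGroup OK K OL L 2 = ⊥

/-- The associated order `𝔄 = {α ∈ K[G] : α 𝔓_L ^ h ⊆ 𝔓_L ^ h}` of `𝔓_L ^ h`. -/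
def associatedOrder (h : ℤ) : Subalgebra OK (MonoidAlgebra K Gal(L/K)) where
  carrier := {α | ∀ y ∈ idealPow OL L h, galAction K L α y ∈ idealPow OL L h}
  mul_mem' {a b} ha hb y hy := by
    rw [map_mul, Module.End.mul_apply]
    exact ha _ (hb _ hy)
  add_mem' {a b} ha hb y hy := by
    rw [map_add, LinearMap.add_apply]
    exact add_mem (ha _ hy) (hb _ hy)
  algebraMap_mem' r y hy := by
    have key : galAction K L (algebraMap OK (MonoidAlgebra K Gal(L/K)) r) y
        = algebraMap OK OL r • y := by
      have h1 : algebraMap OK (MonoidAlgebra K Gal(L/K)) r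
          = algebraMap K (MonoidAlgebra K Gal(L/K)) (algebraMap OK K r) := rfl
      rw [h1, AlgHom.commutes, Module.algebraMap_end_apply, algebraMap_smul, algebraMap_smul]
    rw [key]
    exact Submodule.smul_mem _ _ hy

/-- `𝔓_L ^ h` as a module over its associated order. -/
instance idealModule (h : ℤ) : Module (associatedOrder OK K OL L h) (idealPow OL L h) where
  smul a y := ⟨galAction K L a.1 y.1, a.2 y.1 y.2⟩
  one_smul y := Subtype.ext (by
    change galAction K L 1 y.1 = y.1
    rw [map_one, Module.End.one_apply])
  mul_smul a b y := Subtype.ext (by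
    change galAction K L (a.1 * b.1) y.1 = galAction K L a.1 (galAction K L b.1 y.1)
    rw [map_mul, Module.End.mul_apply])
  smul_zero a := Subtype.ext (map_zero (galAction K L a.1))
  smul_add a y z := Subtype.ext (map_add (galAction K L a.1) y.1 z.1)
  add_smul a b y := Subtype.ext (by
    change galAction K L (a.1 + b.1) y.1 = galAction K L a.1 y.1 + galAction K L b.1 y.1
    rw [map_add, LinearMap.add_apply])
  zero_smul y := Subtype.ext (by
    change galAction K L 0 y.1 = 0
    rw [map_zero, LinearMap.zero_apply])

/-- `𝔓_L ^ h` is free over its associated order. -/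
def IsFreeIdeal (h : ℤ) : Prop :=
  Module.Free (associatedOrder OK K OL L h) (idealPow OL L h)

/-- The minimal number of generators of `𝔓_L ^ h` as a module over its associated order
(a cardinal, so that no convention for infinitely generated modules is involved). -/
def minGenerators (h : ℤ) : Cardinal :=
  (⊤ : Submodule (associatedOrder OK K OL L h) (idealPow OL L h)).spanRank

end Setting

/-- `R` is a (not necessarily commutative) local ring whose residue ring `R / 𝔐` (`𝔐` the Jacobson
radical, which is the unique maximal ideal of a local ring) is the residue field `k / 𝔪` of the
local ring `k`, through the structure map `k → R`. -/
def IsLocalWithResidueField (k : Type u) (R : Type v) [CommRing k] [IsLocalRing k] [Ring R]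
    [Algebra k R] : Prop :=
  IsLocalRing R ∧
  Function.Surjective (fun a : k ↦ Ideal.Quotient.mk (Ring.jacobson R) (algebraMap k R a)) ∧
  ∀ a : k, algebraMap k R a ∈ Ring.jacobson R ↔ a ∈ maximalIdeal k

/-- The embedding dimension `dim_{R/𝔐} (𝔐 / 𝔐 ^ 2)` of a (not necessarily commutative) local ring
`R` with unique maximal ideal `𝔐`; `𝔐 ^ 2` is written `𝔐 • ⊤` inside the `R`-module `𝔐`. -/
def embeddingDim (R : Type u) [Ring R] : Cardinal :=
  Module.rank (R ⧸ Ring.jacobson R)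
    (Ring.jacobson R ⧸ (Ring.jacobson R • (⊤ : Submodule R (Ring.jacobson R))))

end GaloisModule

end

set_option linter.unusedSectionVars false

noncomputable section

namespace GaloisModule

open IsLocalRing nonZeroDivisors WithZero

/-! Write q = p^n. The extension is generated by an element y with v_L(y) = -1 on which the Galois
group acts by translations, σ y = y + c(σ), where the c(σ) ∈ OK are distinct modulo the maximal
ideal (`exists_translation`). To find it, the ramification character σ ↦ σ(π⁻¹) - π⁻¹ mod 𝔓_L,
injective by weak ramification, is lifted to an additive map c into OK; this is possible because OK
has characteristic p. An element of trace one makes c a coboundary (additive Hilbert 90), and the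
vanishing of H¹(G, 𝔓_L) allows the solution to be moved by an element of K to one of valuation -1.

The powers y^j, 0 ≤ j < q, have distinct valuations modulo q, so every fractional ideal is the
direct sum of its intersections with the lines K y^j. The Vandermonde matrix of the c(σ) is
invertible over OK, so OK[G] contains elements D_i acting on these powers as Hasse derivatives, D_i
y^j = C(j,i) y^(j-i), and D_i D_k = C(i+k,i) D_(i+k). If h ≡ b + 1 mod q with 0 ≤ b < q, the ideal
has the OK-basis x_j = t^(m+ε_j) y^j with ε_j = 1 exactly when j ≥ q - b, and its associated order
has the OK-basis X_i = t^(-w_i) D_i with w_i = 1 exactly when i ≥ c = max(b, q - b).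

Both structures are therefore monomial (`MonomialBasis`, `MonomialModule`). A structure constant is
a unit exactly when the indices add without carry in base p (Kummer) and the exponents add up
exactly. The order is local because the X_i with i > 0 span a nilpotent ideal; 𝔐/𝔐² has as basis the
classes of t and of the X_i that are not unit multiples of a product X_j X_l with j, l > 0
(`embeddingDim_eq`); minimal generators of the ideal are the x_j that are not unit multiples of some
X_i x_(i+j) with i > 0 (`spanRank_eq`).

What remains is digit counting. With v the p-adic valuation, the ideal needs one generator plus one
for each m in [b, q - b) with m - p^v(m) < b (`minGenerators_eq`). The embedding dimension is n + 1
plus the number of m in [c, q), not powers of p, with m - p^v(m) < c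
(`embeddingDim_associatedOrder`). Each set has at most one m of a given valuation, whence the upper
bounds; particular b give the exact values. -/

/-- Adding `i` and `k` in base `p` produces no carry. -/
def NoCarry (p i k : ℕ) : Prop := ¬ p ∣ (i + k).choose i

/-! ### Carries in base p -/

section NoCarry

variable {p : ℕ} [hp : Fact p.Prime]

/-- Kummer's theorem: the valuation of the binomial coefficient counts the positions with a carry.
Positions beyond the length of i + k never carry. -/
lemma noCarry_iff {i k : ℕ} : NoCarry p i k ↔ ∀ s, 1 ≤ s → i % p ^ s + k % p ^ s < p ^ s := by
  have hch : (i + k).choose i ≠ 0 := (Nat.choose_pos (Nat.le_add_right i k)).ne'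
  have h := padicValNat_choose' (p := p) (n := k) (k := i) (Nat.lt_succ_self (Nat.log p (k + i)))
  rw [add_comm k i] at h
  rw [NoCarry, dvd_iff_padicValNat_ne_zero hch, not_not, h, Finset.card_eq_zero,
    Finset.filter_eq_empty_iff]
  constructor
  · intro H s hs
    by_cases hlog : s < (Nat.log p (i + k)).succ
    · exact not_le.1 (H (Finset.mem_Ico.2 ⟨hs, hlog⟩))
    · have : i + k < p ^ s := Nat.lt_pow_of_log_lt hp.out.one_lt (by omega)
      exact (Nat.add_le_add (Nat.mod_le _ _) (Nat.mod_le _ _)).trans_lt this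
  · intro H s hs
    exact not_le.2 (H s (Finset.mem_Ico.1 hs).1)

lemma not_pow_padicValNat_succ_dvd {m s : ℕ} (hm : 0 < m) (hs : padicValNat p m < s) :
    ¬ p ^ s ∣ m := fun h ↦ by
  have := (padicValNat_dvd_iff_le hm.ne').1 h
  omega

lemma eq_of_dvd_of_lt_add {d a b : ℕ} (ha : d ∣ a) (hb : d ∣ b) (h1 : a < b + d) (h2 : b < a + d) :
    a = b := by
  obtain ⟨x, rfl⟩ := ha
  obtain ⟨y, rfl⟩ := hb
  have h1' : d * x < d * (y + 1) := by rw [mul_add, mul_one]; exact h1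
  have h2' : d * y < d * (x + 1) := by rw [mul_add, mul_one]; exact h2
  have := Nat.lt_of_mul_lt_mul_left h1'
  have := Nat.lt_of_mul_lt_mul_left h2'
  rw [show x = y by omega]

/-- The base-p digits of p^n - 1 - i are the complements to p - 1 of those of i. -/
lemma noCarry_compl {n i : ℕ} (hi : i < p ^ n) : NoCarry p i (p ^ n - 1 - i) := by
  rw [noCarry_iff]
  intro s hs
  have hP : 0 < p ^ s := pow_pos hp.out.pos s
  have hQ : 0 < p ^ n := pow_pos hp.out.pos n
  by_contra hcon
  rcases le_or_gt s n with h | h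
  · have h1 := Nat.mod_lt i hP
    have h2 := Nat.mod_lt (p ^ n - 1 - i) hP
    have hdvd : p ^ s ∣ i % p ^ s + (p ^ n - 1 - i) % p ^ s + 1 := by
      have : p ^ s ∣ i + (p ^ n - 1 - i) + 1 := by
        rw [show i + (p ^ n - 1 - i) + 1 = p ^ n by omega]
        exact pow_dvd_pow p h
      rw [← Nat.modEq_zero_iff_dvd] at this ⊢
      exact ((((Nat.mod_modEq i _).add (Nat.mod_modEq _ _)).add_right 1)).trans this
    have := eq_of_dvd_of_lt_add hdvd (dvd_refl (p ^ s)) (by omega) (by omega)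
    omega
  · have h1 : p ^ n < p ^ s := Nat.pow_lt_pow_right hp.out.one_lt h
    have h2 := Nat.mod_le i (p ^ s)
    have h3 := Nat.mod_le (p ^ n - 1 - i) (p ^ s)
    omega

/-- The number k ends in v digits equal to p - 1, where v is the valuation of k + 1, so a positive i
below p^v would carry. Together with `noCarry_pow_padicValNat_succ` this identifies p^v as the least
positive number that adds to k without carry. -/
lemma pow_padicValNat_succ_le_of_noCarry {i k : ℕ} (h : NoCarry p i k) (hi : 0 < i) :
    p ^ padicValNat p (k + 1) ≤ i := by
  by_contra hcon
  set v := padicValNat p (k + 1) with hv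
  have hdvd : p ^ v ∣ k + 1 := pow_padicValNat_dvd
  have hv0 : 1 ≤ v := by
    by_contra h0
    rw [show v = 0 by omega, pow_zero] at hcon
    omega
  have h1 := noCarry_iff.1 h v hv0
  rw [Nat.mod_eq_of_lt (by omega : i < p ^ v)] at h1
  have h2 : p ^ v ∣ k % p ^ v + 1 := by
    rw [← Nat.modEq_zero_iff_dvd] at hdvd ⊢
    exact ((Nat.mod_modEq k _).add_right 1).trans hdvd
  have := Nat.le_of_dvd (Nat.succ_pos _) h2
  omega

/-- The lowest digit of k different from p - 1 can be raised by one. -/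
lemma noCarry_pow_padicValNat_succ (k : ℕ) : NoCarry p (p ^ padicValNat p (k + 1)) k := by
  rw [noCarry_iff]
  intro s hs
  set v := padicValNat p (k + 1) with hv
  have hP : 0 < p ^ s := pow_pos hp.out.pos s
  have hr := Nat.mod_lt k hP
  rcases le_or_gt s v with h | h
  · rw [Nat.mod_eq_zero_of_dvd (pow_dvd_pow p h)]
    omega
  have hlt : p ^ v < p ^ s := Nat.pow_lt_pow_right hp.out.one_lt h
  rw [Nat.mod_eq_of_lt hlt]
  by_contra hcon
  have hdvd : p ^ v ∣ k % p ^ s + 1 := by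
    have hdvd : p ^ v ∣ k + 1 := pow_padicValNat_dvd
    rw [← Nat.modEq_zero_iff_dvd] at hdvd ⊢
    exact (((Nat.mod_modEq k _).add_right 1).of_dvd (pow_dvd_pow p h.le)).trans hdvd
  have h1 := eq_of_dvd_of_lt_add hdvd (pow_dvd_pow p h.le) (by omega) (by omega)
  refine not_pow_padicValNat_succ_dvd (Nat.succ_pos k) h ?_
  rw [← Nat.modEq_zero_iff_dvd]
  refine ((Nat.mod_modEq k (p ^ s)).add_right 1).symm.trans ?_
  rw [h1, Nat.modEq_zero_iff_dvd]

/-- Trailing zeros of a sum formed without carry are trailing zeros of both summands. -/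
lemma pow_padicValNat_add_le_of_noCarry {i k : ℕ} (h : NoCarry p i k) (hi : 0 < i) :
    p ^ padicValNat p (i + k) ≤ i := by
  by_contra hcon
  set v := padicValNat p (i + k) with hv
  have hdvd : p ^ v ∣ i + k := pow_padicValNat_dvd
  have hv0 : 1 ≤ v := by
    by_contra h0
    rw [show v = 0 by omega, pow_zero] at hcon
    omega
  have h1 := noCarry_iff.1 h v hv0
  have h2 : p ^ v ∣ i % p ^ v + k % p ^ v := by
    rw [← Nat.modEq_zero_iff_dvd] at hdvd ⊢
    exact ((Nat.mod_modEq i _).add (Nat.mod_modEq k _)).trans hdvd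
  rw [Nat.mod_eq_of_lt (by omega : i < p ^ v)] at h1 h2
  have := Nat.le_of_dvd (Nat.add_pos_left hi _) h2
  omega

lemma noCarry_comm {i k : ℕ} : NoCarry p i k ↔ NoCarry p k i := by
  simp only [noCarry_iff, add_comm]

omit hp in
lemma pow_padicValNat_le {m : ℕ} (hm : 0 < m) : p ^ padicValNat p m ≤ m :=
  Nat.le_of_dvd hm pow_padicValNat_dvd

/-- The lowest nonzero digit of m can be lowered by one without borrowing. -/
lemma noCarry_pow_padicValNat {m : ℕ} (hm : 0 < m) :
    NoCarry p (p ^ padicValNat p m) (m - p ^ padicValNat p m) := by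
  rw [noCarry_iff]
  intro s hs
  have hle := pow_padicValNat_le (p := p) hm
  have hdm : p ^ padicValNat p m ∣ m := pow_padicValNat_dvd
  set v := padicValNat p m with hv
  set k := m - p ^ v with hk
  have hP : 0 < p ^ s := pow_pos hp.out.pos s
  have hr := Nat.mod_lt k hP
  rcases le_or_gt s v with h | h
  · rw [Nat.mod_eq_zero_of_dvd (pow_dvd_pow p h)]
    omega
  have hlt : p ^ v < p ^ s := Nat.pow_lt_pow_right hp.out.one_lt h
  rw [Nat.mod_eq_of_lt hlt]
  by_contra hcon
  have hdvd : p ^ v ∣ p ^ v + k % p ^ s := by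
    have hdvd : p ^ v ∣ p ^ v + k := by rwa [show p ^ v + k = m by omega]
    rw [← Nat.modEq_zero_iff_dvd] at hdvd ⊢
    exact (((Nat.mod_modEq k _).add_left _).of_dvd (pow_dvd_pow p h.le)).trans hdvd
  have h1 := eq_of_dvd_of_lt_add hdvd (pow_dvd_pow p h.le) (by omega) (by omega)
  refine not_pow_padicValNat_succ_dvd hm h ?_
  rw [← Nat.modEq_zero_iff_dvd, show m = p ^ v + k by omega]
  refine ((Nat.mod_modEq k (p ^ s)).add_left _).symm.trans ?_
  rw [h1, Nat.modEq_zero_iff_dvd]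

lemma padicValNat_lt_of_lt {n m : ℕ} (hm : 0 < m) (h : m < p ^ n) : padicValNat p m < n :=
  (Nat.pow_lt_pow_iff_right hp.out.one_lt).1 ((pow_padicValNat_le hm).trans_lt h)

lemma padicValNat_pow_sub {n m : ℕ} (hm : 0 < m) (h : m < p ^ n) :
    padicValNat p (p ^ n - m) = padicValNat p m := by
  have key : ∀ a, 0 < a → a < p ^ n → padicValNat p a ≤ padicValNat p (p ^ n - a) := by
    intro a ha h
    rw [← padicValNat_dvd_iff_le (by omega)]
    exact Nat.dvd_sub (pow_dvd_pow p (padicValNat_lt_of_lt ha h).le) pow_padicValNat_dvd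
  refine le_antisymm ?_ (key m hm h)
  have := key (p ^ n - m) (by omega) (by omega)
  rwa [show p ^ n - (p ^ n - m) = m by omega] at this

lemma padicValNat_eq_of_dvd {m s : ℕ} (hm : 0 < m) (h1 : p ^ s ∣ m) (h2 : ¬ p ^ (s + 1) ∣ m) :
    padicValNat p m = s := by
  rw [padicValNat_dvd_iff_le hm.ne'] at h1 h2
  omega

end NoCarry

/-! ### The exponents ε and w -/

/-- `ε_j ∈ {0, 1}`: the jump of the exponents of the monomial basis of an ideal. -/
def eps (q b j : ℕ) : ℕ := if q ≤ b + j then 1 else 0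

/-- `w_i ∈ {0, 1}`: the exponents of the monomial basis of an associated order. -/
def wt (c i : ℕ) : ℕ := if c ≤ i then 1 else 0

/-- Two indices of weight one would have sum at least 2c ≥ q. This keeps the structure constants of
the associated order integral. -/
lemma wt_add_le {q c i k : ℕ} (hc : q ≤ 2 * c) (h : i + k < q) : wt c i + wt c k ≤ wt c (i + k) := by
  unfold wt
  split_ifs <;> omega

/-- If i ≥ max(b, q - b), then adding i carries j from below the threshold q - b to above it. This
keeps the action on the ideal integral. -/
lemma eps_add_wt_le {q b i j : ℕ} (h : i + j < q) :
    eps q b j + wt (max b (q - b)) i ≤ eps q b (i + j) := by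
  unfold wt eps
  split_ifs <;> omega

/-- Sharpness of the weights: no larger power of t can be divided out of D_i. The extreme choices k
= 0 and k = p^n - 1 - i suffice, and neither produces a carry. -/
lemma exists_eps_eq {p n b i : ℕ} [Fact p.Prime] (hi : i < p ^ n) :
    ∃ k, i + k < p ^ n ∧ NoCarry p i k ∧
      eps (p ^ n) b (i + k) = eps (p ^ n) b k + wt (max b (p ^ n - b)) i := by
  by_cases h : b ≤ i
  · refine ⟨0, by omega, by simp [noCarry_iff, Nat.mod_lt, (Fact.out : p.Prime).pos], ?_⟩
    unfold wt eps
    split_ifs <;> omega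
  · refine ⟨p ^ n - 1 - i, by omega, noCarry_compl hi, ?_⟩
    unfold wt eps
    split_ifs <;> omega

/-! ### Counting generators and indecomposable indices -/

section Count

variable (p n : ℕ) [hp : Fact p.Prime]

/-- The set counting the generators, besides one, of an ideal. -/
def extraGenerators (b : ℕ) : Finset ℕ :=
  (Finset.Ico b (p ^ n - b)).filter fun m ↦ m - p ^ padicValNat p m < b

open Classical in
/-- The set counting the elements, besides `n + 1`, of a minimal generating set of the maximal
ideal of an associated order. -/
def extraCotangent (c : ℕ) : Finset ℕ :=
  (Finset.Ico c (p ^ n)).filter fun m ↦ m - p ^ padicValNat p m < c ∧ ∀ s, m ≠ p ^ s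

variable {p n}

/-- Put m = p^n - 1 - j. If some positive i adding to j without carry gives equality of exponents,
then so does the least such i, which is p^v with v the valuation of j + 1 (equivalently of m), or
the greatest, which is m itself. Failure at both ends is the inequality defining `extraGenerators`.
-/
lemma forall_eps_ne_iff {b j : ℕ} (hb : b < p ^ n) (hj : j < p ^ n) :
    (∀ i, 0 < i → i + j < p ^ n → ¬ (NoCarry p i j ∧
      eps (p ^ n) b (i + j) = eps (p ^ n) b j + wt (max b (p ^ n - b)) i)) ↔
    j = p ^ n - 1 ∨ p ^ n - 1 - j ∈ extraGenerators p n b := by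
  rw [extraGenerators, Finset.mem_filter, Finset.mem_Ico]
  by_cases hj1 : j = p ^ n - 1
  · simp only [hj1, true_or, iff_true]
    intro i hi h
    omega
  have hv : padicValNat p (p ^ n - 1 - j) = padicValNat p (j + 1) := by
    rw [← padicValNat_pow_sub (n := n) (m := j + 1) (by omega) (by omega)]
    congr 1
    omega
  have hle := pow_padicValNat_le (p := p) (m := p ^ n - 1 - j) (by omega)
  rw [hv] at hle ⊢
  have hpos : 0 < p ^ padicValNat p (j + 1) := pow_pos hp.out.pos _
  constructor
  · intro H
    right
    have h1 := H (p ^ padicValNat p (j + 1)) hpos (by omega)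
    have h2 := H (p ^ n - 1 - j) (by omega) (by omega)
    have h3 : ¬ _ := fun h ↦ h1 ⟨noCarry_pow_padicValNat_succ j, h⟩
    have h4 : ¬ _ := fun h ↦ h2 ⟨by
      rw [noCarry_comm]
      have := noCarry_compl hj
      exact this, h⟩
    clear h1 h2 H
    revert h3 h4
    unfold eps wt
    split_ifs <;> omega
  · rintro (h | ⟨h1, h2⟩)
    · exact absurd h hj1
    · rintro i hi hij ⟨hnc, h⟩
      have := pow_padicValNat_succ_le_of_noCarry hnc hi
      revert h
      unfold eps wt
      split_ifs <;> omega

omit hp in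
lemma mem_extraCotangent {c m : ℕ} : m ∈ extraCotangent p n c ↔
    (c ≤ m ∧ m < p ^ n) ∧ m - p ^ padicValNat p m < c ∧ ∀ s, m ≠ p ^ s := by
  classical
  rw [extraCotangent, Finset.mem_filter, Finset.mem_Ico]

/-- In a decomposition of m without carry both parts are at least p^v, v the valuation of m; so a
power of p has none, and otherwise splitting off p^v is the decisive test. -/
lemma forall_wt_ne_iff {c m : ℕ} (hc : p ^ n ≤ 2 * c) (hm0 : 0 < m) (hm : m < p ^ n) :
    (∀ j l, 0 < j → 0 < l → j + l = m → ¬ (NoCarry p j l ∧ wt c m = wt c j + wt c l)) ↔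
    (∃ s, m = p ^ s) ∨ m ∈ extraCotangent p n c := by
  rw [mem_extraCotangent]
  by_cases hs : ∃ s, m = p ^ s
  · simp only [hs, true_or, iff_true]
    obtain ⟨s, rfl⟩ := hs
    rintro j l hj hl h ⟨hnc, -⟩
    have := pow_padicValNat_add_le_of_noCarry hnc hj
    rw [h, padicValNat.prime_pow] at this
    omega
  push Not at hs
  have hle := pow_padicValNat_le (p := p) hm0
  have hne := hs (padicValNat p m)
  have hpos : 0 < p ^ padicValNat p m := pow_pos hp.out.pos _
  constructor
  · intro H
    right
    have h1 := H (p ^ padicValNat p m) (m - p ^ padicValNat p m) hpos (by omega) (by omega)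
    have h2 : ¬ _ := fun h ↦ h1 ⟨noCarry_pow_padicValNat hm0, h⟩
    clear H h1
    refine ⟨⟨?_, hm⟩, ?_, hs⟩ <;> revert h2 <;> unfold wt <;> split_ifs <;> omega
  · rintro (⟨s, h⟩ | ⟨h1, h2, -⟩)
    · exact absurd h (hs s)
    · rintro j l hj hl rfl ⟨hnc, h⟩
      have h3 := pow_padicValNat_add_le_of_noCarry hnc hj
      have h4 := pow_padicValNat_add_le_of_noCarry (noCarry_comm.1 hnc) hl
      rw [add_comm l j] at h4
      revert h
      unfold wt
      split_ifs <;> omega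

open Classical in
lemma card_generators {b : ℕ} (hb : b < p ^ n) :
    (Finset.univ.filter fun j : Fin (p ^ n) ↦ ∀ i, 0 < i → i + j.1 < p ^ n → ¬ (NoCarry p i j ∧
      eps (p ^ n) b (i + j) = eps (p ^ n) b j + wt (max b (p ^ n - b)) i)).card =
      1 + (extraGenerators p n b).card := by
  have hmem : ∀ m ∈ extraGenerators p n b, 0 < m ∧ m < p ^ n := by
    intro m hm
    rw [extraGenerators, Finset.mem_filter, Finset.mem_Ico] at hm
    omega
  rw [add_comm, ← Finset.card_insert_of_notMem (a := 0) (fun h ↦ (hmem 0 h).1.false)]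
  refine Finset.card_bij (fun j _ ↦ p ^ n - 1 - j.1) ?_ ?_ ?_
  · intro j hj
    rw [Finset.mem_filter, forall_eps_ne_iff hb j.2] at hj
    rw [Finset.mem_insert]
    have := j.2
    exact hj.2.imp (fun h ↦ by omega) id
  · intro j _ j' _ h
    have := j.2
    have := j'.2
    ext
    omega
  · intro m hm
    have hm' : m < p ^ n := by
      rcases Finset.mem_insert.1 hm with rfl | h
      · omega
      · exact (hmem m h).2
    refine ⟨⟨p ^ n - 1 - m, by omega⟩, ?_, by simp only; omega⟩
    rw [Finset.mem_filter, forall_eps_ne_iff hb (by simp only; omega)]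
    refine ⟨Finset.mem_univ _, ?_⟩
    simp only
    rw [show p ^ n - 1 - (p ^ n - 1 - m) = m by omega]
    exact (Finset.mem_insert.1 hm).imp (fun h ↦ by omega) id

open Classical in
lemma card_indecomposables {c : ℕ} (hc : p ^ n ≤ 2 * c) :
    (Finset.univ.filter fun m : Fin (p ^ n) ↦ 0 < m.1 ∧ m.1 < p ^ n ∧
      ∀ j l, 0 < j → 0 < l → j + l = m.1 →
        ¬ (NoCarry p j l ∧ wt c m = wt c j + wt c l)).card =
      n + (extraCotangent p n c).card := by
  have hq : 0 < p ^ n := pow_pos hp.out.pos n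
  have hpow : ((Finset.range n).image fun s ↦ p ^ s).card = n := by
    rw [Finset.card_image_of_injective _ (Nat.pow_right_injective hp.out.two_le),
      Finset.card_range]
  have hdisj : Disjoint ((Finset.range n).image fun s ↦ p ^ s) (extraCotangent p n c) := by
    rw [Finset.disjoint_left]
    intro m hm hm'
    obtain ⟨s, -, rfl⟩ := Finset.mem_image.1 hm
    exact (mem_extraCotangent.1 hm').2.2 s rfl
  have hmem : ∀ m ∈ ((Finset.range n).image fun s ↦ p ^ s) ∪ extraCotangent p n c,
      0 < m ∧ m < p ^ n := by
    intro m hm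
    rcases Finset.mem_union.1 hm with hm | hm
    · obtain ⟨s, hs, rfl⟩ := Finset.mem_image.1 hm
      exact ⟨pow_pos hp.out.pos s,
        Nat.pow_lt_pow_right hp.out.one_lt (Finset.mem_range.1 hs)⟩
    · have := mem_extraCotangent.1 hm
      have := pow_pos hp.out.pos n
      omega
  have hcard := Finset.card_union_of_disjoint hdisj
  rw [hpow] at hcard
  rw [← hcard]
  have hiff : ∀ m, 0 < m → m < p ^ n → (((∃ s, m = p ^ s) ∨ m ∈ extraCotangent p n c) ↔
      m ∈ ((Finset.range n).image fun s ↦ p ^ s) ∪ extraCotangent p n c) := by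
    intro m _ hm
    rw [Finset.mem_union, Finset.mem_image]
    refine or_congr_left ⟨?_, ?_⟩
    · rintro ⟨s, rfl⟩
      exact ⟨s, Finset.mem_range.2 ((Nat.pow_lt_pow_iff_right hp.out.one_lt).1 hm), rfl⟩
    · rintro ⟨s, -, h⟩
      exact ⟨s, h.symm⟩
  refine Finset.card_bij (fun m _ ↦ m.1) ?_ (fun _ _ _ _ h ↦ Fin.ext h) ?_
  · intro m hm
    obtain ⟨-, h0, h1, h2⟩ := Finset.mem_filter.1 hm
    rw [forall_wt_ne_iff hc h0 h1] at h2
    exact (hiff m h0 h1).1 h2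
  · intro m hm
    obtain ⟨h0, h1⟩ := hmem m hm
    refine ⟨⟨m, h1⟩, Finset.mem_filter.2 ⟨Finset.mem_univ _, h0, h1, ?_⟩, rfl⟩
    rw [forall_wt_ne_iff hc h0 h1]
    exact (hiff m h0 h1).2 hm

omit hp in
-- An interval [x, x + p^v) contains only one multiple of p^v. This is the source of the upper
-- bounds by n.
lemma padicValNat_injOn {x m m' : ℕ} (h1 : x ≤ m) (h2 : m - p ^ padicValNat p m < x)
    (h1' : x ≤ m') (h2' : m' - p ^ padicValNat p m' < x)
    (h : padicValNat p m = padicValNat p m') : m = m' := by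
  have hd : p ^ padicValNat p m ∣ m := pow_padicValNat_dvd
  have hd' : p ^ padicValNat p m' ∣ m' := pow_padicValNat_dvd
  rw [← h] at hd' h2'
  exact eq_of_dvd_of_lt_add hd hd' (by omega) (by omega)

lemma card_extraGenerators_le (b : ℕ) : (extraGenerators p n b).card ≤ n := by
  conv_rhs => rw [← Finset.card_range n]
  refine Finset.card_le_card_of_injOn (padicValNat p) ?_ ?_
  · intro m hm
    simp only [extraGenerators, Finset.coe_filter, Finset.mem_Ico, Set.mem_ofPred_eq] at hm
    exact Finset.mem_coe.2 (Finset.mem_range.2 (padicValNat_lt_of_lt (by omega) (by omega)))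
  · intro m hm m' hm' h
    simp only [extraGenerators, Finset.coe_filter, Finset.mem_Ico, Set.mem_ofPred_eq] at hm hm'
    exact padicValNat_injOn hm.1.1 hm.2 hm'.1.1 hm'.2 h

omit hp in
lemma injOn_extraCotangent (c : ℕ) :
    Set.InjOn (padicValNat p) (extraCotangent p n c : Set ℕ) := by
  intro m hm m' hm' h
  rw [Finset.mem_coe, mem_extraCotangent] at hm hm'
  exact padicValNat_injOn hm.1.1 hm.2.1 hm'.1.1 hm'.2.1 h

omit hp in
lemma card_extraCotangent_le_of_lt {c r : ℕ}
    (h : ∀ m, c ≤ m → m < p ^ n → padicValNat p m < r) : (extraCotangent p n c).card ≤ r := by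
  conv_rhs => rw [← Finset.card_range r]
  refine Finset.card_le_card_of_injOn (padicValNat p) ?_ (injOn_extraCotangent c)
  intro m hm
  rw [Finset.mem_coe, mem_extraCotangent] at hm
  exact Finset.mem_coe.2 (Finset.mem_range.2 (h m hm.1.1 hm.1.2))

lemma le_card_extraCotangent {c r : ℕ} (hc : 0 < c) (f : ℕ → ℕ)
    (h : ∀ s < r, (c ≤ f s ∧ f s < p ^ n) ∧ f s < c + p ^ s ∧ padicValNat p (f s) = s ∧
      ∀ a, f s ≠ p ^ a) : r ≤ (extraCotangent p n c).card := by
  conv_lhs => rw [← Finset.card_range r]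
  refine Finset.card_le_card_of_injOn f ?_ ?_
  · intro s hs
    obtain ⟨h1, h2, h3, h4⟩ := h s (Finset.mem_range.1 (Finset.mem_coe.1 hs))
    rw [Finset.mem_coe, mem_extraCotangent]
    simp only [h3]
    have : 0 < p ^ s := pow_pos hp.out.pos s
    exact ⟨h1, by omega, h4⟩
  · intro s hs s' hs' hss
    rw [← (h s (Finset.mem_range.1 (Finset.mem_coe.1 hs))).2.2.1, hss,
      (h s' (Finset.mem_range.1 (Finset.mem_coe.1 hs'))).2.2.1]

lemma card_extraCotangent_le {c : ℕ} (hc : 0 < c) : (extraCotangent p n c).card ≤ n :=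
  card_extraCotangent_le_of_lt fun _ h1 h2 ↦ padicValNat_lt_of_lt (by omega) h2

lemma ne_pow_of_lt {m : ℕ} (hn : 1 ≤ n) (h1 : p ^ (n - 1) < m) (h2 : m < p ^ n) (s : ℕ) :
    m ≠ p ^ s := by
  rintro rfl
  have := (Nat.pow_lt_pow_iff_right hp.out.one_lt).1 h1
  have := (Nat.pow_lt_pow_iff_right hp.out.one_lt).1 h2
  omega

omit hp in
lemma pow_eq_mul_pow_pred (hn : 1 ≤ n) : p ^ n = p * p ^ (n - 1) := by
  rw [← pow_succ', Nat.sub_add_cancel hn]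

lemma two_mul_pow_pred_le (hn : 1 ≤ n) : 2 * p ^ (n - 1) ≤ p ^ n := by
  rw [pow_eq_mul_pow_pred hn]
  exact Nat.mul_le_mul_right _ hp.out.two_le

/-- A member has valuation below r, as no multiple of p^r lies strictly between p^n - p^r and p^n;
each s < r is realised by p^n - p^r + p^s. -/
lemma card_extraCotangent_sub_pow (hn : 1 ≤ n) {r : ℕ} (hr : r < n) :
    (extraCotangent p n (p ^ n - p ^ r + 1)).card = r := by
  have h2 := two_mul_pow_pred_le (p := p) hn
  have h3 : p ^ r ≤ p ^ (n - 1) := Nat.pow_le_pow_right hp.out.pos (by omega)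
  apply le_antisymm
  · refine card_extraCotangent_le_of_lt fun m hm1 hm2 ↦ ?_
    by_contra hv
    have hd : p ^ r ∣ m := (padicValNat_dvd_iff_le (by omega)).2 (by omega)
    have := eq_of_dvd_of_lt_add hd (pow_dvd_pow p hr.le) (by omega) (by omega)
    omega
  · refine le_card_extraCotangent (Nat.succ_pos _) (fun s ↦ p ^ n - p ^ r + p ^ s) fun s hs ↦ ?_
    have hs0 : 0 < p ^ s := pow_pos hp.out.pos s
    have hsr : p ^ s < p ^ r := Nat.pow_lt_pow_right hp.out.one_lt hs
    refine ⟨⟨by omega, by omega⟩, by omega, ?_, ne_pow_of_lt hn (by omega) (by omega)⟩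
    have hd : ∀ a ≤ r, p ^ a ∣ p ^ n - p ^ r := fun a ha ↦
      Nat.dvd_sub (pow_dvd_pow p (by omega)) (pow_dvd_pow p ha)
    refine padicValNat_eq_of_dvd (by omega)
      ((Nat.dvd_add_right (hd s hs.le)).2 dvd_rfl) fun h ↦ ?_
    rw [Nat.dvd_add_right (hd (s + 1) hs)] at h
    exact absurd (Nat.le_of_dvd hs0 h) (not_le.2 (Nat.pow_lt_pow_right hp.out.one_lt (by omega)))

lemma odd_pow (hp2 : p ≠ 2) (s : ℕ) : p ^ s % 2 = 1 :=
  Nat.odd_iff.1 ((hp.out.odd_of_ne_two hp2).pow)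

/-- Every valuation s < n is realised, by (p^n + p^s)/2. -/
lemma card_extraCotangent_half (hp2 : p ≠ 2) (hn : 1 ≤ n) :
    (extraCotangent p n ((p ^ n + 1) / 2)).card = n := by
  have hodd := odd_pow (p := p) hp2
  have hn2 := two_mul_pow_pred_le (p := p) hn
  refine le_antisymm (card_extraCotangent_le (by have := hodd n; omega))
    (le_card_extraCotangent (by have := hodd n; omega) (fun s ↦ (p ^ n + p ^ s) / 2) fun s hs ↦ ?_)
  have h1 := hodd n
  have h2 := hodd s
  have hsn : p ^ s < p ^ n := Nat.pow_lt_pow_right hp.out.one_lt hs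
  obtain ⟨m, hm⟩ : ∃ m, p ^ n + p ^ s = 2 * m := ⟨(p ^ n + p ^ s) / 2, by omega⟩
  have hm' : (p ^ n + p ^ s) / 2 = m := by omega
  simp only [hm']
  refine ⟨⟨by omega, by omega⟩, by omega, ?_, ne_pow_of_lt hn (by omega) (by omega)⟩
  refine padicValNat_eq_of_dvd (by omega) ?_ fun h ↦ ?_
  · have hco : Nat.Coprime (p ^ s) 2 :=
      Nat.Coprime.pow_left s ((Nat.coprime_primes hp.out Nat.prime_two).2 hp2)
    refine hco.dvd_of_dvd_mul_left ?_
    rw [← hm]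
    exact dvd_add (pow_dvd_pow p hs.le) dvd_rfl
  · have h4 : p ^ (s + 1) ∣ p ^ n + p ^ s := hm ▸ h.mul_left 2
    rw [Nat.dvd_add_right (pow_dvd_pow p (by omega))] at h4
    exact absurd (Nat.le_of_dvd (by omega) h4)
      (not_le.2 (Nat.pow_lt_pow_right hp.out.one_lt (by omega)))

omit hp in
lemma extraCotangent_self : extraCotangent p n (p ^ n) = ∅ := by
  ext m
  rw [mem_extraCotangent]
  simp only [Finset.notMem_empty, iff_false]
  omega

lemma self_mem_extraCotangent {c : ℕ} (hn : 1 ≤ n) (h1 : p ^ (n - 1) < c) (h2 : c < p ^ n) :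
    c ∈ extraCotangent p n c := by
  rw [mem_extraCotangent]
  have : 0 < p ^ padicValNat p c := pow_pos hp.out.pos _
  exact ⟨⟨le_rfl, h2⟩, by omega, ne_pow_of_lt hn h1 h2⟩

lemma card_extraCotangent_pred (hn : 1 ≤ n) (h : p ^ (n - 1) < p ^ n - 1) :
    (extraCotangent p n (p ^ n - 1)).card = 1 := by
  rw [Finset.card_eq_one]
  refine ⟨p ^ n - 1, ?_⟩
  ext m
  rw [Finset.mem_singleton]
  constructor
  · rw [mem_extraCotangent]
    omega
  · rintro rfl
    exact self_mem_extraCotangent hn h (by omega)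

/-- The only excluded case is p^n = 2; there is room above p^(n-1) in all others. -/
lemma pow_pred_add_one_lt (hn : 1 ≤ n) (h : p ≠ 2 ∨ 1 < n) : p ^ (n - 1) + 1 < p ^ n := by
  rw [pow_eq_mul_pow_pred hn]
  have h0 : 0 < p ^ (n - 1) := pow_pos hp.out.pos _
  rcases h with h | h
  · have : 3 ≤ p := by have := hp.out.two_le; omega
    have := Nat.mul_le_mul_right (p ^ (n - 1)) this
    omega
  · have h1 : 1 < p ^ (n - 1) := Nat.one_lt_pow (by omega) hp.out.one_lt
    have := Nat.mul_le_mul_right (p ^ (n - 1)) hp.out.two_le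
    omega

lemma card_extraGenerators_one (hn : 1 ≤ n) (h : p ≠ 2 ∨ 1 < n) :
    (extraGenerators p n 1).card = n := by
  have h0 := pow_pred_add_one_lt hn h
  refine le_antisymm (card_extraGenerators_le 1) ?_
  conv_lhs => rw [← Finset.card_range n]
  refine Finset.card_le_card_of_injOn (fun s ↦ p ^ s) ?_
    (Nat.pow_right_injective hp.out.two_le).injOn
  intro s hs
  rw [Finset.mem_coe, Finset.mem_range] at hs
  change p ^ s ∈ extraGenerators p n 1
  rw [extraGenerators, Finset.mem_filter, Finset.mem_Ico, padicValNat.prime_pow]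
  have : 0 < p ^ s := pow_pos hp.out.pos _
  have : p ^ s ≤ p ^ (n - 1) := Nat.pow_le_pow_right hp.out.pos (by omega)
  omega

lemma card_extraGenerators_half (hp2 : p ≠ 2) (hn : 1 ≤ n) :
    (extraGenerators p n ((p ^ n - 1) / 2)).card = 1 := by
  rw [Finset.card_eq_one]
  refine ⟨(p ^ n - 1) / 2, ?_⟩
  have h1 := odd_pow (p := p) hp2 n
  have h2 := pow_pred_add_one_lt hn (Or.inl hp2)
  ext m
  rw [Finset.mem_singleton, extraGenerators, Finset.mem_filter, Finset.mem_Ico]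
  constructor
  · omega
  · rintro rfl
    have := pow_pos hp.out.pos (padicValNat p ((p ^ n - 1) / 2))
    omega

end Count

/-! ### Counting for the prime 2 -/

section Two

variable {n : ℕ}

/-- A nonempty set forces 0 < b < 2^(n-1), and then both b and 2^(n-1) are members. Hence a minimal
number of generators equal to two cannot occur. -/
lemma two_le_card_extraGenerators_two (hn : 1 ≤ n) {b : ℕ}
    (h : (extraGenerators 2 n b).card ≠ 0) : 2 ≤ (extraGenerators 2 n b).card := by
  rw [Finset.card_ne_zero] at h
  obtain ⟨m, hm⟩ := h
  rw [extraGenerators, Finset.mem_filter, Finset.mem_Ico] at hm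
  have h2 := pow_eq_mul_pow_pred (p := 2) hn
  have h1 : b ∈ extraGenerators 2 n b := by
    rw [extraGenerators, Finset.mem_filter, Finset.mem_Ico]
    have : 0 < 2 ^ padicValNat 2 b := by positivity
    omega
  have h3 : 2 ^ (n - 1) ∈ extraGenerators 2 n b := by
    rw [extraGenerators, Finset.mem_filter, Finset.mem_Ico, padicValNat.prime_pow]
    omega
  exact Finset.one_lt_card.2 ⟨b, h1, 2 ^ (n - 1), h3, by omega⟩

lemma card_extraGenerators_two (hn : 1 < n) :
    (extraGenerators 2 n (2 ^ (n - 1) - 1)).card = 2 := by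
  have h2 := pow_eq_mul_pow_pred (p := 2) hn.le
  have h1 : 1 < 2 ^ (n - 1) := Nat.one_lt_pow (by omega) (by omega)
  have : extraGenerators 2 n (2 ^ (n - 1) - 1) = {2 ^ (n - 1) - 1, 2 ^ (n - 1)} := by
    ext m
    rw [extraGenerators, Finset.mem_filter, Finset.mem_Ico, Finset.mem_insert,
      Finset.mem_singleton]
    constructor
    · omega
    · rintro (rfl | rfl)
      · have : 0 < 2 ^ padicValNat 2 (2 ^ (n - 1) - 1) := by positivity
        omega
      · rw [padicValNat.prime_pow]
        omega
  rw [this, Finset.card_pair (by omega)]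

lemma padicValNat_two_lt (hn : 1 ≤ n) {m : ℕ} (h1 : 2 ^ (n - 1) < m) (h2 : m < 2 ^ n) :
    padicValNat 2 m < n - 1 := by
  by_contra hv
  have h := pow_eq_mul_pow_pred (p := 2) hn
  have hd : 2 ^ (n - 1) ∣ m := (padicValNat_dvd_iff_le (by omega)).2 (by omega)
  have := eq_of_dvd_of_lt_add hd (dvd_refl (2 ^ (n - 1))) (by omega) (by omega)
  omega

/-- An integer strictly between 2^(n-1) and 2^n stays at or above 2^(n-1) when its lowest binary
digit is removed. -/
lemma extraCotangent_two_half (hn : 1 ≤ n) : extraCotangent 2 n (2 ^ (n - 1)) = ∅ := by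
  ext m
  rw [mem_extraCotangent]
  simp only [Finset.notMem_empty, iff_false]
  rintro ⟨⟨h1, h2⟩, h3, h4⟩
  have hlt : 2 ^ (n - 1) < m := lt_of_le_of_ne h1 (Ne.symm (h4 (n - 1)))
  have hv := padicValNat_two_lt hn hlt h2
  have hd : 2 ^ padicValNat 2 m ∣ m := pow_padicValNat_dvd
  have := eq_of_dvd_of_lt_add hd (pow_dvd_pow 2 hv.le) (by omega) (by omega)
  omega

lemma card_extraCotangent_two_le (hn : 1 ≤ n) {c : ℕ} (hc : 2 ^ (n - 1) ≤ c) :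
    (extraCotangent 2 n c).card ≤ n - 1 := by
  rcases hc.eq_or_lt with rfl | hc
  · rw [extraCotangent_two_half hn, Finset.card_empty]
    omega
  · exact card_extraCotangent_le_of_lt fun m h1 h2 ↦ padicValNat_two_lt hn (hc.trans_le h1) h2

/-- All valuations s < n - 1 must occur. A member of valuation s is an odd multiple of 2^s in [c, c
+ 2^s); letting s descend from n - 2 to 0 halves the possible distance from 2^(n-1) to c at each
step. -/
lemma eq_of_card_extraCotangent_two (hn : 1 < n) {c : ℕ} (hc : 2 ^ (n - 1) ≤ c)
    (h : (extraCotangent 2 n c).card = n - 1) : c = 2 ^ (n - 1) + 1 := by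
  have hq := pow_eq_mul_pow_pred (p := 2) hn.le
  have hcn : 2 ^ (n - 1) < c := by
    refine lt_of_le_of_ne hc ?_
    rintro rfl
    rw [extraCotangent_two_half hn.le, Finset.card_empty] at h
    omega
  have himg : (extraCotangent 2 n c).image (padicValNat 2) = Finset.range (n - 1) := by
    refine Finset.eq_of_subset_of_card_le ?_ ?_
    · intro v hv
      obtain ⟨m, hm, rfl⟩ := Finset.mem_image.1 hv
      rw [mem_extraCotangent] at hm
      exact Finset.mem_range.2 (padicValNat_two_lt hn.le (hcn.trans_le hm.1.1) hm.1.2)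
    · rw [Finset.card_image_of_injOn (injOn_extraCotangent c), h, Finset.card_range]
  have hlt : c < 2 ^ n := by
    by_contra hcon
    have : extraCotangent 2 n c = ∅ := by
      ext m
      rw [mem_extraCotangent]
      simp only [Finset.notMem_empty, iff_false]
      omega
    rw [this, Finset.card_empty] at h
    omega
  have key : ∀ d ≤ n - 1, c ≤ 2 ^ (n - 1) + 2 ^ (n - 1 - d) := by
    intro d
    induction d with
    | zero => intro _; rw [Nat.sub_zero]; omega
    | succ d ih =>
      intro hd
      have ih := ih (by omega)
      set s := n - 1 - (d + 1) with hs
      rw [show n - 1 - d = s + 1 by omega, pow_succ] at ih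
      have hmem : s ∈ (extraCotangent 2 n c).image (padicValNat 2) := by
        rw [himg, Finset.mem_range]
        omega
      obtain ⟨m, hm, hv⟩ := Finset.mem_image.1 hmem
      rw [mem_extraCotangent, hv] at hm
      have hm0 : 0 < m := by omega
      have hd1 : 2 ^ s ∣ m := by rw [← hv]; exact pow_padicValNat_dvd
      have hd2 : ¬ 2 ^ s * 2 ∣ m := by
        rw [← pow_succ]
        exact not_pow_padicValNat_succ_dvd hm0 (by omega)
      have hd3 : 2 ^ s * 2 ∣ 2 ^ (n - 1) := by
        rw [← pow_succ]
        exact pow_dvd_pow 2 (by omega)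
      by_contra hcon
      have hm1 : 2 ^ (n - 1) + 2 ^ s < m := by omega
      have hm2 : m < 2 ^ (n - 1) + 2 ^ s * 2 + 2 ^ s := by omega
      have hd4 : 2 ^ s ∣ 2 ^ (n - 1) + 2 ^ s * 2 :=
        dvd_add (Dvd.dvd.trans (dvd_mul_right _ _) hd3) (dvd_mul_right _ _)
      -- The only multiple of 2^s left for m is 2^(n-1) + 2·2^s, whose valuation exceeds s.
      have := eq_of_dvd_of_lt_add hd1 hd4 (by omega) (by omega)
      exact hd2 (this ▸ dvd_add hd3 dvd_rfl)
  have := key (n - 1) le_rfl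
  rw [Nat.sub_self, pow_zero] at this
  omega

end Two

/-! ### Algebras with a monomial basis: locality -/

/-- A `k`-basis `X_0 = 1, …, X_{q-1}` of a `k`-algebra such that `X_i X_j` is a multiple of
`X_{i+j}` (zero for `q ≤ i + j`). -/
structure MonomialBasis (k R : Type*) [CommRing k] [Ring R] [Algebra k R] (q : ℕ) where
  elt : ℕ → R
  basis : Module.Basis (Fin q) k R
  basis_apply : ∀ i : Fin q, basis i = elt i
  elt_zero : elt 0 = 1
  elt_of_le : ∀ i, q ≤ i → elt i = 0
  coeff : ℕ → ℕ → k
  elt_mul : ∀ i j, elt i * elt j = coeff i j • elt (i + j)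

namespace MonomialBasis

section Ring

variable {k R : Type*} [CommRing k] [Ring R] [Algebra k R] {q : ℕ} (B : MonomialBasis k R q)

/-- The coordinate of an element at `X_i`. -/
def coord (i : ℕ) : R →ₗ[k] k := if h : i < q then B.basis.coord ⟨i, h⟩ else 0

lemma coord_elt {i : ℕ} (j : ℕ) (hi : i < q) : B.coord i (B.elt j) = if i = j then 1 else 0 := by
  rw [coord, dif_pos hi]
  by_cases hj : j < q
  · have := B.basis_apply ⟨j, hj⟩
    simp only at this
    rw [← this, Module.Basis.coord_apply, Module.Basis.repr_self, Finsupp.single_apply]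
    simp [Fin.ext_iff, eq_comm]
  · rw [B.elt_of_le j (by omega), map_zero, if_neg (by omega)]

lemma sum_coord (x : R) : x = ∑ i ∈ Finset.range q, B.coord i x • B.elt i := by
  conv_lhs => rw [← B.basis.sum_repr x]
  rw [Finset.sum_range]
  refine Finset.sum_congr rfl fun i _ ↦ ?_
  rw [B.basis_apply, coord, dif_pos i.2, Module.Basis.coord_apply]

lemma hom_ext {N : Type*} [AddCommMonoid N] [Module k N] {f g : R →ₗ[k] N}
    (h : ∀ i < q, f (B.elt i) = g (B.elt i)) : f = g :=
  B.basis.ext fun i ↦ by rw [B.basis_apply]; exact h i i.2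

lemma coeff_zero_left {i : ℕ} (hi : i < q) : B.coeff 0 i = 1 := by
  have h := B.elt_mul 0 i
  rw [B.elt_zero, one_mul, zero_add] at h
  have := congrArg (B.coord i) h
  rw [map_smul, B.coord_elt i hi, if_pos rfl, smul_eq_mul, mul_one] at this
  exact this.symm

lemma coeff_zero_right {i : ℕ} (hi : i < q) : B.coeff i 0 = 1 := by
  have h := B.elt_mul i 0
  rw [B.elt_zero, mul_one, add_zero] at h
  have := congrArg (B.coord i) h
  rw [map_smul, B.coord_elt i hi, if_pos rfl, smul_eq_mul, mul_one] at this
  exact this.symm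

/-- Indices add under multiplication, so only X_0 X_0 contributes to X_0. -/
lemma coord_zero_mul (hq : 0 < q) (x y : R) :
    B.coord 0 (x * y) = B.coord 0 x * B.coord 0 y := by
  have : (LinearMap.mul k R).compr₂ (B.coord 0) =
      ((LinearMap.mul k k).compl₁₂ (B.coord 0) (B.coord 0)) := by
    refine B.hom_ext fun i hi ↦ B.hom_ext fun j hj ↦ ?_
    simp only [LinearMap.compr₂_apply, LinearMap.mul_apply', LinearMap.compl₁₂_apply, B.elt_mul,
      map_smul, B.coord_elt _ hq, smul_eq_mul]
    by_cases h : i = 0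
    · subst h
      rw [B.coeff_zero_left hj, zero_add, if_pos rfl]
    · rw [if_neg (Ne.symm h), if_neg (by omega), mul_zero, zero_mul]
  exact congrFun (congrArg DFunLike.coe (congrFun (congrArg DFunLike.coe this) x)) y

/-- The augmentation of an algebra with a monomial basis. -/
def aug (hq : 0 < q) : R →ₐ[k] k :=
  AlgHom.ofLinearMap (B.coord 0) (by rw [← B.elt_zero, B.coord_elt 0 hq, if_pos rfl])
    (B.coord_zero_mul hq)

@[simp] lemma aug_apply (hq : 0 < q) (x : R) : B.aug hq x = B.coord 0 x := rfl

/-- The span of the basis elements of index at least `s`. -/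
def tail (s : ℕ) : Submodule k R := Submodule.span k (B.elt '' Set.Ici s)

lemma tail_eq_bot {s : ℕ} (hs : q ≤ s) : B.tail s = ⊥ := by
  rw [tail, Submodule.span_eq_bot]
  rintro _ ⟨i, hi, rfl⟩
  exact B.elt_of_le i (hs.trans hi)

lemma mul_mem_tail {s s' : ℕ} {x y : R} (hx : x ∈ B.tail s) (hy : y ∈ B.tail s') :
    x * y ∈ B.tail (s + s') := by
  rw [tail] at hx hy
  induction hx using Submodule.span_induction with
  | mem x hx =>
    obtain ⟨i, hi, rfl⟩ := hx
    induction hy using Submodule.span_induction with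
    | mem y hy =>
      obtain ⟨j, hj, rfl⟩ := hy
      rw [B.elt_mul]
      exact Submodule.smul_mem _ _ (Submodule.subset_span ⟨i + j, Nat.add_le_add hi hj, rfl⟩)
    | zero => rw [mul_zero]; exact zero_mem _
    | add y z _ _ h1 h2 => rw [mul_add]; exact add_mem h1 h2
    | smul a y _ h1 => rw [mul_smul_comm]; exact Submodule.smul_mem _ _ h1
  | zero => rw [zero_mul]; exact zero_mem _
  | add y z _ _ h1 h2 => rw [add_mul]; exact add_mem h1 h2
  | smul a y _ h1 => rw [smul_mul_assoc]; exact Submodule.smul_mem _ _ h1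

/-- The s-th power lies in the tail of index s, and tails vanish from q on. -/
lemma isNilpotent_of_mem_tail {x : R} (hx : x ∈ B.tail 1) : IsNilpotent x := by
  have h : ∀ s : ℕ, x ^ (s + 1) ∈ B.tail (s + 1) := by
    intro s
    induction s with
    | zero => simpa using hx
    | succ s ih => rw [pow_succ]; exact B.mul_mem_tail ih hx
  refine ⟨q + 1, ?_⟩
  have := h q
  rwa [B.tail_eq_bot (Nat.le_succ q), Submodule.mem_bot] at this

lemma mem_tail_one {x : R} (hx : B.coord 0 x = 0) : x ∈ B.tail 1 := by
  rw [B.sum_coord x]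
  refine Submodule.sum_mem _ fun i _ ↦ ?_
  rcases Nat.eq_zero_or_pos i with rfl | hi
  · rw [hx, zero_smul]; exact zero_mem _
  · exact Submodule.smul_mem _ _ (Submodule.subset_span ⟨i, hi, rfl⟩)

/-- The element is a unit scalar plus a nilpotent element, and scalars are central. -/
lemma isUnit_of_isUnit_coord (hq : 0 < q) {x : R} (hx : IsUnit (B.coord 0 x)) : IsUnit x := by
  have h1 : x - algebraMap k R (B.coord 0 x) ∈ B.tail 1 := by
    refine B.mem_tail_one ?_
    rw [map_sub, sub_eq_zero, ← B.aug_apply hq (algebraMap k R _), AlgHom.commutes]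
    rfl
  have h2 := B.isNilpotent_of_mem_tail h1
  have h3 := (Algebra.commutes (B.coord 0 x) (x - algebraMap k R (B.coord 0 x)))
  have := h2.isUnit_add_left_of_commute (hx.map (algebraMap k R))
    (show Commute _ _ from h3.symm)
  simpa using this

lemma isUnit_iff (hq : 0 < q) {x : R} : IsUnit x ↔ IsUnit (B.coord 0 x) :=
  ⟨fun h ↦ h.map (B.aug hq), B.isUnit_of_isUnit_coord hq⟩

end Ring

section Local

variable {k R : Type*} [CommRing k] [IsLocalRing k] [Ring R] [Algebra k R] {q : ℕ}
  (B : MonomialBasis k R q) (hq : 0 < q)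

/-- The residue map of an algebra with a monomial basis over a local ring. -/
def res : R →+* ResidueField k := (residue k).comp (B.aug hq : R →+* k)

lemma res_apply (x : R) : B.res hq x = residue k (B.coord 0 x) := rfl

lemma res_algebraMap (a : k) : B.res hq (algebraMap k R a) = residue k a := by
  rw [res_apply, ← B.aug_apply hq, AlgHom.commutes]
  rfl

lemma res_surjective : Function.Surjective (B.res hq) := fun y ↦ by
  obtain ⟨a, rfl⟩ := residue_surjective y
  exact ⟨algebraMap k R a, B.res_algebraMap hq a⟩

lemma res_eq_zero_iff {x : R} : B.res hq x = 0 ↔ ¬ IsUnit x := by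
  rw [res_apply, residue_eq_zero_iff, mem_maximalIdeal, mem_nonunits_iff, B.isUnit_iff hq]

include B hq in
lemma nontrivial : Nontrivial R := (B.res hq).domain_nontrivial

include B hq in
lemma isLocalRing : IsLocalRing R := by
  have := B.nontrivial hq
  refine IsLocalRing.of_nonunits_add fun a b ha hb ↦ ?_
  rw [mem_nonunits_iff, ← B.res_eq_zero_iff hq] at *
  rw [map_add, ha, hb, add_zero]

/-- The kernel of the residue map is exactly the set of nonunits, so it contains, hence equals,
every maximal left ideal. -/
lemma mem_jacobson {x : R} : x ∈ Ring.jacobson R ↔ B.res hq x = 0 := by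
  have := B.nontrivial hq
  constructor
  · intro h
    by_contra h0
    rw [B.res_eq_zero_iff, not_not] at h0
    exact (Ring.jacobson_lt_top R).ne (Ideal.eq_top_of_isUnit_mem _ h h0)
  · intro h
    rw [Ring.jacobson_eq_sInf_isMaximal, Submodule.mem_sInf]
    intro I hI
    have hle : I ≤ RingHom.ker (B.res hq) := by
      intro y hy
      rw [RingHom.mem_ker, B.res_eq_zero_iff]
      exact fun hu ↦ hI.ne_top (Ideal.eq_top_of_isUnit_mem _ hy hu)
    rw [hI.eq_of_le (RingHom.ker_ne_top _) hle]
    exact h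

include B hq in
theorem isLocalWithResidueField : IsLocalWithResidueField k R := by
  refine ⟨B.isLocalRing hq, ?_, ?_⟩
  · intro y
    obtain ⟨x, rfl⟩ := Ideal.Quotient.mk_surjective y
    obtain ⟨a, ha⟩ := residue_surjective (B.res hq x)
    refine ⟨a, ?_⟩
    simp only
    rw [Ideal.Quotient.eq, B.mem_jacobson hq, map_sub, B.res_algebraMap, ha, sub_self]
  · intro a
    rw [B.mem_jacobson hq, B.res_algebraMap, residue_eq_zero_iff]

/-- The residue ring of an algebra with a monomial basis is the residue field of the base. -/
def quotientHom : R ⧸ Ring.jacobson R →+* ResidueField k :=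
  Ideal.Quotient.lift _ (B.res hq) fun _ h ↦ (B.mem_jacobson hq).1 h

lemma quotientHom_bijective : Function.Bijective (B.quotientHom hq) := by
  constructor
  · rw [injective_iff_map_eq_zero]
    intro y hy
    obtain ⟨x, rfl⟩ := Ideal.Quotient.mk_surjective y
    exact Ideal.Quotient.eq_zero_iff_mem.2 ((B.mem_jacobson hq).2 hy)
  · intro y
    obtain ⟨x, rfl⟩ := B.res_surjective hq y
    exact ⟨Ideal.Quotient.mk _ x, rfl⟩

end Local

/-! ### The cotangent space of a monomial algebra -/

section EmbeddingDim

open Classical in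
/-- Division by `t`, for elements divisible by `t`. -/
def divBy {k : Type*} [CommRing k] (t a : k) : k := if h : t ∣ a then h.choose else 0

lemma divBy_mul {k : Type*} [CommRing k] [IsDomain k] {t : k} (ht : t ≠ 0) (a : k) : divBy t (t * a) = a := by
  have h : t ∣ t * a := dvd_mul_right t a
  rw [divBy, dif_pos h]
  exact (mul_left_cancel₀ ht h.choose_spec).symm

variable {k R : Type*} [CommRing k] [IsDomain k] [IsDiscreteValuationRing k] [Ring R]
  [Algebra k R] {q : ℕ} (B : MonomialBasis k R q) (hq : 0 < q)

/-- The positive indices `i` such that `X_i` is not, up to a unit, a product `X_j X_l` with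
`0 < j, l`. -/
def Indecomposable (i : ℕ) : Prop :=
  0 < i ∧ i < q ∧ ∀ j l, 0 < j → 0 < l → j + l = i → ¬ IsUnit (B.coeff j l)

/-- Modulo the maximal ideal of k, the coordinate at an indecomposable index is a derivation along
the augmentation: the mixed products X_j X_l with j, l > 0 contribute only nonunit coefficients. On
the maximal ideal it therefore kills products. -/
lemma residue_coord_mul {i : ℕ} (hi : B.Indecomposable i) (x y : R) :
    residue k (B.coord i (x * y)) =
      residue k (B.coord 0 x * B.coord i y + B.coord i x * B.coord 0 y) := by
  obtain ⟨hi0, hiq, hi⟩ := hi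
  have hq : 0 < q := hi0.trans hiq
  let f : k →ₗ[k] ResidueField k := Algebra.linearMap k _
  have hf : ∀ a, f a = residue k a := fun a ↦ rfl
  have : (LinearMap.mul k R).compr₂ (f ∘ₗ B.coord i) =
      ((LinearMap.mul k k).compl₁₂ (B.coord 0) (B.coord i) +
        (LinearMap.mul k k).compl₁₂ (B.coord i) (B.coord 0)).compr₂ f := by
    refine B.hom_ext fun j hj ↦ B.hom_ext fun l hl ↦ ?_
    simp only [LinearMap.compr₂_apply, LinearMap.mul_apply', LinearMap.compl₁₂_apply, B.elt_mul,
      map_smul, B.coord_elt _ hq, B.coord_elt _ hiq, LinearMap.add_apply,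
      LinearMap.comp_apply]
    clear_value f
    by_cases hj0 : j = 0
    · subst hj0
      rw [B.coeff_zero_left hl, zero_add, if_neg (by omega : ¬ i = 0)]
      simp
    by_cases hl0 : l = 0
    · subst hl0
      rw [B.coeff_zero_right hj, add_zero, if_neg (by omega : ¬ i = 0)]
      simp
    rw [if_neg (Ne.symm hj0), if_neg (Ne.symm hl0)]
    by_cases hjl : i = j + l
    · rw [if_pos hjl, ← map_smul, hf, hf, smul_eq_mul, mul_one, zero_mul, mul_zero, add_zero,
        map_zero, residue_eq_zero_iff]
      exact hi j l (by omega) (by omega) hjl.symm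
    · simp [hjl]
  exact congrFun (congrArg DFunLike.coe (congrFun (congrArg DFunLike.coe this) x)) y

open Classical in
/-- The coordinate map whose kernel is the square of the maximal ideal. -/
def cotangentMap {t : k} (ht : Irreducible t) :
    Ring.jacobson R →ₛₗ[B.res hq]
      ({i : Fin q // i.1 = 0 ∨ B.Indecomposable i} → ResidueField k) where
  toFun x i := if i.1.1 = 0 then residue k (divBy t (B.coord 0 x.1))
    else residue k (B.coord i.1 x.1)
  map_add' x y := by
    have hm : ∀ z : Ring.jacobson R, ∃ a, B.coord 0 z.1 = t * a := by
      intro z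
      have := (B.mem_jacobson hq).1 z.2
      rwa [res_apply, residue_eq_zero_iff, ht.maximalIdeal_eq, Ideal.mem_span_singleton] at this
    ext i
    obtain ⟨a, ha⟩ := hm x
    obtain ⟨b, hb⟩ := hm y
    simp only [Pi.add_apply]
    split_ifs
    · rw [Submodule.coe_add, map_add, ha, hb, ← mul_add, divBy_mul ht.ne_zero,
        divBy_mul ht.ne_zero, divBy_mul ht.ne_zero, map_add]
    · rw [Submodule.coe_add, map_add, map_add]
  map_smul' r x := by
    have hm := (B.mem_jacobson hq).1 x.2
    rw [res_apply, residue_eq_zero_iff, ht.maximalIdeal_eq, Ideal.mem_span_singleton] at hm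
    obtain ⟨a, ha⟩ := hm
    ext i
    simp only [Pi.smul_apply, smul_eq_mul, res_apply]
    split_ifs with h
    · rw [Submodule.coe_smul, smul_eq_mul, B.coord_zero_mul hq, ha, divBy_mul ht.ne_zero,
        mul_left_comm, divBy_mul ht.ne_zero, map_mul]
    · rw [Submodule.coe_smul, smul_eq_mul, B.residue_coord_mul (i.2.resolve_left h), map_add,
        map_mul, ha, map_mul, map_mul, (residue_eq_zero_iff t).2 ht.not_isUnit, zero_mul, mul_zero,
        add_zero]

lemma cotangentMap_apply {t : k} (ht : Irreducible t) (x : Ring.jacobson R)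
    (i : {i : Fin q // i.1 = 0 ∨ B.Indecomposable i}) :
    B.cotangentMap hq ht x i = if i.1.1 = 0 then residue k (divBy t (B.coord 0 x.1))
      else residue k (B.coord i.1 x.1) := by
  classical
  simp [cotangentMap]

lemma cotangentMap_surjective {t : k} (ht : Irreducible t) :
    Function.Surjective (B.cotangentMap hq ht) := by
  classical
  intro f
  choose g hg using fun i ↦ residue_surjective (f i)
  let a : ℕ → k := fun i ↦ if h : i < q then
    (if h' : i = 0 ∨ B.Indecomposable i then g ⟨⟨i, h⟩, h'⟩ else 0) else 0
  have ha : ∀ i : {i : Fin q // i.1 = 0 ∨ B.Indecomposable i}, a i.1 = g i := by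
    intro i
    simp only [a]
    rw [dif_pos i.1.2, dif_pos i.2]
  let x : R := ∑ i ∈ Finset.range q, (if i = 0 then t * a 0 else a i) • B.elt i
  have hx : ∀ i < q, B.coord i x = if i = 0 then t * a 0 else a i := by
    intro i hi
    simp only [x, map_sum, map_smul, B.coord_elt _ hi, smul_eq_mul, mul_ite, mul_one, mul_zero]
    rw [Finset.sum_ite_eq, if_pos (Finset.mem_range.2 hi)]
  have hxJ : x ∈ Ring.jacobson R := by
    rw [B.mem_jacobson hq, res_apply, hx 0 hq, if_pos rfl, map_mul,
      (residue_eq_zero_iff t).2 ht.not_isUnit, zero_mul]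
  refine ⟨⟨x, hxJ⟩, ?_⟩
  ext i
  rw [cotangentMap_apply, ← hg i, ← ha i]
  split_ifs with h
  · rw [hx 0 hq, if_pos rfl, divBy_mul ht.ne_zero, h]
  · rw [hx _ i.1.2, if_neg h]

include hq in
lemma elt_mem_jacobson {i : ℕ} (hi : 0 < i) : B.elt i ∈ Ring.jacobson R := by
  rw [B.mem_jacobson hq, res_apply, B.coord_elt i hq, if_neg hi.ne, map_zero]

include B hq in
lemma algebraMap_mem_jacobson {t : k} (ht : Irreducible t) :
    algebraMap k R t ∈ Ring.jacobson R := by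
  rw [B.mem_jacobson hq, res_algebraMap, (residue_eq_zero_iff t).2 ht.not_isUnit]

/-- Elements of the kernel are combinations of t², of t X_i with i indecomposable, and of X_i with i
decomposable, the last being unit multiples of some X_j X_l; all of these lie in 𝔐². Conversely the
map is semilinear along the residue map, so it kills 𝔐². -/
lemma ker_cotangentMap {t : k} (ht : Irreducible t) (x : Ring.jacobson R) :
    B.cotangentMap hq ht x = 0 ↔
      x ∈ (Ring.jacobson R • (⊤ : Submodule R (Ring.jacobson R))) := by
  constructor
  · intro h
    let S : Submodule R R := Submodule.map (Ring.jacobson R).subtype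
      (Ring.jacobson R • (⊤ : Submodule R (Ring.jacobson R)))
    have hmul : ∀ y z : R, y ∈ Ring.jacobson R → z ∈ Ring.jacobson R → y * z ∈ S := by
      intro y z hy hz
      exact ⟨y • ⟨z, hz⟩, Submodule.smul_mem_smul hy trivial, rfl⟩
    have hsm : ∀ (a : k) (y : R), y ∈ S → a • y ∈ S := by
      intro a y hy
      rw [Algebra.smul_def, ← smul_eq_mul]
      exact S.smul_mem _ hy
    suffices hx : x.1 ∈ S by
      obtain ⟨y, hy, hyx⟩ := hx
      rwa [← Subtype.ext hyx]
    rw [B.sum_coord x.1]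
    refine Submodule.sum_mem _ fun i hi ↦ ?_
    have hiq := Finset.mem_range.1 hi
    by_cases hi0 : i = 0
    · subst hi0
      have hm := (B.mem_jacobson hq).1 x.2
      rw [res_apply, residue_eq_zero_iff, ht.maximalIdeal_eq, Ideal.mem_span_singleton] at hm
      obtain ⟨a, ha⟩ := hm
      have h0 := congrFun h ⟨⟨0, hq⟩, Or.inl rfl⟩
      rw [cotangentMap_apply, if_pos rfl, ha, divBy_mul ht.ne_zero, Pi.zero_apply,
        residue_eq_zero_iff, ht.maximalIdeal_eq, Ideal.mem_span_singleton] at h0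
      obtain ⟨b, rfl⟩ := h0
      rw [ha, B.elt_zero, ← Algebra.algebraMap_eq_smul_one, ← mul_assoc, mul_comm (t * t),
        map_mul, map_mul, ← smul_eq_mul]
      exact S.smul_mem _ (hmul _ _ (B.algebraMap_mem_jacobson hq ht)
        (B.algebraMap_mem_jacobson hq ht))
    by_cases hind : B.Indecomposable i
    · have h0 := congrFun h ⟨⟨i, hiq⟩, Or.inr hind⟩
      rw [cotangentMap_apply, if_neg hi0, Pi.zero_apply,
        residue_eq_zero_iff, ht.maximalIdeal_eq, Ideal.mem_span_singleton] at h0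
      obtain ⟨b, hb⟩ := h0
      simp only at hb
      rw [hb, mul_comm, mul_smul, Algebra.smul_def t]
      exact hsm _ _ (hmul _ _ (B.algebraMap_mem_jacobson hq ht)
        (B.elt_mem_jacobson hq (Nat.pos_of_ne_zero hi0)))
    · simp only [Indecomposable, not_and, not_forall, not_not] at hind
      obtain ⟨j, l, hj, hl, rfl, hu⟩ := hind (Nat.pos_of_ne_zero hi0) hiq
      refine hsm _ _ ?_
      have : B.elt (j + l) = (hu.unit⁻¹ : kˣ).1 • (B.elt j * B.elt l) := by
        rw [B.elt_mul, smul_smul, IsUnit.val_inv_mul, one_smul]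
      rw [this]
      exact hsm _ _ (hmul _ _ (B.elt_mem_jacobson hq hj) (B.elt_mem_jacobson hq hl))
  · intro h
    have : Ring.jacobson R • (⊤ : Submodule R (Ring.jacobson R)) ≤
        LinearMap.ker (B.cotangentMap hq ht) := by
      rw [Submodule.smul_le]
      intro r hr y _
      rw [LinearMap.mem_ker, LinearMap.map_smulₛₗ, (B.mem_jacobson hq).1 hr, zero_smul]
    exact this h

include B hq in
open Classical in
theorem embeddingDim_eq :
    embeddingDim R =
      ((1 + (Finset.univ.filter fun i : Fin q ↦ B.Indecomposable i).card : ℕ) : Cardinal) := by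
  obtain ⟨t, ht⟩ := IsDiscreteValuationRing.exists_irreducible k
  let J2 := Ring.jacobson R • (⊤ : Submodule R (Ring.jacobson R))
  let T := {i : Fin q // i.1 = 0 ∨ B.Indecomposable i}
  let f : (Ring.jacobson R ⧸ J2) →+ (T → ResidueField k) :=
    QuotientAddGroup.lift J2.toAddSubgroup (B.cotangentMap hq ht).toAddMonoidHom
      (fun x hx ↦ (B.ker_cotangentMap hq ht x).2 hx)
  have hf : Function.Bijective f := by
    constructor
    · rw [injective_iff_map_eq_zero]
      intro y hy
      obtain ⟨x, rfl⟩ := Submodule.Quotient.mk_surjective _ y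
      exact (Submodule.Quotient.mk_eq_zero _).2 ((B.ker_cotangentMap hq ht x).1 hy)
    · intro y
      obtain ⟨x, rfl⟩ := B.cotangentMap_surjective hq ht y
      exact ⟨Submodule.Quotient.mk x, rfl⟩
  -- The rank is over R/𝔐, while the target is a space over the residue field of k; `quotientHom`
  -- identifies the two scalar rings.
  have key := lift_rank_eq_of_equiv_equiv (R := R ⧸ Ring.jacobson R) (R' := ResidueField k)
    (B.quotientHom hq) (AddEquiv.ofBijective f hf) (B.quotientHom_bijective hq) (by
      intro r m
      obtain ⟨r, rfl⟩ := Ideal.Quotient.mk_surjective r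
      obtain ⟨x, rfl⟩ := Submodule.Quotient.mk_surjective _ m
      exact (B.cotangentMap hq ht).map_smulₛₗ r x)
  rw [rank_fun'] at key
  have hc : Fintype.card T =
      1 + (Finset.univ.filter fun i : Fin q ↦ B.Indecomposable i).card := by
    rw [Fintype.card_subtype, Finset.filter_or, Finset.card_union_of_disjoint]
    · congr 1
      rw [Finset.card_eq_one]
      refine ⟨⟨0, hq⟩, ?_⟩
      ext i
      simp [Fin.ext_iff]
    · rw [Finset.disjoint_filter]
      intro i _ hi h
      exact h.1.ne' hi
  rw [hc, Cardinal.lift_natCast] at key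
  exact Cardinal.lift_injective (key.trans (Cardinal.lift_natCast _).symm)

end EmbeddingDim

end MonomialBasis

/-! ### Modules over a monomial algebra: minimal generators and freeness -/

/-- A `k`-basis `x_0, …, x_{q-1}` of a module over an algebra with monomial basis
`X_0, …, X_{q-1}` such that `X_i x_j` is a multiple of `x_{j-i}` (zero for `j < i`). -/
structure MonomialModule {k R : Type*} [CommRing k] [Ring R] [Algebra k R] {q : ℕ}
    (B : MonomialBasis k R q) (M : Type*) [AddCommGroup M] [Module k M] [Module R M] where
  vec : ℕ → M
  basis : Module.Basis (Fin q) k M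
  basis_apply : ∀ i : Fin q, basis i = vec i
  coeff : ℕ → ℕ → k
  elt_smul : ∀ i j, i < q → j < q → B.elt i • vec j = coeff i j • vec (j - i)
  coeff_of_lt : ∀ i j, j < i → coeff i j = 0

namespace MonomialModule

variable {k R : Type*} [CommRing k] [Ring R] [Algebra k R] {q : ℕ}
  {B : MonomialBasis k R q} {M : Type*} [AddCommGroup M] [Module k M] [Module R M]
  (C : MonomialModule B M)

/-- The indices `j` such that `x_j` is not, up to a unit, of the form `X_i x_{i+j}` with `0 < i`. -/
def IsGenerator (j : ℕ) : Prop :=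
  ∀ i, 0 < i → i + j < q → ¬ IsUnit (C.coeff i (i + j))

lemma coeff_zero_left [IsScalarTower k R M] {j : ℕ} (hj : j < q) : C.coeff 0 j = 1 := by
  have h := C.elt_smul 0 j (by omega) hj
  rw [B.elt_zero, one_smul, Nat.sub_zero, ← C.basis_apply ⟨j, hj⟩] at h
  have := congrArg (C.basis.coord ⟨j, hj⟩) h
  rw [map_smul, Module.Basis.coord_apply, Module.Basis.repr_self, Finsupp.single_eq_same,
    smul_eq_mul, mul_one] at this
  exact this.symm

lemma coord_vec (i : Fin q) {j : ℕ} (hj : j < q) :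
    C.basis.coord i (C.vec j) = if i.1 = j then 1 else 0 := by
  rw [← C.basis_apply ⟨j, hj⟩, Module.Basis.coord_apply, Module.Basis.repr_self,
    Finsupp.single_apply]
  simp [Fin.ext_iff, eq_comm]

/-- Descending induction on j: a vector that is not a generator is a unit multiple of X_i x_(i+j)
with i > 0. -/
lemma span_generators [IsScalarTower k R M] :
    Submodule.span R (C.vec '' {j | j < q ∧ C.IsGenerator j}) = ⊤ := by
  let N := Submodule.span R (C.vec '' {j | j < q ∧ C.IsGenerator j})
  have hsm : ∀ (a : k) (y : M), y ∈ N → a • y ∈ N := by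
    intro a y hy
    rw [← algebraMap_smul R a y]
    exact N.smul_mem _ hy
  have h : ∀ d j, j < q → q - j ≤ d → C.vec j ∈ N := by
    intro d
    induction d with
    | zero => intro j hj hd; omega
    | succ d ih =>
      intro j hj hd
      by_cases hg : C.IsGenerator j
      · exact Submodule.subset_span ⟨j, ⟨hj, hg⟩, rfl⟩
      · simp only [IsGenerator, not_forall, not_not] at hg
        obtain ⟨i, hi0, hiq, hu⟩ := hg
        have := C.elt_smul i (i + j) (by omega) hiq
        rw [Nat.add_sub_cancel_left] at this
        have h2 : C.vec j = (hu.unit⁻¹ : kˣ).1 • (B.elt i • C.vec (i + j)) := by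
          rw [this, smul_smul, IsUnit.val_inv_mul, one_smul]
        rw [h2]
        exact hsm _ _ (N.smul_mem _ (ih (i + j) hiq (by omega)))
  rw [eq_top_iff]
  rintro x -
  rw [← C.basis.sum_repr x]
  refine Submodule.sum_mem _ fun i _ ↦ hsm _ _ ?_
  rw [C.basis_apply]
  exact h _ i i.2 le_rfl

variable [IsLocalRing k]

/-- The X_i with i > 0 reach a generator index only with nonunit coefficients, so modulo the maximal
ideal of k an element of R acts on this coordinate through its augmentation. -/
lemma residue_coord_smul [IsScalarTower k R M] {i : Fin q} (hi : C.IsGenerator i) (r : R) (x : M) :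
    residue k (C.basis.coord i (r • x)) = residue k (B.coord 0 r * C.basis.coord i x) := by
  have hq : 0 < q := i.pos
  let f : k →ₗ[k] ResidueField k := Algebra.linearMap k _
  have hf : ∀ a, f a = residue k a := fun a ↦ rfl
  have : ((LinearMap.lsmul k k).compl₁₂ (B.coord 0) (C.basis.coord i)).compr₂ f =
      ((Algebra.lsmul k k M).toLinearMap : R →ₗ[k] M →ₗ[k] M).compr₂
        (f ∘ₗ C.basis.coord i) := by
    refine B.hom_ext fun j hj ↦ C.basis.ext fun l ↦ ?_
    rw [C.basis_apply]
    simp only [LinearMap.compr₂_apply, LinearMap.compl₁₂_apply, LinearMap.comp_apply,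
      AlgHom.toLinearMap_apply, Algebra.lsmul_coe, C.elt_smul j l hj l.2, LinearMap.lsmul_apply,
      map_smul, B.coord_elt _ hq, smul_eq_mul, C.coord_vec i l.2]
    by_cases hlj : l.1 < j
    · rw [C.coeff_of_lt _ _ hlj, zero_smul, if_neg (by omega), zero_mul, map_zero]
    rw [C.coord_vec i (show l.1 - j < q by omega)]
    by_cases hj0 : j = 0
    · subst hj0
      rw [C.coeff_zero_left l.2, if_pos rfl, Nat.sub_zero, one_mul, one_smul]
    · rw [if_neg (Ne.symm hj0), zero_mul, map_zero, eq_comm]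
      by_cases hjl : i.1 = l - j
      · rw [if_pos hjl, ← map_smul, hf, residue_eq_zero_iff, smul_eq_mul, mul_one]
        have := hi j (by omega) (by omega)
        rwa [show j + i.1 = l by omega] at this
      · rw [if_neg hjl, map_zero, smul_zero]
  exact (congrFun (congrArg DFunLike.coe (congrFun (congrArg DFunLike.coe this) r)) x).symm

/-- The coordinates of a module modulo the maximal ideal, at the indices of generators. -/
def generatorMap [IsScalarTower k R M] (hq : 0 < q) :
    M →ₛₗ[B.res hq] ({i : Fin q // C.IsGenerator i} → ResidueField k) where
  toFun x i := residue k (C.basis.coord i.1 x)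
  map_add' x y := by ext i; simp
  map_smul' r x := by
    ext i
    rw [C.residue_coord_smul i.2, map_mul]
    rfl

lemma generatorMap_surjective [IsScalarTower k R M] (hq : 0 < q) :
    Function.Surjective (C.generatorMap hq) := by
  classical
  intro f
  choose g hg using fun i ↦ residue_surjective (f i)
  refine ⟨∑ i : Fin q, (if h : C.IsGenerator i then g ⟨i, h⟩ else 0) • C.basis i, ?_⟩
  ext i
  change residue k (C.basis.coord i.1 _) = _
  rw [Module.Basis.coord_apply, Module.Basis.repr_sum_self, dif_pos i.2, hg]

open Classical in
theorem spanRank_eq [IsScalarTower k R M] (hq : 0 < q) :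
    (⊤ : Submodule R M).spanRank =
      (((Finset.univ.filter fun i : Fin q ↦ C.IsGenerator i).card : ℕ) : Cardinal) := by
  apply le_antisymm
  · rw [← C.span_generators]
    refine (Submodule.spanRank_span_le_card _).trans ?_
    have : C.vec '' {j | j < q ∧ C.IsGenerator j} =
        ((Finset.univ.filter fun i : Fin q ↦ C.IsGenerator i).image fun i : Fin q ↦ C.vec i :
          Finset M) := by
      ext x
      simp only [Set.mem_image, Set.mem_ofPred_eq, Finset.coe_image, Finset.coe_filter,
        Finset.mem_univ, true_and]
      exact ⟨fun ⟨j, ⟨hj, hg⟩, h⟩ ↦ ⟨⟨j, hj⟩, hg, h⟩, fun ⟨j, hg, h⟩ ↦ ⟨j, ⟨j.2, hg⟩, h⟩⟩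
    rw [this, Finset.coe_sort_coe, Cardinal.mk_coe_finset, Nat.cast_le]
    exact Finset.card_image_le
  -- Lower bound: the coordinates at generator indices map the module onto a residue field vector
  -- space of the right dimension.
  · have : RingHomSurjective (B.res hq) := ⟨B.res_surjective hq⟩
    have h1 := Submodule.lift_spanRank_map_le (C.generatorMap hq) ⊤
    rw [Submodule.map_top, LinearMap.range_eq_top.2 (C.generatorMap_surjective hq)] at h1
    have h2 := Submodule.rank_le_spanRank (R := ResidueField k)
      (M := {i : Fin q // C.IsGenerator i} → ResidueField k)
    rw [rank_fun', Fintype.card_subtype] at h2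
    have h3 := (Cardinal.lift_le.2 h2).trans h1
    rw [Cardinal.lift_natCast] at h3
    rwa [← Cardinal.lift_le, Cardinal.lift_natCast]

omit [IsLocalRing k] in
theorem free_of_forall_isGenerator [IsScalarTower k R M]
    (h : ∀ j < q, C.IsGenerator j → j = q - 1) : Module.Free R M := by
  have hspan : Submodule.span R {C.vec (q - 1)} = ⊤ := by
    rw [eq_top_iff, ← C.span_generators]
    refine Submodule.span_mono ?_
    rintro _ ⟨j, ⟨hj, hg⟩, rfl⟩
    rw [h j hj hg]
    rfl
  let f : R →ₗ[R] M := LinearMap.toSpanSingleton R M (C.vec (q - 1))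
  have hf : Function.Surjective f := by
    rw [← LinearMap.range_eq_top, LinearMap.range_toSpanSingleton, hspan]
  let e : M ≃ₗ[k] R := C.basis.equiv B.basis (Equiv.refl _)
  have hinj : Function.Injective f := by
    have : Module.Finite k R := Module.Finite.of_basis B.basis
    -- R and M are both free of rank q over k, so a surjection between them is injective.
    have h2 : Function.Injective (e.toLinearMap ∘ₗ f.restrictScalars k) :=
      OrzechProperty.injective_of_surjective_endomorphism _ (e.surjective.comp hf)
    exact Function.Injective.of_comp (f := e) h2
  exact Module.Free.of_equiv (LinearEquiv.ofBijective f ⟨hinj, hf⟩)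

-- An R-basis of M and the k-basis of R combine to a k-basis of M of size q times the rank, and M
-- has k-rank q; so the rank is one.
include C in
theorem spanRank_le_one_of_free [IsScalarTower k R M] (hq : 0 < q) [Module.Free R M] :
    (⊤ : Submodule R M).spanRank ≤ 1 := by
  have : Nontrivial R := B.nontrivial hq
  have := B.isLocalRing hq
  let b := Module.Free.chooseBasis R M
  let b2 := B.basis.smulTower b
  let g := b2.indexEquiv C.basis
  have hc := Nat.card_congr g
  rw [Nat.card_prod, Nat.card_fin] at hc
  have h1 : Nat.card (Module.Free.ChooseBasisIndex R M) = 1 :=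
    Nat.eq_of_mul_eq_mul_left hq (hc.trans (mul_one q).symm)
  obtain ⟨hs, ⟨i⟩⟩ := Nat.card_eq_one_iff_unique.1 h1
  rw [← b.span_eq]
  refine (Submodule.spanRank_span_le_card _).trans ?_
  rw [Cardinal.le_one_iff_subsingleton]
  refine ⟨fun x y ↦ ?_⟩
  obtain ⟨_, a, rfl⟩ := x
  obtain ⟨_, c, rfl⟩ := y
  exact Subtype.ext (congrArg b (Subsingleton.elim a c))

end MonomialModule

/-! ### The normalised valuation and fractional ideals -/

section Val

variable (OL : Type*) (L : Type*) [CommRing OL] [IsDomain OL] [IsDiscreteValuationRing OL]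
  [Field L] [Algebra OL L] [IsFractionRing OL L]

/-- The normalised valuation of `L`, with values in `ℤᵐ⁰`. -/
def val : Valuation L ℤᵐ⁰ := (IsDiscreteValuationRing.maximalIdeal OL).valuation L

variable {OL L}

lemma val_algebraMap_le_one (a : OL) : val OL L (algebraMap OL L a) ≤ 1 :=
  IsDedekindDomain.HeightOneSpectrum.valuation_le_one _ a

lemma val_algebraMap_le_exp_iff (a : OL) (i : ℕ) :
    val OL L (algebraMap OL L a) ≤ exp (-(i : ℤ)) ↔ a ∈ maximalIdeal OL ^ i := by
  rw [val, IsDedekindDomain.HeightOneSpectrum.valuation_of_algebraMap,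
    IsDedekindDomain.HeightOneSpectrum.intValuation_le_pow_iff_mem]
  rfl

lemma val_algebraMap_lt_one_iff (a : OL) :
    val OL L (algebraMap OL L a) < 1 ↔ a ∈ maximalIdeal OL :=
  IsDedekindDomain.HeightOneSpectrum.valuation_lt_one_iff_mem _ a

lemma val_unit (u : OLˣ) : val OL L (algebraMap OL L u) = 1 := by
  refine le_antisymm (val_algebraMap_le_one _) (not_lt.1 fun h ↦ ?_)
  rw [val_algebraMap_lt_one_iff] at h
  exact h u.isUnit

lemma val_irreducible {π : OL} (hπ : Irreducible π) : val OL L (algebraMap OL L π) = exp (-1) := by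
  rw [val, IsDedekindDomain.HeightOneSpectrum.valuation_of_algebraMap]
  exact IsDedekindDomain.HeightOneSpectrum.intValuation_singleton _ hπ.ne_zero hπ.maximalIdeal_eq

lemma exists_eq_zpow_mul {π : OL} (hπ : Irreducible π) {x : L} (hx : x ≠ 0) :
    ∃ (m : ℤ) (u : OLˣ), x = algebraMap OL L π ^ m * algebraMap OL L u := by
  obtain ⟨a, b, hb, rfl⟩ := IsFractionRing.div_surjective (A := OL) x
  have hb0 : b ≠ 0 := nonZeroDivisors.ne_zero hb
  have ha0 : a ≠ 0 := by
    rintro rfl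
    simp at hx
  obtain ⟨i, u, rfl⟩ := IsDiscreteValuationRing.eq_unit_mul_pow_irreducible ha0 hπ
  obtain ⟨j, w, rfl⟩ := IsDiscreteValuationRing.eq_unit_mul_pow_irreducible hb0 hπ
  have hπ0 : algebraMap OL L π ≠ 0 := by
    rw [Ne, IsFractionRing.to_map_eq_zero_iff]
    exact hπ.ne_zero
  have hw : algebraMap OL L w ≠ 0 := (w.isUnit.map (algebraMap OL L)).ne_zero
  have hw' : algebraMap OL L (w⁻¹ : OLˣ) = (algebraMap OL L w)⁻¹ := by
    refine eq_inv_of_mul_eq_one_left ?_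
    rw [← map_mul, Units.inv_mul, map_one]
  refine ⟨i - j, u * w⁻¹, ?_⟩
  rw [zpow_sub₀ hπ0, Units.val_mul, map_mul, map_mul, map_mul, map_pow, map_pow, hw',
    zpow_natCast, zpow_natCast]
  field_simp

lemma exp_neg_one_zpow (m : ℤ) : (exp (-1) : ℤᵐ⁰) ^ m = exp (-m) := by
  rw [← exp_zsmul]
  simp

lemma val_zpow_mul {π : OL} (hπ : Irreducible π) (m : ℤ) (u : OLˣ) :
    val OL L (algebraMap OL L π ^ m * algebraMap OL L u) = exp (-m) := by
  rw [map_mul, val_unit, mul_one, map_zpow₀, val_irreducible hπ, exp_neg_one_zpow]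

lemma val_le_one_iff {x : L} : val OL L x ≤ 1 ↔ ∃ a : OL, algebraMap OL L a = x := by
  refine ⟨fun h ↦ ?_, ?_⟩
  · rcases eq_or_ne x 0 with rfl | hx
    · exact ⟨0, map_zero _⟩
    obtain ⟨π, hπ⟩ := IsDiscreteValuationRing.exists_irreducible OL
    obtain ⟨m, u, rfl⟩ := exists_eq_zpow_mul hπ hx
    rw [val_zpow_mul hπ, ← exp_zero, exp_le_exp] at h
    lift m to ℕ using by omega
    exact ⟨π ^ m * u, by rw [map_mul, map_pow, zpow_natCast]⟩
  · rintro ⟨a, rfl⟩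
    exact val_algebraMap_le_one a

lemma mem_idealPow_iff {h : ℤ} {x : L} : x ∈ idealPow OL L h ↔ val OL L x ≤ exp (-h) := by
  obtain ⟨π, hπ⟩ := IsDiscreteValuationRing.exists_irreducible OL
  have hπ0 : algebraMap OL L π ≠ 0 := by
    rw [Ne, IsFractionRing.to_map_eq_zero_iff]
    exact hπ.ne_zero
  have hz : ∀ m : ℤ, FractionalIdeal.spanSingleton OL⁰ (algebraMap OL L π) ^ m =
      FractionalIdeal.spanSingleton OL⁰ (algebraMap OL L π ^ m) := by
    intro m
    cases m with
    | ofNat m =>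
      rw [Int.ofNat_eq_natCast, zpow_natCast, zpow_natCast, FractionalIdeal.spanSingleton_pow]
    | negSucc m =>
      rw [zpow_negSucc, zpow_negSucc, FractionalIdeal.spanSingleton_pow,
        FractionalIdeal.spanSingleton_inv]
  rw [idealPow, FractionalIdeal.mem_coe, hπ.maximalIdeal_eq,
    FractionalIdeal.coeIdeal_span_singleton, hz, FractionalIdeal.mem_spanSingleton]
  have hv : val OL L (algebraMap OL L π ^ h) = exp (-h) := by
    rw [map_zpow₀, val_irreducible hπ, exp_neg_one_zpow]
  constructor
  · rintro ⟨z, rfl⟩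
    rw [Algebra.smul_def, map_mul, hv]
    exact mul_le_of_le_one_left' (val_algebraMap_le_one z)
  · intro hx
    have : val OL L (x / algebraMap OL L π ^ h) ≤ 1 := by
      rw [map_div₀, hv]
      exact div_le_one_of_le₀ hx zero_le
    obtain ⟨a, ha⟩ := val_le_one_iff.1 this
    refine ⟨a, ?_⟩
    rw [Algebra.smul_def, ha, div_mul_cancel₀ _ (zpow_ne_zero _ hπ0)]

lemma val_lt_one_iff_le {x : L} : val OL L x < 1 ↔ val OL L x ≤ exp (-1) := by
  rcases eq_or_ne x 0 with rfl | hx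
  · simp
  · rw [← exp_zero, ← exp_log ((Valuation.ne_zero_iff (val OL L)).2 hx), exp_lt_exp, exp_le_exp]
    omega

/-- A sum of elements of pairwise distinct valuations is at least as large as each of them. -/
lemma _root_.Valuation.le_map_sum {F Γ ι : Type*} [Field F] [LinearOrderedCommGroupWithZero Γ]
    (v : Valuation F Γ) {s : Finset ι} {z : ι → F}
    (h : ∀ i ∈ s, ∀ j ∈ s, i ≠ j → z i ≠ 0 → v (z i) ≠ v (z j)) {j : ι} (hj : j ∈ s) :
    v (z j) ≤ v (∑ i ∈ s, z i) := by
  classical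
  obtain ⟨i, hi, hmax⟩ := s.exists_max_image (fun i ↦ v (z i)) ⟨j, hj⟩
  rcases eq_or_ne (z i) 0 with h0 | h0
  · have := hmax j hj
    rw [h0, map_zero] at this
    exact this.trans zero_le
  · rw [v.map_sum_eq_of_lt hi]
    · exact hmax j hj
    · intro l hl
      rw [Finset.mem_sdiff, Finset.mem_singleton] at hl
      exact lt_of_le_of_ne (hmax l hl.1) (h i hi l hl.1 (Ne.symm hl.2) h0).symm

/-- The exponents of the nonzero terms lie in different classes modulo q, so no cancellation can
occur. -/
lemma le_val_sum {q : ℕ} {ι : Type*} [Fintype ι] {z : ι → L} {g : ι → ℤ}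
    (hz : ∀ i, z i = 0 ∨ ∃ m : ℤ, val OL L (z i) = exp (q * m + g i))
    (hg : ∀ i j, (q : ℤ) ∣ g i - g j → i = j) (j : ι) :
    val OL L (z j) ≤ val OL L (∑ i, z i) := by
  refine Valuation.le_map_sum _ ?_ (Finset.mem_univ j)
  intro i _ j _ hij h0 heq
  obtain ⟨m, hm⟩ := (hz i).resolve_left h0
  have h0' : z j ≠ 0 := by
    rw [← Valuation.ne_zero_iff (val OL L), ← heq, hm]
    exact exp_ne_zero
  obtain ⟨m', hm'⟩ := (hz j).resolve_left h0'
  rw [hm, hm', exp_inj] at heq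
  exact hij (hg i j ⟨m' - m, by linear_combination heq⟩)

end Val

section Extension

variable {OK : Type*} {K : Type*} {OL : Type*} {L : Type*}
  [CommRing OK] [IsDomain OK] [IsDiscreteValuationRing OK] [Field K] [Algebra OK K]
  [IsFractionRing OK K] [CommRing OL] [IsDomain OL] [IsDiscreteValuationRing OL] [Field L]
  [Algebra OL L] [IsFractionRing OL L] [Algebra K L] [Algebra OK OL] [Algebra OK L]
  [IsScalarTower OK K L] [IsScalarTower OK OL L]

/-! ### Valuations in a totally ramified extension -/

section TotallyRamified

variable {q : ℕ} (hq : Module.finrank K L = q) (htot : IsTotallyRamified OK K OL L)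

include hq htot

lemma val_uniformizer {t : OK} (ht : Irreducible t) :
    val OL L (algebraMap OK L t) = exp (-(q : ℤ)) := by
  have h := htot
  rw [IsTotallyRamified, ht.maximalIdeal_eq, Ideal.map_span, Set.image_singleton, hq] at h
  obtain ⟨π, hπ⟩ := IsDiscreteValuationRing.exists_irreducible OL
  rw [hπ.maximalIdeal_eq, Ideal.span_singleton_pow, Ideal.span_singleton_eq_span_singleton] at h
  obtain ⟨u, hu⟩ := h
  have h1 : algebraMap OK L t = algebraMap OL L (algebraMap OK OL t) :=
    IsScalarTower.algebraMap_apply _ _ _ _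
  have h2 := congrArg (fun x ↦ val OL L (algebraMap OL L x)) hu
  simp only [map_mul, val_unit, mul_one, map_pow, val_irreducible hπ] at h2
  rw [h1, h2, ← zpow_natCast, exp_neg_one_zpow]

omit hq htot in
lemma val_unit_base (u : OKˣ) : val OL L (algebraMap OK L u) = 1 := by
  have := val_unit (L := L) (Units.map (algebraMap OK OL : OK →* OL) u)
  rwa [Units.coe_map, MonoidHom.coe_coe, ← IsScalarTower.algebraMap_apply] at this

lemma val_zpow_mul_base {t : OK} (ht : Irreducible t) (m : ℤ) (u : OKˣ) :
    val OL L (algebraMap K L (algebraMap OK K t ^ m * algebraMap OK K u)) = exp (-(q * m)) := by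
  rw [map_mul, map_zpow₀, ← IsScalarTower.algebraMap_apply, ← IsScalarTower.algebraMap_apply,
    map_mul, map_zpow₀, val_unit_base, val_uniformizer hq htot ht, ← exp_zsmul, mul_one]
  congr 1
  simp
  ring

lemma exists_val_eq_exp {a : K} (ha : a ≠ 0) :
    ∃ m : ℤ, val OL L (algebraMap K L a) = exp (q * m) := by
  obtain ⟨t, ht⟩ := IsDiscreteValuationRing.exists_irreducible OK
  obtain ⟨m, u, rfl⟩ := exists_eq_zpow_mul ht ha
  exact ⟨-m, by rw [val_zpow_mul_base hq htot ht, mul_neg]⟩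

lemma val_base_le_one_iff [NeZero q] {a : K} :
    val OL L (algebraMap K L a) ≤ 1 ↔ ∃ b : OK, algebraMap OK K b = a := by
  have hq0 : (0 : ℤ) < q := by
    exact_mod_cast Nat.pos_of_ne_zero (NeZero.ne q)
  constructor
  · intro h
    rcases eq_or_ne a 0 with rfl | ha
    · exact ⟨0, map_zero _⟩
    obtain ⟨t, ht⟩ := IsDiscreteValuationRing.exists_irreducible OK
    obtain ⟨m, u, rfl⟩ := exists_eq_zpow_mul ht ha
    rw [val_zpow_mul_base hq htot ht, ← exp_zero, exp_le_exp, neg_nonpos,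
      mul_nonneg_iff_of_pos_left hq0] at h
    lift m to ℕ using h
    exact ⟨t ^ m * u, by rw [map_mul, map_pow, zpow_natCast]⟩
  · rintro ⟨b, rfl⟩
    rw [← IsScalarTower.algebraMap_apply, IsScalarTower.algebraMap_apply OK OL L]
    exact val_algebraMap_le_one _

lemma val_base_lt_one_iff [NeZero q] {a : OK} :
    val OL L (algebraMap OK L a) < 1 ↔ a ∈ maximalIdeal OK := by
  rw [mem_maximalIdeal, mem_nonunits_iff]
  constructor
  · rintro h hu
    rw [← hu.unit_spec, val_unit_base] at h
    exact lt_irrefl _ h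
  · intro h
    obtain ⟨t, ht⟩ := IsDiscreteValuationRing.exists_irreducible OK
    have : a ∈ maximalIdeal OK := h
    rw [ht.maximalIdeal_eq, Ideal.mem_span_singleton] at this
    obtain ⟨b, rfl⟩ := this
    rw [map_mul, map_mul, val_uniformizer hq htot ht, IsScalarTower.algebraMap_apply OK OL L b]
    refine (mul_le_of_le_one_right' (val_algebraMap_le_one _)).trans_lt ?_
    rw [← exp_zero, exp_lt_exp]
    have := Nat.pos_of_ne_zero (NeZero.ne q)
    omega

lemma le_val_sum_smul {u : Fin q → L} {g : Fin q → ℤ} (hu : ∀ i, val OL L (u i) = exp (g i))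
    (hg : ∀ i j, (q : ℤ) ∣ g i - g j → i = j) (a : Fin q → K) (j : Fin q) :
    val OL L (a j • u j) ≤ val OL L (∑ i, a i • u i) := by
  refine le_val_sum (OL := OL) (q := q) (z := fun i ↦ a i • u i) (g := g) (fun i ↦ ?_) hg j
  rcases eq_or_ne (a i) 0 with h | h
  · left; rw [h, zero_smul]
  · right
    obtain ⟨m, hm⟩ := exists_val_eq_exp hq htot h
    exact ⟨m, by rw [Algebra.smul_def, map_mul, hm, hu, exp_add]⟩

lemma linearIndependent_of_val {u : Fin q → L} {g : Fin q → ℤ}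
    (hu : ∀ i, val OL L (u i) = exp (g i))
    (hg : ∀ i j, (q : ℤ) ∣ g i - g j → i = j) : LinearIndependent K u := by
  rw [Fintype.linearIndependent_iff]
  intro a ha j
  have := le_val_sum_smul hq htot hu hg a j
  rw [ha, map_zero, le_zero_iff, (val OL L).zero_iff, smul_eq_zero] at this
  refine this.resolve_right fun h ↦ ?_
  have := hu j
  rw [h, map_zero] at this
  exact exp_ne_zero this.symm

/-- A totally ramified extension has trivial residue extension. -/
lemma exists_val_sub_lt_one [NeZero q] [FiniteDimensional K L] {x : L} (hx : val OL L x ≤ 1) :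
    ∃ a : OK, val OL L (x - algebraMap OK L a) < 1 := by
  by_contra! hcon
  obtain ⟨π, hπ⟩ := IsDiscreteValuationRing.exists_irreducible OL
  have hq0 := Nat.pos_of_ne_zero (NeZero.ne q)
  have hx1 : ∀ a : OK, val OL L (x - algebraMap OK L a) = 1 := fun a ↦
    le_antisymm ((val OL L).map_sub_le hx (by
      rw [IsScalarTower.algebraMap_apply OK OL L]; exact val_algebraMap_le_one _)) (hcon a)
  -- If x had no approximation in OK, then x together with the q powers 1, π, …, π^(q-1) would be q
  -- + 1 independent elements of a space of dimension q.
  have hli : LinearIndependent K (Fin.cons x fun i : Fin q ↦ algebraMap OL L π ^ (i : ℕ)) := by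
    rw [Fintype.linearIndependent_iff]
    intro a ha
    rw [Fin.sum_univ_succ] at ha
    simp only [Fin.cons_zero, Fin.cons_succ] at ha
    let z : Fin q → L := fun i ↦ (if i.1 = 0 then a 0 • x else 0) +
      a i.succ • algebraMap OL L π ^ (i : ℕ)
    have hsum : ∑ i, z i = 0 := by
      have h0 : ∑ i : Fin q, (if i.1 = 0 then a 0 • x else 0) = a 0 • x := by
        rw [Finset.sum_eq_single (⟨0, hq0⟩ : Fin q)]
        · rw [if_pos rfl]
        · intro i _ hi
          exact if_neg fun h ↦ hi (Fin.ext h)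
        · simp
      rw [Finset.sum_add_distrib, h0, ha]
    -- Since x stays at distance one from OK, every combination of x and 1 with nonzero
    -- x-coefficient still has valuation divisible by q, hence is independent of the positive powers
    -- of π.
    have hval0 : ∀ b c : K, b ≠ 0 → ∃ m : ℤ,
        val OL L (b • x + algebraMap K L c) = exp (q * m) := by
      intro b c hb
      have h1 : b • x + algebraMap K L c = algebraMap K L b * (x + algebraMap K L (c / b)) := by
        rw [mul_add, ← map_mul, mul_div_cancel₀ _ hb, Algebra.smul_def]
      obtain ⟨m, hm⟩ := exists_val_eq_exp hq htot hb
      rcases le_or_gt (val OL L (algebraMap K L (c / b))) 1 with h | h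
      · obtain ⟨d, hd⟩ := (val_base_le_one_iff hq htot).1 h
        refine ⟨m, ?_⟩
        have h2 := hx1 (-d)
        rw [IsScalarTower.algebraMap_apply OK K L, map_neg, hd, map_neg, sub_neg_eq_add] at h2
        rw [h1, map_mul, hm, h2, mul_one]
      · have hc0 : c / b ≠ 0 := by
          intro h0
          rw [h0, map_zero, map_zero] at h
          exact absurd h (not_lt.2 zero_le)
        obtain ⟨m', hm'⟩ := exists_val_eq_exp hq htot hc0
        refine ⟨m + m', ?_⟩
        rw [h1, map_mul, Valuation.map_add_eq_of_lt_right _ (hx.trans_lt h), hm, hm', mul_add,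
          exp_add]
    have hz : ∀ i, z i = 0 ∨ ∃ m : ℤ, val OL L (z i) = exp (q * m + -(i.1 : ℤ)) := by
      intro i
      simp only [z]
      by_cases hi : i.1 = 0
      · rw [if_pos hi, hi, pow_zero, ← Algebra.algebraMap_eq_smul_one, Nat.cast_zero, neg_zero]
        by_cases hb : a 0 = 0
        · rw [hb, zero_smul, zero_add]
          by_cases hc : a i.succ = 0
          · left; rw [hc, map_zero]
          · right
            simpa using exists_val_eq_exp hq htot hc
        · right
          simpa using hval0 _ _ hb
      · rw [if_neg hi, zero_add]
        by_cases hc : a i.succ = 0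
        · left; rw [hc, zero_smul]
        · right
          obtain ⟨m, hm⟩ := exists_val_eq_exp hq htot hc
          refine ⟨m, ?_⟩
          rw [Algebra.smul_def, map_mul, hm, map_pow, val_irreducible hπ, ← zpow_natCast,
            exp_neg_one_zpow, exp_add]
    have hg : ∀ i j : Fin q, (q : ℤ) ∣ -(i.1 : ℤ) - -(j.1 : ℤ) → i = j := by
      intro i j h
      have h1 := Int.eq_zero_of_abs_lt_dvd h (by rw [abs_lt]; omega)
      ext
      omega
    have hz0 : ∀ j, z j = 0 := by
      intro j
      have := le_val_sum hz hg j
      rw [hsum, map_zero, le_zero_iff, (val OL L).zero_iff] at this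
      exact this
    have ha0 : a 0 = 0 := by
      by_contra hb
      obtain ⟨m, hm⟩ := hval0 (a 0) (a (Fin.succ ⟨0, hq0⟩)) hb
      have h0 := hz0 ⟨0, hq0⟩
      simp only [z] at h0
      rw [if_pos trivial, pow_zero, ← Algebra.algebraMap_eq_smul_one] at h0
      rw [h0, map_zero] at hm
      exact exp_ne_zero hm.symm
    intro i
    refine Fin.cases ha0 (fun j ↦ ?_) i
    have h0 := hz0 j
    simp only [z, ha0, zero_smul, ite_self, zero_add, smul_eq_zero] at h0
    refine h0.resolve_right (pow_ne_zero _ ?_)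
    rw [Ne, IsFractionRing.to_map_eq_zero_iff]
    exact hπ.ne_zero
  have := hli.fintype_card_le_finrank
  rw [Fintype.card_fin, hq] at this
  omega

end TotallyRamified

end Extension

/-- For each operator in turn, pass to the last nonzero iterate; commutativity keeps the previous
operators zero on it. Applied to T_σ = σ - 1 this is the existence of nonzero fixed vectors for a
p-group in characteristic p. -/
lemma exists_ne_zero_forall_apply_eq_zero {k V ι : Type*} [Semiring k] [AddCommGroup V] [Module k V]
    (T : ι → Module.End k V) (hcomm : ∀ i j, Commute (T i) (T j)) (hnil : ∀ i, IsNilpotent (T i))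
    (I : AddSubgroup V) (hI : ∀ i, ∀ x ∈ I, T i x ∈ I) {x : V} (hx : x ∈ I) (hx0 : x ≠ 0)
    (s : Finset ι) : ∃ x' ∈ I, x' ≠ 0 ∧ ∀ i ∈ s, T i x' = 0 := by
  classical
  induction s using Finset.induction_on with
  | empty => exact ⟨x, hx, hx0, by simp⟩
  | insert i s his ih =>
    obtain ⟨y, hy, hy0, hys⟩ := ih
    have hex : ∃ m, (T i ^ m) y = 0 := by
      obtain ⟨m, hm⟩ := hnil i
      exact ⟨m, by rw [hm, LinearMap.zero_apply]⟩
    obtain ⟨m, hm, hmin⟩ : ∃ m, (T i ^ (m + 1)) y = 0 ∧ (T i ^ m) y ≠ 0 := by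
      have h1 := Nat.find_spec hex
      rcases h : Nat.find hex with _ | m
      · rw [h, pow_zero] at h1
        exact absurd h1 hy0
      · rw [h] at h1
        exact ⟨m, h1, Nat.find_min hex (by omega)⟩
    refine ⟨(T i ^ m) y, ?_, hmin, ?_⟩
    · clear hm hmin
      induction m with
      | zero => simpa using hy
      | succ m ih =>
        rw [pow_succ', Module.End.mul_apply]
        exact hI i _ ih
    · intro j hj
      rcases Finset.mem_insert.1 hj with rfl | hj
      · rw [← Module.End.mul_apply, ← pow_succ', hm]
      · rw [← Module.End.mul_apply, ((hcomm j i).pow_right m).eq, Module.End.mul_apply, hys j hj,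
          map_zero]

section Extension

variable {OK : Type*} {K : Type*} {OL : Type*} {L : Type*}
  [CommRing OK] [IsDomain OK] [IsDiscreteValuationRing OK] [Field K] [Algebra OK K]
  [IsFractionRing OK K] [CommRing OL] [IsDomain OL] [IsDiscreteValuationRing OL] [Field L]
  [Algebra OL L] [IsFractionRing OL L] [Algebra K L] [Algebra OK OL] [Algebra OK L]
  [IsScalarTower OK K L] [IsScalarTower OK OL L]
  [IsIntegralClosure OL OK L] [FiniteDimensional K L] [IsGalois K L]

/-! ### Galois invariance of the valuation -/

section Galois

variable (OK OL)

include OK in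
lemma val_galois (σ : Gal(L/K)) (x : L) : val OL L (σ x) = val OL L x := by
  rcases eq_or_ne x 0 with rfl | hx
  · rw [map_zero]
  obtain ⟨π, hπ⟩ := IsDiscreteValuationRing.exists_irreducible OL
  obtain ⟨m, u, rfl⟩ := exists_eq_zpow_mul hπ hx
  have hπ' : Irreducible (galRestrict OK K L OL σ π) :=
    (MulEquiv.irreducible_iff (galRestrict OK K L OL σ)).2 hπ
  rw [val_zpow_mul hπ, map_mul, map_zpow₀, ← algebraMap_galRestrict_apply OK σ,
    ← algebraMap_galRestrict_apply OK σ]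
  exact val_zpow_mul hπ' m (Units.map (galRestrict OK K L OL σ : OL →* OL) u)

variable {OK OL}

lemma mem_ramificationGroup_iff {σ : Gal(L/K)} {i : ℕ} : σ ∈ ramificationGroup OK K OL L i ↔
    ∀ x : OL, val OL L (σ (algebraMap OL L x) - algebraMap OL L x) ≤ exp (-((i + 1 : ℕ) : ℤ)) := by
  rw [ramificationGroup, Subgroup.mem_comap, AddSubgroup.mem_inertia]
  refine forall_congr' fun x ↦ ?_
  rw [← algebraMap_galRestrict_apply OK σ, ← map_sub, val_algebraMap_le_exp_iff]
  rfl

end Galois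

variable {q : ℕ} [NeZero q] (hq : Module.finrank K L = q) (htot : IsTotallyRamified OK K OL L)

/-! ### Reduction of integral elements of L to the residue field of K -/

section Reduction

variable (OK OL) in
open Classical in
/-- The residue class in the residue field of `K` of an integral element of `L`, where `L/K` is
totally ramified. -/
def red (x : L) : ResidueField OK :=
  if h : ∃ a : OK, val OL L (x - algebraMap OK L a) < 1 then residue OK h.choose else 0

include hq htot

lemma red_eq {x : L} {a : OK} (h : val OL L (x - algebraMap OK L a) < 1) :
    red OK OL x = residue OK a := by
  have hex : ∃ a : OK, val OL L (x - algebraMap OK L a) < 1 := ⟨a, h⟩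
  rw [red, dif_pos hex, ← sub_eq_zero, ← map_sub, residue_eq_zero_iff,
    ← val_base_lt_one_iff hq htot]
  have h2 := hex.choose_spec
  have := (val OL L).map_sub_lt h h2
  rw [sub_sub_sub_cancel_left] at this
  rwa [map_sub]

lemma red_spec {x : L} (hx : val OL L x ≤ 1) {a : OK} (h : red OK OL x = residue OK a) :
    val OL L (x - algebraMap OK L a) < 1 := by
  obtain ⟨b, hb⟩ := exists_val_sub_lt_one hq htot hx
  rw [red_eq hq htot hb, ← sub_eq_zero, ← map_sub, residue_eq_zero_iff,
    ← val_base_lt_one_iff hq htot, map_sub] at h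
  have := (val OL L).map_add_lt hb h
  rwa [sub_add_sub_cancel] at this

lemma red_add {x y : L} (hx : val OL L x ≤ 1) (hy : val OL L y ≤ 1) :
    red OK OL (x + y) = red OK OL x + red OK OL y := by
  obtain ⟨a, ha⟩ := exists_val_sub_lt_one hq htot hx
  obtain ⟨b, hb⟩ := exists_val_sub_lt_one hq htot hy
  rw [red_eq hq htot ha, red_eq hq htot hb, ← map_add]
  refine red_eq hq htot ?_
  rw [map_add, add_sub_add_comm]
  exact (val OL L).map_add_lt ha hb

lemma red_mul {x y : L} (hx : val OL L x ≤ 1) (hy : val OL L y ≤ 1) :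
    red OK OL (x * y) = red OK OL x * red OK OL y := by
  obtain ⟨a, ha⟩ := exists_val_sub_lt_one hq htot hx
  obtain ⟨b, hb⟩ := exists_val_sub_lt_one hq htot hy
  rw [red_eq hq htot ha, red_eq hq htot hb, ← map_mul]
  refine red_eq hq htot ?_
  have hb1 : val OL L (algebraMap OK L a) ≤ 1 := by
    rw [IsScalarTower.algebraMap_apply OK OL L]
    exact val_algebraMap_le_one _
  rw [map_mul, show x * y - algebraMap OK L a * algebraMap OK L b =
    (x - algebraMap OK L a) * y + algebraMap OK L a * (y - algebraMap OK L b) by ring]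
  refine (val OL L).map_add_lt ?_ ?_ <;> rw [map_mul]
  · exact (mul_le_of_le_one_right' hy).trans_lt ha
  · exact (mul_le_of_le_one_left' hb1).trans_lt hb

lemma red_one : red OK OL (1 : L) = 1 := by
  rw [← map_one (residue OK)]
  refine red_eq hq htot ?_
  rw [map_one, sub_self, map_zero]
  exact zero_lt_one

lemma red_galois {x : L} (hx : val OL L x ≤ 1) (σ : Gal(L/K)) :
    red OK OL (σ x) = red OK OL x := by
  obtain ⟨a, ha⟩ := exists_val_sub_lt_one hq htot hx
  rw [red_eq hq htot ha]
  refine red_eq hq htot ?_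
  rw [← val_galois OK OL σ, map_sub] at ha
  rwa [IsScalarTower.algebraMap_apply OK K L, AlgEquiv.commutes,
    ← IsScalarTower.algebraMap_apply] at ha

lemma val_base_le_of_lt_one {a : K} (h : val OL L (algebraMap K L a) < 1) :
    val OL L (algebraMap K L a) ≤ exp (-(q : ℤ)) := by
  rcases eq_or_ne a 0 with rfl | ha
  · simp
  obtain ⟨m, hm⟩ := exists_val_eq_exp hq htot ha
  have hq0 := Nat.pos_of_ne_zero (NeZero.ne q)
  rw [hm, ← exp_zero, exp_lt_exp] at h
  rw [hm, exp_le_exp]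
  have : m ≤ -1 := by
    by_contra hcon
    have : (0 : ℤ) ≤ q * m := mul_nonneg (by omega) (by omega)
    omega
  nlinarith

end Reduction

/-! ### The ramification character -/

section Ramification

variable {p : ℕ} [Fact p.Prime] [CharP K p]

include K in
variable (OK K p) in
lemma charP_base : CharP OK p :=
  RingHom.charP (algebraMap OK K) (IsFractionRing.injective OK K) p

include K in
variable (OK K p) in
lemma charP_residueField : CharP (ResidueField OK) p := by
  have := charP_base OK K p
  exact charP_of_injective_ringHom
    (RingHom.injective ((residue OK).comp (ZMod.castHom (dvd_refl p) OK))) p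

include hq htot

omit [NeZero q] in
lemma card_galois : Nat.card Gal(L/K) = q := by rw [IsGalois.card_aut_eq_finrank, hq]

variable {π : OL} (hπ : Irreducible π)

include hπ

omit [NeZero q] hq htot in
include OK in
lemma val_galois_div_eq_one (σ : Gal(L/K)) :
    val OL L (σ (algebraMap OL L π) / algebraMap OL L π) = 1 := by
  rw [map_div₀, val_galois OK OL σ, div_self]
  rw [val_irreducible hπ]
  exact exp_ne_zero

omit [NeZero q] hq htot in
lemma algebraMap_irreducible_ne_zero : algebraMap OL L π ≠ 0 := by
  rw [Ne, IsFractionRing.to_map_eq_zero_iff]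
  exact hπ.ne_zero

/-- The whole group is wild: σ ↦ σπ/π mod 𝔓_L is multiplicative because the Galois group acts
trivially on residues, and its values are p^n-th roots of unity in characteristic p, hence trivial.
-/
lemma val_galois_sub_le {n : ℕ} (hn : q = p ^ n) (σ : Gal(L/K)) :
    val OL L (σ (algebraMap OL L π) - algebraMap OL L π) ≤ exp (-2) := by
  set ϖ := algebraMap OL L π with hϖ
  have hϖ0 : ϖ ≠ 0 := algebraMap_irreducible_ne_zero hπ
  have := charP_residueField OK K p
  let μ : Gal(L/K) →* ResidueField OK :=
    { toFun := fun σ ↦ red OK OL (σ ϖ / ϖ)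
      map_one' := by
        rw [AlgEquiv.one_apply, div_self hϖ0]
        exact red_one hq htot
      map_mul' := fun σ τ ↦ by
        have h1 : (σ * τ) ϖ / ϖ = σ (τ ϖ / ϖ) * (σ ϖ / ϖ) := by
          have : σ ϖ ≠ 0 := by simpa using hϖ0
          rw [map_div₀, AlgEquiv.mul_apply]
          field_simp
        have h2 := (val_galois_div_eq_one (OK := OK) hπ τ).le
        rw [h1, red_mul hq htot (by rwa [val_galois OK OL σ])
          (val_galois_div_eq_one (OK := OK) hπ σ).le, red_galois hq htot h2, mul_comm] }
  have h1 : μ σ ^ p ^ n = 1 := by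
    rw [← map_pow, ← hn, ← card_galois (L := L) hq htot, pow_card_eq_one', map_one]
  have h2 : μ σ = 1 := by
    rw [← sub_eq_zero]
    refine eq_zero_of_pow_eq_zero (n := p ^ n) ?_
    rw [sub_pow_char_pow, h1, one_pow, sub_self]
  have h3 := red_spec hq htot (val_galois_div_eq_one (OK := OK) hπ σ).le (a := 1) (by rw [map_one]; exact h2)
  rw [map_one, val_lt_one_iff_le] at h3
  rw [show σ ϖ - ϖ = (σ ϖ / ϖ - 1) * ϖ by field_simp, map_mul, hϖ, val_irreducible hπ,
    show (-2 : ℤ) = -1 + -1 by norm_num, exp_add]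
  exact mul_le_mul_left h3 _

omit [NeZero q] hq htot in
include OK in
lemma val_galois_inv_sub (σ : Gal(L/K)) :
    val OL L (σ (algebraMap OL L π)⁻¹ - (algebraMap OL L π)⁻¹) =
      exp 2 * val OL L (σ (algebraMap OL L π) - algebraMap OL L π) := by
  set ϖ := algebraMap OL L π with hϖ
  have hϖ0 : ϖ ≠ 0 := algebraMap_irreducible_ne_zero hπ
  have hσ : σ ϖ ≠ 0 := by simpa using hϖ0
  have : σ ϖ⁻¹ - ϖ⁻¹ = -((σ ϖ - ϖ) * (ϖ⁻¹ * (σ ϖ)⁻¹)) := by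
    rw [map_inv₀]
    field_simp
    ring
  rw [this, Valuation.map_neg, map_mul, map_mul, map_inv₀, map_inv₀, val_galois OK OL σ, hϖ,
    val_irreducible hπ, mul_comm, ← exp_neg, ← exp_add]
  norm_num

lemma val_galois_inv_sub_le {n : ℕ} (hn : q = p ^ n) (σ : Gal(L/K)) :
    val OL L (σ (algebraMap OL L π)⁻¹ - (algebraMap OL L π)⁻¹) ≤ 1 := by
  rw [val_galois_inv_sub (OK := OK) hπ]
  refine (mul_le_mul_right (val_galois_sub_le hq htot hπ hn σ) _).trans ?_
  rw [← exp_add]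
  norm_num

/-- Membership in the second ramification group can be tested on a uniformizer: σ fixes OK and OL =
OK + π OL, so the bound for all of OL improves by one exponent at a time. -/
lemma eq_one_of_val_lt (hweak : IsWeaklyRamified OK K OL L) {σ : Gal(L/K)}
    (h : val OL L (σ (algebraMap OL L π) - algebraMap OL L π) ≤ exp (-3)) : σ = 1 := by
  rw [IsWeaklyRamified] at hweak
  rw [← Subgroup.mem_bot, ← hweak, mem_ramificationGroup_iff]
  suffices H : ∀ k : ℕ, k ≤ 3 → ∀ x : OL,
      val OL L (σ (algebraMap OL L x) - algebraMap OL L x) ≤ exp (-(k : ℤ)) from H 3 le_rfl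
  intro k
  induction k with
  | zero =>
    intro _ x
    have h1 := val_algebraMap_le_one (L := L) x
    simpa using (val OL L).map_sub_le (g := 1) ((val_galois OK OL σ _).le.trans h1) h1
  | succ k ih =>
    intro hk x
    obtain ⟨a, ha⟩ := exists_val_sub_lt_one hq htot (val_algebraMap_le_one (L := L) x)
    rw [IsScalarTower.algebraMap_apply OK OL L, ← map_sub, val_algebraMap_lt_one_iff,
      hπ.maximalIdeal_eq, Ideal.mem_span_singleton] at ha
    obtain ⟨z, hz⟩ := ha
    have hx : algebraMap OL L x =
        algebraMap K L (algebraMap OK K a) + algebraMap OL L π * algebraMap OL L z := by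
      rw [← IsScalarTower.algebraMap_apply, IsScalarTower.algebraMap_apply OK OL L, ← map_mul,
        ← hz, ← map_add, add_sub_cancel]
    rw [hx, map_add, AlgEquiv.commutes, add_sub_add_left_eq_sub, map_mul,
      show ∀ a b c d : L, a * b - c * d = (a - c) * b + c * (b - d) by intros; ring]
    refine (val OL L).map_add_le ?_ ?_ <;> rw [map_mul]
    · rw [val_galois OK OL σ]
      refine (mul_le_of_le_one_right' (val_algebraMap_le_one z)).trans (h.trans ?_)
      rw [exp_le_exp]
      omega
    · rw [val_irreducible hπ]
      refine (mul_le_mul_right (ih (by omega) z) _).trans ?_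
      rw [← exp_add, exp_le_exp]
      omega

/-- The first ramification group of a weakly ramified extension embeds into the residue field. -/
lemma exists_ramification_character {n : ℕ} (hn : q = p ^ n)
    (hweak : IsWeaklyRamified OK K OL L) :
    ∃ c : Gal(L/K) → OK, (∀ σ τ, c (σ * τ) = c σ + c τ) ∧
      (∀ σ, residue OK (c σ) = 0 → σ = 1) ∧
      ∀ σ, val OL L (σ (algebraMap OL L π)⁻¹ - (algebraMap OL L π)⁻¹ - algebraMap OK L (c σ))
        < 1 := by
  have := charP_residueField OK K p
  have := charP_base OK K p
  let := ZMod.algebra OK p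
  let := ZMod.algebra (ResidueField OK) p
  -- In characteristic p the residue map is linear over the prime field and splits. The splitting
  -- makes the character additive in OK itself, not only modulo the maximal ideal.
  let f : OK →ₗ[ZMod p] ResidueField OK := (residue OK).toAddMonoidHom.toZModLinearMap p
  obtain ⟨g, hg⟩ := f.exists_rightInverse_of_surjective
    (LinearMap.range_eq_top.2 residue_surjective)
  have hg' : ∀ x, residue OK (g x) = x := fun x ↦ congrFun (congrArg DFunLike.coe hg) x
  set Y := (algebraMap OL L π)⁻¹ with hY
  have hle := val_galois_inv_sub_le hq htot hπ hn
  rw [← hY] at hle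
  have hspec : ∀ σ : Gal(L/K),
      val OL L (σ Y - Y - algebraMap OK L (g (red OK OL (σ Y - Y)))) < 1 := fun σ ↦
    red_spec hq htot (hle σ) (hg' _).symm
  refine ⟨fun σ ↦ g (red OK OL (σ Y - Y)), ?_, ?_, hspec⟩
  · intro σ τ
    have : (σ * τ) Y - Y = (σ Y - Y) + σ (τ Y - Y) := by
      rw [AlgEquiv.mul_apply, map_sub]
      ring
    change g (red OK OL ((σ * τ) Y - Y)) = _
    rw [this, red_add hq htot (hle σ) (by rw [val_galois OK OL σ]; exact hle τ),
      red_galois hq htot (hle τ), map_add]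
  · intro σ hσ
    refine eq_one_of_val_lt hq htot hπ hweak ?_
    change residue OK (g _) = 0 at hσ
    rw [hg'] at hσ
    have := red_spec hq htot (hle σ) (a := 0) (by rw [hσ, map_zero])
    rw [map_zero, sub_zero, val_lt_one_iff_le, val_galois_inv_sub (OK := OK) hπ] at this
    have h2 := mul_le_mul_right this (exp (-2) : ℤᵐ⁰)
    rw [← mul_assoc, ← exp_add, ← exp_add] at h2
    simpa using h2

end Ramification

/-! ### An element of trace one -/

section Trace

variable {c : Gal(L/K) → OK} (hc : ∀ σ τ, c (σ * τ) = c σ + c τ)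
  (hc0 : ∀ σ, residue OK (c σ) = 0 → σ = 1) {π : OL} (hπ : Irreducible π)
  (hcπ : ∀ σ, val OL L (σ (algebraMap OL L π)⁻¹ - (algebraMap OL L π)⁻¹ - algebraMap OK L (c σ))
        < 1)

include hq htot hc0 hπ hcπ in
lemma val_sub_galois_eq {σ : Gal(L/K)} (hσ : σ ≠ 1) :
    val OL L (algebraMap OL L π - σ (algebraMap OL L π)) = exp (-2) := by
  have h1 : ¬ val OL L (algebraMap OK L (c σ)) < 1 := by
    rw [val_base_lt_one_iff hq htot, ← residue_eq_zero_iff]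
    exact fun h ↦ hσ (hc0 σ h)
  have h2 : val OL L (algebraMap OK L (c σ)) ≤ 1 := by
    rw [IsScalarTower.algebraMap_apply OK OL L]
    exact val_algebraMap_le_one _
  have h3 := le_antisymm h2 (not_lt.1 h1)
  have h4 : val OL L (σ (algebraMap OL L π)⁻¹ - (algebraMap OL L π)⁻¹) = 1 := by
    rw [← h3]
    refine (val OL L).map_eq_of_sub_lt ?_
    rw [(val OL L).map_sub_swap, h3]
    rw [(val OL L).map_sub_swap]
    exact hcπ σ
  rw [val_galois_inv_sub (OK := OK) hπ, (val OL L).map_sub_swap] at h4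
  rw [← one_mul (val OL L _), ← exp_zero, show (0 : ℤ) = -2 + 2 by norm_num, exp_add, mul_assoc, h4,
    mul_one]

include hc0 hq htot hπ hcπ in
/-- There is an element of trace one of large valuation. -/
lemma exists_trace_one : ∃ θ : L, ∑ σ : Gal(L/K), σ θ = 1 ∧ val OL L θ = exp ((q : ℤ) - 1) := by
  classical
  set ϖ := algebraMap OL L π with hϖ
  have hsub := fun σ ↦ val_sub_galois_eq (σ := σ) hq htot hc0 hπ hcπ
  have hcard : (Finset.univ : Finset Gal(L/K)).card = q := by
    rw [Finset.card_univ, ← Nat.card_eq_fintype_card, card_galois (L := L) hq htot]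
  have hq0 := Nat.pos_of_ne_zero (NeZero.ne q)
  -- This is Euler's element ϖ^(q-1)/f'(ϖ), f having the conjugates of ϖ as roots. Its trace is the
  -- leading coefficient of X^(q-1) by Lagrange interpolation. The q - 1 factors of the denominator
  -- have v_L = 2 each, so v_L(θ) = 1 - q.
  refine ⟨ϖ ^ (q - 1) / ∏ τ ∈ (Finset.univ : Finset Gal(L/K)).erase 1, (ϖ - τ ϖ), ?_, ?_⟩
  · have hinj : Set.InjOn (fun σ : Gal(L/K) ↦ σ ϖ) (Finset.univ : Finset Gal(L/K)) := by
      intro σ _ τ _ h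
      by_contra hne
      have h1 : τ⁻¹ * σ ≠ 1 := by
        rw [Ne, inv_mul_eq_one]
        exact Ne.symm hne
      have h2 := hsub _ h1
      have h3 : (τ⁻¹ * σ) ϖ = ϖ := by
        have : σ ϖ = τ ϖ := h
        rw [AlgEquiv.mul_apply, this, ← AlgEquiv.mul_apply, inv_mul_cancel, AlgEquiv.one_apply]
      rw [h3, sub_self, map_zero] at h2
      exact exp_ne_zero h2.symm
    have key := Lagrange.coeff_eq_sum hinj (P := Polynomial.X ^ (q - 1))
      (by rw [Polynomial.degree_X_pow, hcard]; exact_mod_cast Nat.sub_lt hq0 one_pos)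
    rw [hcard, Polynomial.coeff_X_pow, if_pos rfl] at key
    rw [key]
    refine Finset.sum_congr rfl fun σ _ ↦ ?_
    rw [map_div₀, map_pow, map_prod, Polynomial.eval_pow, Polynomial.eval_X]
    congr 1
    refine Finset.prod_bij (fun τ _ ↦ σ * τ) ?_ ?_ ?_ ?_
    · intro τ hτ
      simpa using hτ
    · intro τ _ τ' _ h
      exact mul_left_cancel h
    · intro τ hτ
      refine ⟨σ⁻¹ * τ, ?_, by simp⟩
      have := (Finset.mem_erase.1 hτ).1
      simp only [Finset.mem_erase, Finset.mem_univ, and_true, Ne, inv_mul_eq_one]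
      exact this.symm
    · intro τ _
      rw [map_sub, AlgEquiv.mul_apply]
  · rw [map_div₀, map_pow, map_prod, Finset.prod_congr rfl fun τ hτ ↦
      hsub τ (Finset.mem_erase.1 hτ).1, Finset.prod_const, Finset.card_erase_of_mem
      (Finset.mem_univ _), hcard, hϖ, val_irreducible hπ, ← zpow_natCast, ← zpow_natCast,
      ← exp_zsmul, ← exp_zsmul, ← exp_sub]
    congr 1
    simp only [smul_eq_mul]
    push_cast [Nat.one_le_iff_ne_zero.2 hq0.ne']
    ring

end Trace

/-! ### An integral normal basis of the maximal ideal of OL -/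

section NormalBasis

variable {p : ℕ} [Fact p.Prime] [CharP K p] {n : ℕ} (hn : q = p ^ n)
  (hcomm : ∀ σ τ : Gal(L/K), σ * τ = τ * σ) {θ : L} (hθ : ∑ σ : Gal(L/K), σ θ = 1)
  (hvθ : val OL L θ = exp ((q : ℤ) - 1))

/-- Left translation of functions on a group. -/
def leftTranslate (k G : Type*) [Semiring k] [Group G] : G →* Module.End k (G → k) where
  toFun τ := LinearMap.funLeft k k fun σ ↦ τ⁻¹ * σ
  map_one' := by ext; simp [LinearMap.funLeft]
  map_mul' τ τ' := LinearMap.ext fun f ↦ funext fun σ ↦ by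
    simp [LinearMap.funLeft, mul_assoc]

lemma leftTranslate_apply {k G : Type*} [Semiring k] [Group G] (τ : G) (f : G → k) (σ : G) :
    leftTranslate k G τ f σ = f (τ⁻¹ * σ) := rfl

omit [NeZero q] in
lemma galois_sum_smul {k : Type*} [Semiring k] [Module k L] (τ : Gal(L/K))
    (hsm : ∀ (a : k) (x : L), τ (a • x) = a • τ x) (a : Gal(L/K) → k) :
    τ (∑ σ, a σ • σ θ) = ∑ σ, a (τ⁻¹ * σ) • σ θ := by
  rw [map_sum]
  refine Finset.sum_bij (fun σ _ ↦ τ * σ) (by simp) (fun _ _ _ _ h ↦ mul_left_cancel h)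
    (fun σ _ ↦ ⟨τ⁻¹ * σ, by simp, by simp⟩) fun σ _ ↦ ?_
  rw [hsm, inv_mul_cancel_left, AlgEquiv.mul_apply]

-- A nonunit coefficient has v_L ≥ q, against v_L(θ) = 1 - q.
include hq htot hvθ in
lemma val_sum_smul_lt_one {a : Gal(L/K) → K} (ha : ∀ σ, val OL L (algebraMap K L (a σ)) < 1) :
    val OL L (∑ σ, a σ • σ θ) < 1 := by
  refine (val OL L).map_sum_lt one_ne_zero fun σ _ ↦ ?_
  rw [Algebra.smul_def, map_mul, val_galois OK OL σ, hvθ]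
  refine (mul_le_mul_left (val_base_le_of_lt_one hq htot (ha σ)) _).trans_lt ?_
  rw [← exp_add, ← exp_zero, exp_lt_exp]
  omega

-- The reductions of the integral families whose sum lies in 𝔓_L form a translation-stable subgroup
-- of the functions G → κ. If it were nonzero, it would contain a nonzero invariant, hence constant,
-- function; but as θ has trace one, a constant family sums to the constant itself, which then
-- vanishes modulo 𝔓_L.
include hq htot hn hcomm hθ hvθ in
lemma residue_eq_zero_of_val_sum_lt_one {a : Gal(L/K) → OK}
    (ha : val OL L (∑ σ, algebraMap OK K (a σ) • σ θ) < 1) (σ : Gal(L/K)) :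
    residue OK (a σ) = 0 := by
  have := charP_residueField OK K p
  have hadd : ∀ a b : Gal(L/K) → OK, ∑ σ, algebraMap OK K ((a - b) σ) • σ θ =
      ∑ σ, algebraMap OK K (a σ) • σ θ - ∑ σ, algebraMap OK K (b σ) • σ θ := by
    intro a b
    rw [← Finset.sum_sub_distrib]
    exact Finset.sum_congr rfl fun σ _ ↦ by rw [Pi.sub_apply, map_sub, sub_smul]
  let I : AddSubgroup (Gal(L/K) → ResidueField OK) := AddSubgroup.ofSub
    {f | ∃ a : Gal(L/K) → OK, (fun σ ↦ residue OK (a σ)) = f ∧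
      val OL L (∑ σ, algebraMap OK K (a σ) • σ θ) < 1} ⟨0, 0, by ext; simp, by simp⟩ (by
        rintro _ ⟨a, rfl, ha⟩ _ ⟨b, rfl, hb⟩
        refine ⟨a - b, by ext; simp [sub_eq_add_neg], ?_⟩
        rw [hadd]
        exact (val OL L).map_sub_lt ha hb)
  have hImem : ∀ f, f ∈ I ↔ ∃ a : Gal(L/K) → OK, (fun σ ↦ residue OK (a σ)) = f ∧
      val OL L (∑ σ, algebraMap OK K (a σ) • σ θ) < 1 := fun f ↦ Iff.rfl
  by_contra hne
  let T : Gal(L/K) → Module.End (ResidueField OK) (Gal(L/K) → ResidueField OK) :=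
    fun τ ↦ leftTranslate _ _ τ - 1
  have hTI : ∀ τ, ∀ f ∈ I, T τ f ∈ I := by
    rintro τ f ⟨a, rfl, ha⟩
    refine I.sub_mem ((hImem _).2 ⟨fun σ ↦ a (τ⁻¹ * σ), rfl, ?_⟩) ⟨a, rfl, ha⟩
    rw [← galois_sum_smul τ (fun b x ↦ map_smul τ b x) (fun σ ↦ algebraMap OK K (a σ)),
      val_galois OK OL τ]
    exact ha
  have hTc : ∀ σ τ, Commute (T σ) (T τ) := by
    intro σ τ
    refine Commute.sub_left (Commute.sub_right ?_ (Commute.one_right _)) (Commute.one_left _)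
    rw [Commute, SemiconjBy, ← map_mul, hcomm, map_mul]
  have hTn : ∀ σ, IsNilpotent (T σ) := by
    intro σ
    refine ⟨p ^ n, ?_⟩
    have : CharP (Module.End (ResidueField OK) (Gal(L/K) → ResidueField OK)) p :=
      charP_of_injective_algebraMap (algebraMap (ResidueField OK) _).injective p
    rw [sub_pow_char_pow_of_commute _ _ (Commute.one_right _), ← map_pow, ← hn,
      ← card_galois (L := L) hq htot, pow_card_eq_one', map_one, one_pow, sub_self]
  obtain ⟨f, hfI, hf0, hfT⟩ := exists_ne_zero_forall_apply_eq_zero T hTc hTn I hTI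
    ((hImem _).2 ⟨a, rfl, ha⟩) (fun h ↦ hne (congrFun h σ)) Finset.univ
  obtain ⟨b, rfl, hb⟩ := (hImem f).1 hfI
  have hconst : ∀ τ, residue OK (b τ) = residue OK (b 1) := by
    intro τ
    have := congrFun (hfT τ (Finset.mem_univ _)) τ
    rw [LinearMap.sub_apply, Pi.sub_apply, leftTranslate_apply, inv_mul_cancel, Pi.zero_apply,
      sub_eq_zero] at this
    exact this.symm
  have h1 : val OL L (∑ σ, (algebraMap OK K (b σ) - algebraMap OK K (b 1)) • σ θ) < 1 := by
    refine val_sum_smul_lt_one hq htot hvθ fun σ ↦ ?_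
    rw [← map_sub, ← IsScalarTower.algebraMap_apply, val_base_lt_one_iff hq htot,
      ← residue_eq_zero_iff, map_sub, hconst, sub_self]
  have h2 := (val OL L).map_sub_lt hb h1
  rw [← Finset.sum_sub_distrib] at h2
  simp_rw [← sub_smul, sub_sub_cancel] at h2
  rw [← Finset.smul_sum, hθ, ← Algebra.algebraMap_eq_smul_one, ← IsScalarTower.algebraMap_apply,
    val_base_lt_one_iff hq htot, ← residue_eq_zero_iff] at h2
  exact hf0 (funext fun τ ↦ (hconst τ).trans h2)

-- Dividing by a coefficient of largest valuation, if that is at least one, reduces to the integral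
-- case with a coefficient equal to 1.
include hq htot hn hcomm hθ hvθ in
lemma val_coeff_lt_one {a : Gal(L/K) → K} (ha : val OL L (∑ σ, a σ • σ θ) < 1) (σ : Gal(L/K)) :
    val OL L (algebraMap K L (a σ)) < 1 := by
  obtain ⟨ρ, -, hmax⟩ := (Finset.univ : Finset Gal(L/K)).exists_max_image
    (fun σ ↦ val OL L (algebraMap K L (a σ))) ⟨1, Finset.mem_univ _⟩
  refine (hmax σ (Finset.mem_univ _)).trans_lt ?_
  by_contra hcon
  rw [not_lt] at hcon
  have hρ0 : a ρ ≠ 0 := by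
    intro h
    rw [h, map_zero, map_zero] at hcon
    exact absurd hcon (not_le.2 zero_lt_one)
  have hvρ : val OL L (algebraMap K L (a ρ)) ≠ 0 := by
    rw [(val OL L).ne_zero_iff]
    simpa using hρ0
  have hint : ∀ σ, ∃ b : OK, algebraMap OK K b = a σ / a ρ := by
    intro σ
    rw [← val_base_le_one_iff (L := L) hq htot, map_div₀, map_div₀]
    exact div_le_one_of_le₀ (hmax σ (Finset.mem_univ _)) zero_le
  choose b hb using hint
  have h1 : ∑ σ, algebraMap OK K (b σ) • σ θ = (algebraMap K L (a ρ))⁻¹ * ∑ σ, a σ • σ θ := by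
    rw [Finset.mul_sum]
    refine Finset.sum_congr rfl fun σ _ ↦ ?_
    rw [hb, Algebra.smul_def, Algebra.smul_def, map_div₀]
    ring
  have h2 : val OL L (∑ σ, algebraMap OK K (b σ) • σ θ) < 1 := by
    rw [h1, map_mul, map_inv₀]
    exact (mul_le_of_le_one_left' (inv_le_one_of_one_le₀ hcon)).trans_lt ha
  have h3 := residue_eq_zero_of_val_sum_lt_one hq htot hn hcomm hθ hvθ h2 ρ
  have h4 : b ρ = 1 := by
    apply IsFractionRing.injective OK K
    rw [hb, div_self hρ0, map_one]
  rw [h4, map_one] at h3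
  exact one_ne_zero h3

include hq htot hn hcomm hθ hvθ in
lemma linearIndependent_conjugates : LinearIndependent K fun σ : Gal(L/K) ↦ σ θ := by
  rw [Fintype.linearIndependent_iff]
  intro a ha σ
  by_contra hne
  have h1 : ∑ τ, (a τ / a σ) • τ θ = 0 := by
    simp_rw [div_eq_inv_mul, mul_smul]
    rw [← Finset.smul_sum, ha, smul_zero]
  have h2 := val_coeff_lt_one (OL := OL) (OK := OK) (a := fun τ ↦ a τ / a σ) hq htot hn hcomm hθ hvθ
    (by rw [h1, map_zero]; exact zero_lt_one) σ
  rw [div_self hne, map_one, map_one] at h2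
  exact lt_irrefl _ h2

include hq htot hn hcomm hθ hvθ in
/-- The vanishing of the first cohomology of the maximal ideal, in an elementary form. -/
lemma exists_val_sub_base_lt_one {z : L} (hz : ∀ σ : Gal(L/K), val OL L (σ z - z) < 1) :
    ∃ a : K, val OL L (z - algebraMap K L a) < 1 := by
  have hli := linearIndependent_conjugates (OK := OK) (OL := OL) hq htot hn hcomm hθ hvθ
  have hspan := hli.span_eq_top_of_card_eq_finrank' (by
    rw [← Nat.card_eq_fintype_card, card_galois (L := L) hq htot, hq])
  have hzmem : z ∈ Submodule.span K (Set.range fun σ : Gal(L/K) ↦ σ θ) := by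
    rw [hspan]
    trivial
  obtain ⟨a, rfl⟩ := (Submodule.mem_span_range_iff_exists_fun K).1 hzmem
  -- The coefficient of σθ in σz - z is a_1 - a_σ, so all a_σ agree with a_1 modulo the maximal
  -- ideal. As θ has trace one, subtracting a_1 from z subtracts it from every coefficient.
  refine ⟨a 1, ?_⟩
  have h1 : ∑ σ, a σ • σ θ - algebraMap K L (a 1) = ∑ σ, (a σ - a 1) • σ θ := by
    simp_rw [sub_smul]
    rw [Finset.sum_sub_distrib, ← Finset.smul_sum, hθ, ← Algebra.algebraMap_eq_smul_one]
  rw [h1]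
  refine val_sum_smul_lt_one hq htot hvθ fun σ ↦ ?_
  have h2 := hz σ
  rw [galois_sum_smul σ (fun b x ↦ map_smul σ b x), ← Finset.sum_sub_distrib] at h2
  simp_rw [← sub_smul] at h2
  have h3 := val_coeff_lt_one hq htot hn hcomm hθ hvθ h2 σ
  rw [inv_mul_cancel, map_sub, (val OL L).map_sub_swap] at h3
  rwa [map_sub]

end NormalBasis

/-! ### The translation generator -/

section Translation

variable {p : ℕ} [Fact p.Prime] [CharP K p] {n : ℕ} (hn : q = p ^ n)
  (hweak : IsWeaklyRamified OK K OL L)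

include hq htot hn hweak in
/-- A weakly and totally ramified extension of degree `p ^ n` is generated by an element of
valuation `-1` on which the Galois group acts by translations. -/
theorem exists_translation : ∃ (c : Gal(L/K) → OK) (y : L),
    (∀ σ τ, σ ≠ τ → IsUnit (c σ - c τ)) ∧ val OL L y = exp 1 ∧
      ∀ σ, σ y = y + algebraMap OK L (c σ) := by
  obtain ⟨π, hπ⟩ := IsDiscreteValuationRing.exists_irreducible OL
  obtain ⟨c, hc, hc0, hcπ⟩ := exists_ramification_character hq htot hπ hn hweak
  obtain ⟨θ, hθ, hvθ⟩ := exists_trace_one hq htot hc0 hπ hcπ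
  have hc1 : c 1 = 0 := by
    have := hc 1 1
    rw [one_mul] at this
    simpa using this.symm
  have hcinv : ∀ σ, c σ⁻¹ = - c σ := by
    intro σ
    rw [eq_neg_iff_add_eq_zero, ← hc, inv_mul_cancel, hc1]
  have hinj : ∀ σ τ, residue OK (c σ) = residue OK (c τ) → σ = τ := by
    intro σ τ h
    have := hc0 (σ * τ⁻¹) (by rw [hc, hcinv, map_add, map_neg, h, add_neg_cancel])
    rwa [mul_inv_eq_one] at this
  have hcomm : ∀ σ τ : Gal(L/K), σ * τ = τ * σ := fun σ τ ↦
    hinj _ _ (by rw [hc, hc, add_comm])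
  set Y := (algebraMap OL L π)⁻¹ with hY
  -- The additive Hilbert 90 solution for the cocycle c; its valuation is not controlled yet.
  let y₀ : L := -∑ τ : Gal(L/K), algebraMap OK K (c τ) • τ θ
  have hy₀ : ∀ σ : Gal(L/K), σ y₀ = y₀ + algebraMap OK L (c σ) := by
    intro σ
    simp only [y₀]
    rw [map_neg, galois_sum_smul σ (fun b x ↦ map_smul σ b x) (fun τ ↦ algebraMap OK K (c τ))]
    simp_rw [hc, hcinv, map_add, add_smul, map_neg, neg_smul]
    rw [Finset.sum_add_distrib, Finset.sum_neg_distrib, ← Finset.smul_sum, hθ,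
      ← Algebra.algebraMap_eq_smul_one, ← IsScalarTower.algebraMap_apply]
    ring
  -- Both y₀ and π⁻¹ are translated by c up to 𝔓_L, so they differ by an element of K modulo 𝔓_L.
  -- Subtracting it from y₀ leaves an element as large as π⁻¹ with the same translations.
  obtain ⟨a, ha⟩ := exists_val_sub_base_lt_one (z := y₀ - Y) hq htot hn hcomm hθ hvθ (by
    intro σ
    have : σ (y₀ - Y) - (y₀ - Y) = -(σ Y - Y - algebraMap OK L (c σ)) := by
      rw [map_sub, hy₀]
      ring
    rw [this, Valuation.map_neg]
    exact hcπ σ)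
  refine ⟨c, y₀ - algebraMap K L a, ?_, ?_, ?_⟩
  · intro σ τ hne
    by_contra hu
    have : c σ - c τ ∈ maximalIdeal OK := hu
    rw [← residue_eq_zero_iff, map_sub, sub_eq_zero] at this
    exact hne (hinj _ _ this)
  · have hvY : val OL L Y = exp 1 := by
      rw [hY, map_inv₀, val_irreducible hπ, ← exp_neg, neg_neg]
    rw [← hvY]
    refine (val OL L).map_eq_of_sub_lt ?_
    rw [hvY, sub_right_comm]
    refine ha.trans ?_
    rw [← exp_zero, exp_lt_exp]
    omega
  · intro σ
    rw [map_sub, hy₀, AlgEquiv.commutes]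
    ring

end Translation

end Extension

/-! ### Hasse derivatives in the group algebra -/

/-- A generator of a totally ramified extension of degree `p ^ n`, of valuation `-1`, on which the
Galois group acts by translations with distinct residue classes. -/
structure TranslationGenerator (OK K OL L : Type*)
    [CommRing OK] [IsDomain OK] [IsDiscreteValuationRing OK] [Field K] [Algebra OK K]
    [IsFractionRing OK K] [CommRing OL] [IsDomain OL] [IsDiscreteValuationRing OL] [Field L]
    [Algebra OL L] [IsFractionRing OL L] [Algebra K L] [Algebra OK OL] [Algebra OK L]
    [IsScalarTower OK K L] [IsScalarTower OK OL L] (p n : ℕ) where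
  finrank_eq : Module.finrank K L = p ^ n
  totallyRamified : IsTotallyRamified OK K OL L
  y : L
  shift : Gal(L/K) → OK
  enum : Fin (p ^ n) ≃ Gal(L/K)
  isUnit_sub : ∀ σ τ, σ ≠ τ → IsUnit (shift σ - shift τ)
  val_y : val OL L y = exp 1
  galois_y : ∀ σ, σ y = y + algebraMap OK L (shift σ)

namespace TranslationGenerator

variable {OK : Type*} {K : Type*} {OL : Type*} {L : Type*}
  [CommRing OK] [IsDomain OK] [IsDiscreteValuationRing OK] [Field K] [Algebra OK K]
  [IsFractionRing OK K] [CommRing OL] [IsDomain OL] [IsDiscreteValuationRing OL] [Field L]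
  [Algebra OL L] [IsFractionRing OL L] [Algebra K L] [Algebra OK OL] [Algebra OK L]
  [IsScalarTower OK K L] [IsScalarTower OK OL L]
  {p n : ℕ} [hp : Fact p.Prime] [CharP K p] (Y : TranslationGenerator OK K OL L p n)

/-- The Vandermonde matrix of the translations. -/
def vdm : Matrix (Fin (p ^ n)) (Fin (p ^ n)) OK :=
  Matrix.vandermonde fun a ↦ Y.shift (Y.enum a)

omit hp in
lemma isUnit_det_vdm : IsUnit Y.vdm.det := by
  rw [vdm, Matrix.det_vandermonde]
  refine IsUnit.prod_univ_iff.2 fun i ↦ IsUnit.prod_iff.2 fun j hj ↦ Y.isUnit_sub _ _ fun h ↦ ?_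
  exact (Finset.mem_Ioi.1 hj).ne' (Y.enum.injective h)

/-- The elements of `K[G]` acting on polynomials of degree less than `p ^ n` in the generator as
the Hasse derivatives. -/
def hasse (i : ℕ) : MonoidAlgebra K Gal(L/K) :=
  if h : i < p ^ n then
    ∑ a, MonoidAlgebra.single (Y.enum a) (algebraMap OK K (Y.vdm⁻¹ ⟨i, h⟩ a)) else 0

lemma hasse_of_le {i : ℕ} (h : p ^ n ≤ i) : Y.hasse i = 0 := dif_neg (not_lt.2 h)

lemma galAction_single (σ : Gal(L/K)) (a : K) (x : L) :
    galAction K L (MonoidAlgebra.single σ a) x = a • σ x := by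
  rw [galAction, Representation.asAlgebraHom_single]
  rfl

/-- In the binomial expansion of (y + c(σ))^j all exponents of c(σ) are below p^n, so row i of the
inverse Vandermonde matrix isolates the term with c(σ)^i. -/
lemma galAction_hasse (i : ℕ) {j : ℕ} (hj : j < p ^ n) :
    galAction K L (Y.hasse i) (Y.y ^ j) = (j.choose i : K) • Y.y ^ (j - i) := by
  by_cases hi : i < p ^ n
  swap
  · rw [Y.hasse_of_le (not_lt.1 hi), map_zero, LinearMap.zero_apply,
      Nat.choose_eq_zero_of_lt (by omega), Nat.cast_zero, zero_smul]
  have hinv := Matrix.nonsing_inv_mul _ Y.isUnit_det_vdm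
  have hent : ∀ m (hm : m < p ^ n), ∑ a, Y.vdm⁻¹ ⟨i, hi⟩ a * Y.shift (Y.enum a) ^ m =
      if m = i then 1 else 0 := by
    intro m hm
    have := congrFun (congrFun hinv ⟨i, hi⟩) ⟨m, hm⟩
    rw [Matrix.mul_apply, Matrix.one_apply] at this
    simpa [vdm, Matrix.vandermonde_apply, eq_comm] using this
  rw [hasse, dif_pos hi, map_sum, LinearMap.sum_apply]
  have h1 : ∀ a, galAction K L (MonoidAlgebra.single (Y.enum a)
      (algebraMap OK K (Y.vdm⁻¹ ⟨i, hi⟩ a))) (Y.y ^ j) =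
      ∑ m ∈ Finset.range (j + 1), algebraMap OK L (Y.vdm⁻¹ ⟨i, hi⟩ a * Y.shift (Y.enum a) ^ m) *
        (Y.y ^ (j - m) * (j.choose m : L)) := by
    intro a
    rw [galAction_single, map_pow, Y.galois_y, add_comm, add_pow, Algebra.smul_def,
      ← IsScalarTower.algebraMap_apply, Finset.mul_sum]
    refine Finset.sum_congr rfl fun m _ ↦ ?_
    rw [map_mul, map_pow]
    ring
  rw [Finset.sum_congr rfl fun a _ ↦ h1 a, Finset.sum_comm]
  simp_rw [← Finset.sum_mul, ← map_sum]
  rw [Finset.sum_congr rfl fun m hm ↦ by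
    rw [hent m (by rw [Finset.mem_range] at hm; omega)]]
  simp only [apply_ite (algebraMap OK L), map_one, map_zero, ite_mul, one_mul, zero_mul]
  rw [Finset.sum_ite_eq', Algebra.smul_def, map_natCast]
  split_ifs with h
  · ring
  · rw [Finset.mem_range] at h
    rw [Nat.choose_eq_zero_of_lt (by omega), Nat.cast_zero, zero_mul]

lemma val_y_pow (j : ℕ) : val OL L (Y.y ^ j) = exp (j : ℤ) := by
  rw [map_pow, Y.val_y, ← zpow_natCast, ← exp_zsmul]
  simp

lemma natCast_injOn (i j : Fin (p ^ n)) (h : ((p ^ n : ℕ) : ℤ) ∣ (i.1 : ℤ) - (j.1 : ℤ)) :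
    i = j := by
  have h1 := Int.eq_zero_of_abs_lt_dvd h (by rw [abs_lt]; omega)
  ext
  omega

lemma linearIndependent_pow : LinearIndependent K fun j : Fin (p ^ n) ↦ Y.y ^ (j : ℕ) :=
  linearIndependent_of_val Y.finrank_eq Y.totallyRamified (g := fun j ↦ (j.1 : ℤ))
    (fun j ↦ Y.val_y_pow j) natCast_injOn

/-- The basis of powers of the generator. -/
def powBasis : Module.Basis (Fin (p ^ n)) K L :=
  have : Nonempty (Fin (p ^ n)) := ⟨⟨0, pow_pos hp.out.pos n⟩⟩
  basisOfLinearIndependentOfCardEqFinrank Y.linearIndependent_pow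
    (by rw [Fintype.card_fin, Y.finrank_eq])

lemma powBasis_apply (j : Fin (p ^ n)) : Y.powBasis j = Y.y ^ (j : ℕ) := by
  rw [powBasis, coe_basisOfLinearIndependentOfCardEqFinrank]

lemma choose_pred_ne_zero {i : ℕ} (hi : i < p ^ n) : ((p ^ n - 1).choose i : K) ≠ 0 := by
  rw [Ne, CharP.cast_eq_zero_iff K p]
  have := noCarry_compl hi
  rwa [NoCarry, show i + (p ^ n - 1 - i) = p ^ n - 1 by omega] at this

lemma galAction_sum_hasse (a : Fin (p ^ n) → K) :
    galAction K L (∑ i, a i • Y.hasse i) (Y.y ^ (p ^ n - 1)) =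
      ∑ i, (a (Fin.rev i) * ((p ^ n - 1).choose (Fin.rev i) : K)) • Y.powBasis i := by
  have hq : 0 < p ^ n := pow_pos hp.out.pos n
  rw [map_sum, LinearMap.sum_apply, ← Equiv.sum_comp Fin.revPerm]
  refine Finset.sum_congr rfl fun i _ ↦ ?_
  rw [map_smul, LinearMap.smul_apply, Y.galAction_hasse _ (by omega), smul_smul, powBasis_apply]
  simp only [Fin.revPerm_apply]
  congr 2
  rw [Fin.val_rev]
  omega

lemma eq_zero_of_galAction_sum {a : Fin (p ^ n) → K}
    (h : galAction K L (∑ i, a i • Y.hasse i) (Y.y ^ (p ^ n - 1)) = 0) (i : Fin (p ^ n)) :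
    a i = 0 := by
  rw [galAction_sum_hasse] at h
  have := Fintype.linearIndependent_iff.1 Y.powBasis.linearIndependent _ h (Fin.rev i)
  rw [Fin.rev_rev, mul_eq_zero] at this
  exact this.resolve_right (choose_pred_ne_zero i.2)

/-- The basis of `K[G]` of Hasse derivatives. -/
def hasseBasis : Module.Basis (Fin (p ^ n)) K (MonoidAlgebra K Gal(L/K)) :=
  Module.Basis.mk (v := fun i : Fin (p ^ n) ↦ Y.hasse i)
    (Fintype.linearIndependent_iff.2 fun a ha i ↦ Y.eq_zero_of_galAction_sum
      (by rw [ha, map_zero, LinearMap.zero_apply]) i) (by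
    rintro x -
    have key : ∀ a, MonoidAlgebra.single (Y.enum a) (1 : K) ∈
        Submodule.span K (Set.range fun i : Fin (p ^ n) ↦ Y.hasse i) := by
      intro a
      have hinv := Matrix.mul_nonsing_inv _ Y.isUnit_det_vdm
      have : MonoidAlgebra.single (Y.enum a) (1 : K) =
          ∑ i : Fin (p ^ n), algebraMap OK K (Y.vdm a i) • Y.hasse i := by
        simp_rw [hasse, Fin.is_lt, dif_pos, Fin.eta, Finset.smul_sum, MonoidAlgebra.smul_single]
        rw [Finset.sum_comm]
        have h2 : ∀ a', ∑ i, MonoidAlgebra.single (Y.enum a')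
            (algebraMap OK K (Y.vdm a i) • algebraMap OK K (Y.vdm⁻¹ i a')) =
            if a = a' then MonoidAlgebra.single (Y.enum a) (1 : K) else 0 := by
          intro a'
          have := congrFun (congrFun hinv a) a'
          rw [Matrix.mul_apply, Matrix.one_apply] at this
          simp_rw [smul_eq_mul, ← map_mul, ← MonoidAlgebra.singleAddHom_apply]
          rw [← map_sum (MonoidAlgebra.singleAddHom (Y.enum a')), ← map_sum, this]
          split_ifs with h
          · rw [h, map_one, MonoidAlgebra.singleAddHom_apply]
          · rw [map_zero, map_zero]
        rw [Finset.sum_congr rfl fun a' _ ↦ h2 a', Finset.sum_ite_eq, if_pos (Finset.mem_univ _)]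
      rw [this]
      exact Submodule.sum_mem _ fun i _ ↦ Submodule.smul_mem _ _ (Submodule.subset_span ⟨i, rfl⟩)
    induction x using MonoidAlgebra.induction_linear with
    | zero => exact zero_mem _
    | add x y hx hy => exact add_mem hx hy
    | single σ r =>
      have h2 := Submodule.smul_mem _ r (key (Y.enum.symm σ))
      rwa [MonoidAlgebra.smul_single, smul_eq_mul, mul_one, Equiv.apply_symm_apply] at h2)

lemma hasseBasis_apply (i : Fin (p ^ n)) : Y.hasseBasis i = Y.hasse i := by
  rw [hasseBasis, Module.Basis.mk_apply]

/-- The top power y^(p^n - 1) generates L freely over K[G], because the coefficients C(p^n - 1, i)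
are nonzero in K. Identities in K[G] can thus be checked on this one vector. -/
lemma galAction_injective {x x' : MonoidAlgebra K Gal(L/K)}
    (h : galAction K L x (Y.y ^ (p ^ n - 1)) = galAction K L x' (Y.y ^ (p ^ n - 1))) : x = x' := by
  rw [← sub_eq_zero, ← Y.hasseBasis.sum_repr (x - x')]
  have h1 : galAction K L (x - x') (Y.y ^ (p ^ n - 1)) = 0 := by
    rw [map_sub, LinearMap.sub_apply, h, sub_self]
  rw [← Y.hasseBasis.sum_repr (x - x')] at h1
  simp_rw [hasseBasis_apply] at h1
  exact Finset.sum_eq_zero fun i _ ↦ by rw [Y.eq_zero_of_galAction_sum h1 i, zero_smul]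

lemma hasse_zero : Y.hasse 0 = 1 := by
  have hq : 0 < p ^ n := pow_pos hp.out.pos n
  refine Y.galAction_injective ?_
  rw [Y.galAction_hasse _ (by omega), map_one, Module.End.one_apply, Nat.choose_zero_right,
    Nat.cast_one, one_smul, Nat.sub_zero]

lemma hasse_mul (i k : ℕ) :
    Y.hasse i * Y.hasse k = ((i + k).choose i : K) • Y.hasse (i + k) := by
  have hq : 0 < p ^ n := pow_pos hp.out.pos n
  refine Y.galAction_injective ?_
  rw [map_mul, Module.End.mul_apply, Y.galAction_hasse _ (by omega), map_smul,
    Y.galAction_hasse _ (by omega), map_smul, LinearMap.smul_apply, Y.galAction_hasse _ (by omega),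
    smul_smul, smul_smul, ← Nat.cast_mul, ← Nat.cast_mul, show p ^ n - 1 - k - i = p ^ n - 1 - (i + k) by omega]
  congr 2
  rcases le_or_gt (i + k) (p ^ n - 1) with h | h
  · rw [mul_comm ((i + k).choose i), Nat.choose_symm_add, Nat.choose_mul (Nat.le_add_left k i),
      Nat.add_sub_cancel]
  · rw [Nat.choose_eq_zero_of_lt h, mul_zero]
    rcases le_or_gt k (p ^ n - 1) with h' | h'
    · rw [Nat.choose_eq_zero_of_lt (show p ^ n - 1 - k < i by omega), mul_zero]
    · rw [Nat.choose_eq_zero_of_lt h', zero_mul]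

/-- The components along the powers of y have distinct valuations modulo p^n, so none exceeds the
sum in size. -/
lemma repr_smul_mem_idealPow {h : ℤ} {x : L} :
    x ∈ idealPow OL L h ↔ ∀ j, Y.powBasis.repr x j • Y.y ^ (j : ℕ) ∈ idealPow OL L h := by
  constructor
  · intro hx j
    rw [mem_idealPow_iff] at hx ⊢
    refine le_trans ?_ hx
    conv_rhs => rw [← Y.powBasis.sum_repr x]
    simp_rw [powBasis_apply]
    exact le_val_sum_smul Y.finrank_eq Y.totallyRamified (u := fun j : Fin (p ^ n) ↦ Y.y ^ (j : ℕ))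
      (g := fun j ↦ (j.1 : ℤ)) (fun j ↦ Y.val_y_pow j) natCast_injOn _ j
  · intro hx
    rw [← Y.powBasis.sum_repr x]
    refine Submodule.sum_mem _ fun j _ ↦ ?_
    rw [powBasis_apply]
    exact hx j

/-! ### Coordinates of a fractional ideal -/

section Ideal

variable {t : OK} (ht : Irreducible t) {h m : ℤ} {b : ℕ} (hb : b < p ^ n)
  (hh : h = b + 1 + (p ^ n : ℕ) * (m - 1))

omit hp in
lemma algebraMap_t_ne_zero (K : Type*) [Field K] [Algebra OK K] [IsFractionRing OK K]
    (ht : Irreducible t) : algebraMap OK K t ≠ 0 := by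
  rw [Ne, IsFractionRing.to_map_eq_zero_iff]
  exact ht.ne_zero

include ht hb hh in
lemma smul_pow_mem_idealPow_iff {j : ℕ} (hj : j < p ^ n) {a : K} :
    a • Y.y ^ j ∈ idealPow OL L h ↔
      ∃ c : OK, a = algebraMap OK K t ^ (m + (eps (p ^ n) b j : ℤ)) * algebraMap OK K c := by
  have hq : 0 < p ^ n := pow_pos hp.out.pos n
  have : NeZero (p ^ n) := ⟨hq.ne'⟩
  set q := p ^ n with hqdef
  have ht0 := algebraMap_t_ne_zero K ht
  -- The condition is q r ≥ h + j = q(m - 1) + b + 1 + j; as 1 ≤ b + 1 + j < 2q, rounding up gives m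
  -- + ε_j.
  have hkey : ∀ r : ℤ, -((q : ℤ) * r) + j ≤ -h ↔ m + (eps q b j : ℤ) ≤ r := by
    intro r
    rw [hh]
    have h1 : (q : ℤ) * (m - 1) = q * m - q := by ring
    rw [h1]
    unfold eps
    have hq' : (0 : ℤ) < q := by exact_mod_cast hq
    split_ifs with hjb
    · constructor
      · intro H
        by_contra hcon
        have h2 : (q : ℤ) * r ≤ q * m := mul_le_mul_of_nonneg_left (by push_cast at hcon; omega)
          hq'.le
        omega
      · intro H
        have h2 : (q : ℤ) * (m + 1) ≤ q * r := mul_le_mul_of_nonneg_left (by push_cast at H; omega)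
          hq'.le
        rw [mul_add, mul_one] at h2
        omega
    · constructor
      · intro H
        by_contra hcon
        have h2 : (q : ℤ) * (r + 1) ≤ q * m := mul_le_mul_of_nonneg_left
          (by push_cast at hcon; omega) hq'.le
        rw [mul_add, mul_one] at h2
        omega
      · intro H
        have h2 : (q : ℤ) * m ≤ q * r := mul_le_mul_of_nonneg_left (by push_cast at H; omega)
          hq'.le
        omega
  rw [mem_idealPow_iff, Algebra.smul_def, map_mul, Y.val_y_pow]
  rcases eq_or_ne a 0 with rfl | ha
  · simp only [map_zero, zero_mul, zero_le, true_iff]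
    exact ⟨0, by rw [map_zero, mul_zero]⟩
  obtain ⟨r, u, rfl⟩ := exists_eq_zpow_mul ht ha
  rw [val_zpow_mul_base Y.finrank_eq Y.totallyRamified ht, ← exp_add, exp_le_exp, hkey]
  constructor
  · intro H
    refine ⟨t ^ (r - (m + eps q b j)).toNat * u, ?_⟩
    rw [map_mul, map_pow, ← mul_assoc, ← zpow_natCast (algebraMap OK K t), ← zpow_add₀ ht0]
    congr 2
    omega
  · rintro ⟨c, hc⟩
    have hc0 : c ≠ 0 := by
      rintro rfl
      rw [map_zero, mul_zero] at hc
      exact ha hc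
    obtain ⟨i, w, rfl⟩ := IsDiscreteValuationRing.eq_unit_mul_pow_irreducible hc0 ht
    rw [mul_comm (w : OK), map_mul, map_pow, ← zpow_natCast (algebraMap OK K t), ← mul_assoc,
      ← zpow_add₀ ht0] at hc
    have h3 := congrArg (fun x ↦ val OL L (algebraMap K L x)) hc
    rw [val_zpow_mul_base Y.finrank_eq Y.totallyRamified ht,
      val_zpow_mul_base Y.finrank_eq Y.totallyRamified ht, exp_inj, neg_inj] at h3
    have := mul_left_cancel₀ (by exact_mod_cast hq.ne') h3
    omega

end Ideal

end TranslationGenerator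

/-! ### Monomial bases of the ideal and of its associated order -/

namespace TranslationGenerator

variable {OK : Type*} {K : Type*} {OL : Type*} {L : Type*}
  [CommRing OK] [IsDomain OK] [IsDiscreteValuationRing OK] [Field K] [Algebra OK K]
  [IsFractionRing OK K] [CommRing OL] [IsDomain OL] [IsDiscreteValuationRing OL] [Field L]
  [Algebra OL L] [IsFractionRing OL L] [Algebra K L] [Algebra OK OL] [Algebra OK L]
  [IsScalarTower OK K L] [IsScalarTower OK OL L]
  {p n : ℕ} [hp : Fact p.Prime] [CharP K p] (Y : TranslationGenerator OK K OL L p n)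

lemma powBasis_repr_pow {j : ℕ} (hj : j < p ^ n) (k : Fin (p ^ n)) :
    Y.powBasis.repr (Y.y ^ j) k = if j = k.1 then 1 else 0 := by
  have := Y.powBasis_apply ⟨j, hj⟩
  simp only at this
  rw [← this, Module.Basis.repr_self, Finsupp.single_apply]
  simp [Fin.ext_iff]

/-- Only D_i lowers the exponent by exactly i, so the y^k-coordinate of the image of y^(i+k) reads
off the D_i-coordinate. -/
lemma hasseBasis_repr_smul_pow {x : MonoidAlgebra K Gal(L/K)} (i : Fin (p ^ n)) {k : ℕ}
    (hk : i.1 + k < p ^ n) :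
    Y.powBasis.repr (galAction K L x (Y.y ^ (i.1 + k))) ⟨k, by omega⟩ =
      Y.hasseBasis.repr x i * ((i.1 + k).choose i.1 : K) := by
  conv_lhs => rw [← Y.hasseBasis.sum_repr x]
  rw [map_sum, LinearMap.sum_apply, map_sum, Finsupp.coe_finsetSum, Finset.sum_apply,
    Finset.sum_eq_single i]
  · rw [hasseBasis_apply, map_smul, LinearMap.smul_apply, Y.galAction_hasse _ hk, map_smul,
      map_smul, Finsupp.smul_apply, Finsupp.smul_apply, Nat.add_sub_cancel_left,
      Y.powBasis_repr_pow (by omega), if_pos rfl]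
    simp
  · intro l _ hl
    rw [hasseBasis_apply, map_smul, LinearMap.smul_apply, Y.galAction_hasse _ hk, map_smul,
      map_smul, Finsupp.smul_apply, Finsupp.smul_apply, Y.powBasis_repr_pow (by omega)]
    by_cases hlk : i.1 + k < l
    · rw [Nat.choose_eq_zero_of_lt hlk, Nat.cast_zero, zero_smul, smul_zero]
    · rw [if_neg, smul_zero, smul_zero]
      simp only
      intro heq
      exact hl (Fin.ext (by omega))
  · simp

variable {t : OK} (ht : Irreducible t) {h m : ℤ} {b : ℕ} (hb : b < p ^ n)
  (hh : h = b + 1 + (p ^ n : ℕ) * (m - 1))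

/-- The basis of an ideal consisting of multiples of powers of the generator. -/
def idealVec (t : OK) (m : ℤ) (b j : ℕ) : L :=
  algebraMap OK K t ^ (m + (eps (p ^ n) b j : ℤ)) • Y.y ^ j

/-- The basis of an associated order consisting of multiples of Hasse derivatives. -/
def orderElt (t : OK) (b i : ℕ) : MonoidAlgebra K Gal(L/K) :=
  algebraMap OK K t ^ (-(wt (max b (p ^ n - b)) i : ℤ)) • Y.hasse i

include ht hb hh in
lemma idealVec_mem {j : ℕ} (hj : j < p ^ n) : Y.idealVec t m b j ∈ idealPow OL L h := by
  rw [idealVec, Y.smul_pow_mem_idealPow_iff ht hb hh hj]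
  exact ⟨1, by rw [map_one, mul_one]⟩

include ht in
lemma galAction_orderElt {i j : ℕ} (hj : j < p ^ n) :
    galAction K L (Y.orderElt t b i) (Y.idealVec t m b j) =
      algebraMap OK K (j.choose i * t ^ (eps (p ^ n) b j - eps (p ^ n) b (j - i) -
        wt (max b (p ^ n - b)) i)) • Y.idealVec t m b (j - i) := by
  have ht0 := algebraMap_t_ne_zero K ht
  rw [orderElt, idealVec, idealVec, map_smul, map_smul, LinearMap.smul_apply,
    Y.galAction_hasse i hj, smul_smul, smul_smul, smul_smul]
  by_cases hij : j < i
  · rw [Nat.choose_eq_zero_of_lt hij, Nat.cast_zero, Nat.cast_zero, mul_zero, zero_mul, map_zero,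
      zero_mul]
  · have hle := eps_add_wt_le (b := b) (show i + (j - i) < p ^ n by omega)
    rw [show i + (j - i) = j by omega] at hle
    congr 1
    rw [map_mul, map_natCast, map_pow, ← zpow_natCast]
    have hz := zpow_add₀ ht0 (m + (eps (p ^ n) b j : ℤ)) (-(wt (max b (p ^ n - b)) i : ℤ))
    rw [show m + (eps (p ^ n) b j : ℤ) + -(wt (max b (p ^ n - b)) i : ℤ) =
      ((eps (p ^ n) b j - eps (p ^ n) b (j - i) - wt (max b (p ^ n - b)) i : ℕ) : ℤ) +
        (m + (eps (p ^ n) b (j - i) : ℤ)) by omega, zpow_add₀ ht0] at hz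
    linear_combination -(j.choose i : K) * hz

include ht hb hh in
lemma orderElt_mem (i : ℕ) :
    Y.orderElt t b i ∈ associatedOrder OK K OL L h := by
  intro x hx
  have ht0 := algebraMap_t_ne_zero K ht
  rw [Y.repr_smul_mem_idealPow] at hx
  rw [← Y.powBasis.sum_repr x, map_sum]
  refine Submodule.sum_mem _ fun j _ ↦ ?_
  obtain ⟨c, hc⟩ := (Y.smul_pow_mem_idealPow_iff ht hb hh j.2).1 (hx j)
  have h1 : Y.powBasis.repr x j • Y.powBasis j = algebraMap OK K c • Y.idealVec t m b j := by
    rw [hc, powBasis_apply, idealVec, smul_smul, mul_comm]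
  rw [h1, map_smul, Y.galAction_orderElt ht j.2, smul_smul, ← map_mul, algebraMap_smul,
    ← algebraMap_smul OL]
  exact Submodule.smul_mem _ _ (Y.idealVec_mem ht hb hh (by omega))

include ht hb hh in
lemma exists_repr_of_mem {x : L} (hx : x ∈ idealPow OL L h) (j : Fin (p ^ n)) :
    ∃ c : OK, Y.powBasis.repr x j =
      algebraMap OK K t ^ (m + (eps (p ^ n) b j : ℤ)) * algebraMap OK K c :=
  (Y.smul_pow_mem_idealPow_iff ht hb hh j.2).1 (Y.repr_smul_mem_idealPow.1 hx j)

include ht hb hh in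
-- Take k from `exists_eps_eq`. Applying x to the ideal's basis vector of index i + k and reading
-- the coordinate at y^k gives the D_i-coordinate times a binomial unit, with exactly w_i as the
-- admissible denominator exponent.
lemma exists_hasseBasis_repr {x : MonoidAlgebra K Gal(L/K)}
    (hx : x ∈ associatedOrder OK K OL L h) (i : Fin (p ^ n)) :
    ∃ c : OK, Y.hasseBasis.repr x i =
      algebraMap OK K c * algebraMap OK K t ^ (-(wt (max b (p ^ n - b)) i : ℤ)) := by
  have := charP_base OK K p
  have ht0 := algebraMap_t_ne_zero K ht
  obtain ⟨k, hk, hnc, heps⟩ := exists_eps_eq (p := p) (n := n) (b := b) i.2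
  have h1 := hx _ (Y.idealVec_mem ht hb hh hk)
  obtain ⟨c, hc⟩ := Y.exists_repr_of_mem ht hb hh h1 ⟨k, by omega⟩
  rw [idealVec, map_smul, map_smul, Finsupp.smul_apply, Y.hasseBasis_repr_smul_pow i hk,
    smul_eq_mul] at hc
  have hu : IsUnit (((i.1 + k).choose i.1 : ℕ) : OK) :=
    (CharP.isUnit_natCast_iff (p := p) (Fact.out)).2 hnc
  obtain ⟨d, hd⟩ := hu.exists_right_inv
  have hd' : (((i.1 + k).choose i.1 : ℕ) : K) * algebraMap OK K d = 1 := by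
    rw [← map_natCast (algebraMap OK K), ← map_mul, hd, map_one]
  refine ⟨c * d, ?_⟩
  have hT : algebraMap OK K t ^ (m + (eps (p ^ n) b (i.1 + k) : ℤ)) ≠ 0 := zpow_ne_zero _ ht0
  apply mul_left_cancel₀ hT
  have h2 : algebraMap OK K t ^ (m + (eps (p ^ n) b k : ℤ)) =
      algebraMap OK K t ^ (m + (eps (p ^ n) b (i.1 + k) : ℤ)) *
        algebraMap OK K t ^ (-(wt (max b (p ^ n - b)) i : ℤ)) := by
    rw [← zpow_add₀ ht0]
    congr 1
    omega
  calc _ = algebraMap OK K t ^ (m + (eps (p ^ n) b (i.1 + k) : ℤ)) * Y.hasseBasis.repr x i *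
        ((((i.1 + k).choose i.1 : ℕ) : K) * algebraMap OK K d) := by rw [hd', mul_one]
    _ = algebraMap OK K t ^ (m + (eps (p ^ n) b (i.1 + k) : ℤ)) * (Y.hasseBasis.repr x i *
        (((i.1 + k).choose i.1 : ℕ) : K)) * algebraMap OK K d := by ring
    _ = _ := by
      rw [hc, h2, map_mul]
      ring

/-- The monomial basis of an associated order. -/
def monomialBasis : MonomialBasis OK (associatedOrder OK K OL L h) (p ^ n) where
  elt i := if hi : i < p ^ n then ⟨Y.orderElt t b i, Y.orderElt_mem ht hb hh i⟩ else 0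
  basis := Module.Basis.mk
    (v := fun i : Fin (p ^ n) ↦ (⟨Y.orderElt t b i, Y.orderElt_mem ht hb hh i⟩ :
      associatedOrder OK K OL L h))
    (by
      have ht0 := algebraMap_t_ne_zero K ht
      rw [Fintype.linearIndependent_iff]
      intro a ha i
      have h1 := congrArg Subtype.val ha
      have h2 := Fintype.linearIndependent_iff.1 Y.hasseBasis.linearIndependent
        (fun i ↦ algebraMap OK K (a i) * algebraMap OK K t ^ (-(wt (max b (p ^ n - b)) i : ℤ)))
        (by
          refine Eq.trans ?_ h1
          rw [AddSubmonoidClass.coe_finsetSum]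
          refine Finset.sum_congr rfl fun i _ ↦ ?_
          change _ = a i • Y.orderElt t b i
          rw [orderElt, hasseBasis_apply, mul_smul, algebraMap_smul]) i
      have h3 := (mul_eq_zero.1 h2).resolve_right (zpow_ne_zero _ ht0)
      rwa [IsFractionRing.to_map_eq_zero_iff] at h3)
    (by
      rintro ⟨x, hx⟩ -
      choose c hc using Y.exists_hasseBasis_repr ht hb hh hx
      have : (⟨x, hx⟩ : associatedOrder OK K OL L h) = ∑ i : Fin (p ^ n), c i •
          (⟨Y.orderElt t b i, Y.orderElt_mem ht hb hh i⟩ : associatedOrder OK K OL L h) := by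
        apply Subtype.ext
        simp only [AddSubmonoidClass.coe_finsetSum, Subalgebra.coe_smul]
        rw [← Y.hasseBasis.sum_repr x]
        refine Finset.sum_congr rfl fun i _ ↦ ?_
        rw [hc, hasseBasis_apply, orderElt, mul_smul, algebraMap_smul]
      rw [this]
      exact Submodule.sum_mem _ fun i _ ↦ Submodule.smul_mem _ _ (Submodule.subset_span ⟨i, rfl⟩))
  basis_apply i := by
    rw [Module.Basis.mk_apply, dif_pos i.2]
  elt_zero := by
    have hq : 0 < p ^ n := pow_pos hp.out.pos n
    rw [dif_pos hq]
    apply Subtype.ext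
    change Y.orderElt t b 0 = 1
    rw [orderElt, hasse_zero, wt, if_neg (by omega)]
    simp
  elt_of_le i hi := dif_neg (by omega)
  -- For i + k < p^n the truncated subtraction is exact by `wt_add_le`; beyond that range X_(i+k) is
  -- zero and the coefficient is immaterial.
  coeff i k := (i + k).choose i * t ^ (wt (max b (p ^ n - b)) (i + k) -
    wt (max b (p ^ n - b)) i - wt (max b (p ^ n - b)) k)
  elt_mul i k := by
    have ht0 := algebraMap_t_ne_zero K ht
    by_cases hik : i + k < p ^ n
    · rw [dif_pos (by omega), dif_pos (by omega), dif_pos hik]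
      apply Subtype.ext
      change Y.orderElt t b i * Y.orderElt t b k = _ • Y.orderElt t b (i + k)
      have hle := wt_add_le (c := max b (p ^ n - b)) (by omega) hik
      rw [orderElt, orderElt, orderElt, smul_mul_smul_comm, hasse_mul, smul_smul,
        ← algebraMap_smul K (_ * t ^ _), smul_smul, map_mul, map_natCast, map_pow, ← zpow_natCast]
      congr 1
      have hz := zpow_add₀ ht0 (-(wt (max b (p ^ n - b)) i : ℤ)) (-(wt (max b (p ^ n - b)) k : ℤ))
      rw [show -(wt (max b (p ^ n - b)) i : ℤ) + -(wt (max b (p ^ n - b)) k : ℤ) =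
        ((wt (max b (p ^ n - b)) (i + k) - wt (max b (p ^ n - b)) i -
          wt (max b (p ^ n - b)) k : ℕ) : ℤ) + -(wt (max b (p ^ n - b)) (i + k) : ℤ) by omega,
        zpow_add₀ ht0] at hz
      linear_combination -((i + k).choose i : K) * hz
    · rw [dif_neg hik, smul_zero]
      by_cases hi : i < p ^ n
      · by_cases hk : k < p ^ n
        · rw [dif_pos hi, dif_pos hk]
          apply Subtype.ext
          change Y.orderElt t b i * Y.orderElt t b k = 0
          rw [orderElt, orderElt, smul_mul_smul_comm, hasse_mul, Y.hasse_of_le (not_lt.1 hik),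
            smul_zero, smul_zero]
        · rw [dif_neg hk, mul_zero]
      · rw [dif_neg hi, zero_mul]

/-- The monomial basis of an ideal. -/
def monomialModule :
    MonomialModule (Y.monomialBasis ht hb hh) (idealPow OL L h) where
  vec j := if hj : j < p ^ n then ⟨Y.idealVec t m b j, Y.idealVec_mem ht hb hh hj⟩ else 0
  basis := Module.Basis.mk
    (v := fun j : Fin (p ^ n) ↦ (⟨Y.idealVec t m b j, Y.idealVec_mem ht hb hh j.2⟩ :
      idealPow OL L h))
    (by
      have ht0 := algebraMap_t_ne_zero K ht
      rw [Fintype.linearIndependent_iff]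
      intro a ha j
      have h1 := congrArg Subtype.val ha
      have h2 := Fintype.linearIndependent_iff.1 Y.powBasis.linearIndependent
        (fun j ↦ algebraMap OK K (a j) * algebraMap OK K t ^ (m + (eps (p ^ n) b j : ℤ)))
        (by
          refine Eq.trans ?_ h1
          rw [AddSubmonoidClass.coe_finsetSum]
          refine Finset.sum_congr rfl fun j _ ↦ ?_
          change _ = a j • Y.idealVec t m b j
          rw [idealVec, powBasis_apply, mul_smul, algebraMap_smul]) j
      have h3 := (mul_eq_zero.1 h2).resolve_right (zpow_ne_zero _ ht0)
      rwa [IsFractionRing.to_map_eq_zero_iff] at h3)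
    (by
      rintro ⟨x, hx⟩ -
      choose c hc using Y.exists_repr_of_mem ht hb hh hx
      have : (⟨x, hx⟩ : idealPow OL L h) = ∑ j : Fin (p ^ n), c j •
          (⟨Y.idealVec t m b j, Y.idealVec_mem ht hb hh j.2⟩ : idealPow OL L h) := by
        apply Subtype.ext
        simp only [AddSubmonoidClass.coe_finsetSum, Submodule.coe_smul_of_tower]
        rw [← Y.powBasis.sum_repr x]
        refine Finset.sum_congr rfl fun j _ ↦ ?_
        rw [hc, powBasis_apply, idealVec, ← algebraMap_smul K (c j), smul_smul, mul_comm]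
      rw [this]
      exact Submodule.sum_mem _ fun i _ ↦ Submodule.smul_mem _ _ (Submodule.subset_span ⟨i, rfl⟩))
  basis_apply j := by
    rw [Module.Basis.mk_apply, dif_pos j.2]
  -- For i ≤ j the truncated subtraction is exact by `eps_add_wt_le`; for j < i the binomial
  -- coefficient vanishes.
  coeff i j := j.choose i * t ^ (eps (p ^ n) b j - eps (p ^ n) b (j - i) -
    wt (max b (p ^ n - b)) i)
  elt_smul i j hi hj := by
    simp only [monomialBasis]
    rw [dif_pos hi, dif_pos hj, dif_pos (show j - i < p ^ n by omega)]
    apply Subtype.ext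
    change galAction K L (Y.orderElt t b i) (Y.idealVec t m b j) = _ • Y.idealVec t m b (j - i)
    rw [Y.galAction_orderElt ht hj, algebraMap_smul]
  coeff_of_lt i j hij := by rw [Nat.choose_eq_zero_of_lt hij, Nat.cast_zero, zero_mul]

omit hp in
lemma isUnit_natCast_mul_pow [Fact p.Prime] [CharP OK p] (ht : Irreducible t) (a e : ℕ) :
    IsUnit ((a : OK) * t ^ e) ↔ ¬ p ∣ a ∧ e = 0 := by
  rw [IsUnit.mul_iff, CharP.isUnit_natCast_iff (p := p) Fact.out]
  refine and_congr_right fun _ ↦ ⟨fun h ↦ ?_, fun h ↦ by rw [h, pow_zero]; exact isUnit_one⟩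
  by_contra he
  exact ht.not_isUnit ((isUnit_pow_iff he).1 h)

lemma isUnit_monomialBasis_coeff {i k : ℕ} (hik : i + k < p ^ n) :
    IsUnit ((Y.monomialBasis ht hb hh).coeff i k) ↔ NoCarry p i k ∧
      wt (max b (p ^ n - b)) (i + k) = wt (max b (p ^ n - b)) i + wt (max b (p ^ n - b)) k := by
  have := charP_base OK K p
  have hle := wt_add_le (c := max b (p ^ n - b)) (by omega) hik
  change IsUnit (((i + k).choose i : OK) * t ^ _) ↔ _
  rw [isUnit_natCast_mul_pow (p := p) ht, NoCarry]
  refine and_congr_right fun _ ↦ ?_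
  omega

lemma isUnit_monomialModule_coeff {i j : ℕ} (hij : i + j < p ^ n) :
    IsUnit ((Y.monomialModule ht hb hh).coeff i (i + j)) ↔ NoCarry p i j ∧
      eps (p ^ n) b (i + j) = eps (p ^ n) b j + wt (max b (p ^ n - b)) i := by
  have := charP_base OK K p
  have hle := eps_add_wt_le (b := b) hij
  change IsUnit (((i + j).choose i : OK) * t ^ _) ↔ _
  rw [isUnit_natCast_mul_pow (p := p) ht, NoCarry, Nat.add_sub_cancel_left]
  refine and_congr_right fun _ ↦ ?_
  omega

end TranslationGenerator

instance (OK K OL L : Type*)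
    [CommRing OK] [IsDomain OK] [IsDiscreteValuationRing OK] [Field K] [Algebra OK K]
    [IsFractionRing OK K] [CommRing OL] [IsDomain OL] [IsDiscreteValuationRing OL] [Field L]
    [Algebra OL L] [IsFractionRing OL L] [Algebra K L] [Algebra OK OL] [Algebra OK L]
    [IsScalarTower OK K L] [IsScalarTower OK OL L] (h : ℤ) :
    IsScalarTower OK (associatedOrder OK K OL L h) (idealPow OL L h) where
  smul_assoc a x y := Subtype.ext (by
    change galAction K L (a • x.1) y.1 = a • galAction K L x.1 y.1
    rw [← algebraMap_smul K a x.1, map_smul, LinearMap.smul_apply, algebraMap_smul])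

/-! ### The invariants as cardinalities -/

section Main

variable {OK : Type*} {K : Type*} {OL : Type*} {L : Type*}
  [CommRing OK] [IsDomain OK] [IsDiscreteValuationRing OK] [Field K] [Algebra OK K]
  [IsFractionRing OK K] [CommRing OL] [IsDomain OL] [IsDiscreteValuationRing OL] [Field L]
  [Algebra OL L] [IsFractionRing OL L] [Algebra K L] [Algebra OK OL] [Algebra OK L]
  [IsScalarTower OK K L] [IsScalarTower OK OL L]
  [IsIntegralClosure OL OK L] [FiniteDimensional K L] [IsGalois K L]
  {p n : ℕ} [hp : Fact p.Prime] [CharP K p]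

lemma nonempty_translationGenerator (hdeg : Module.finrank K L = p ^ n)
    (htot : IsTotallyRamified OK K OL L) (hweak : IsWeaklyRamified OK K OL L) :
    Nonempty (TranslationGenerator OK K OL L p n) := by
  have : NeZero (p ^ n) := ⟨(pow_pos hp.out.pos n).ne'⟩
  obtain ⟨c, y, hc, hy, hσ⟩ := exists_translation (p := p) hdeg htot rfl hweak
  exact ⟨⟨hdeg, htot, y, c,
    (Finite.equivFinOfCardEq (card_galois (L := L) hdeg htot)).symm, hc, hy, hσ⟩⟩

variable (Y : TranslationGenerator OK K OL L p n) {h : ℤ} {b : ℕ} (hb : b < p ^ n)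
  (hh : h ≡ b + 1 [ZMOD (p : ℤ) ^ n])

include Y in
theorem isLocalWithResidueField_associatedOrder (h : ℤ) :
    IsLocalWithResidueField OK (associatedOrder OK K OL L h) := by
  have hq : (0 : ℤ) < (p ^ n : ℕ) := by exact_mod_cast pow_pos hp.out.pos n
  obtain ⟨t, ht⟩ := IsDiscreteValuationRing.exists_irreducible OK
  have h1 := Int.emod_nonneg (h - 1) hq.ne'
  have h2 := Int.emod_lt_of_pos (h - 1) hq
  have h3 := Int.emod_add_mul_ediv (h - 1) (p ^ n : ℕ)
  obtain ⟨b, hb⟩ := Int.eq_ofNat_of_zero_le h1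
  rw [hb] at h2 h3
  exact (Y.monomialBasis ht (b := b) (m := (h - 1) / (p ^ n : ℕ) + 1) (by exact_mod_cast h2)
    (by rw [add_sub_cancel_right]; linarith)).isLocalWithResidueField (by exact_mod_cast hq)

include hh in
omit hp in
lemma exists_eq_add_mul : ∃ m : ℤ, h = b + 1 + (p ^ n : ℕ) * (m - 1) := by
  obtain ⟨m, hm⟩ := hh.symm.dvd
  exact ⟨m + 1, by push_cast; rw [add_sub_cancel_right, ← hm]; ring⟩

include Y hb hh

theorem minGenerators_eq : minGenerators OK K OL L h =
    ((1 + (extraGenerators p n b).card : ℕ) : Cardinal) := by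
  classical
  obtain ⟨t, ht⟩ := IsDiscreteValuationRing.exists_irreducible OK
  obtain ⟨m, hm⟩ := exists_eq_add_mul hh
  rw [minGenerators, (Y.monomialModule ht hb hm).spanRank_eq (pow_pos hp.out.pos n),
    ← card_generators hb]
  congr 2
  refine Finset.filter_congr fun j _ ↦ forall_congr' fun i ↦ forall_congr' fun _ ↦
    forall_congr' fun hij ↦ ?_
  rw [Y.isUnit_monomialModule_coeff ht hb hm hij]

theorem isFreeIdeal_iff : IsFreeIdeal OK K OL L h ↔ (extraGenerators p n b).card = 0 := by
  classical
  have hq : 0 < p ^ n := pow_pos hp.out.pos n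
  obtain ⟨t, ht⟩ := IsDiscreteValuationRing.exists_irreducible OK
  obtain ⟨m, hm⟩ := exists_eq_add_mul hh
  constructor
  · intro hfree
    have : Module.Free (associatedOrder OK K OL L h) (idealPow OL L h) := hfree
    have h1 := (Y.monomialModule ht hb hm).spanRank_le_one_of_free hq
    have h2 := minGenerators_eq Y hb hh
    rw [minGenerators] at h2
    rw [h2] at h1
    have h3 : 1 + (extraGenerators p n b).card ≤ 1 := by exact_mod_cast h1
    omega
  · intro h0
    refine (Y.monomialModule ht hb hm).free_of_forall_isGenerator fun j hj hg ↦ ?_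
    rw [Finset.card_eq_zero] at h0
    -- With no extra generators only the last basis vector generates, which is the criterion for
    -- freeness.
    have h1 := (forall_eps_ne_iff hb hj).1 fun i hi hij ↦ by
      rw [← Y.isUnit_monomialModule_coeff ht hb hm hij]
      exact hg i hi hij
    rw [h0] at h1
    exact h1.resolve_right (Finset.notMem_empty _)

theorem embeddingDim_associatedOrder : embeddingDim (associatedOrder OK K OL L h) =
    ((1 + n + (extraCotangent p n (max b (p ^ n - b))).card : ℕ) : Cardinal) := by
  classical
  obtain ⟨t, ht⟩ := IsDiscreteValuationRing.exists_irreducible OK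
  obtain ⟨m, hm⟩ := exists_eq_add_mul hh
  rw [(Y.monomialBasis ht hb hm).embeddingDim_eq (pow_pos hp.out.pos n), add_assoc,
    ← card_indecomposables (by omega)]
  congr 3
  refine Finset.filter_congr fun i _ ↦ and_congr_right fun _ ↦ and_congr_right fun hi ↦
    forall_congr' fun j ↦ forall_congr' fun l ↦ forall_congr' fun _ ↦ forall_congr' fun _ ↦
    forall_congr' fun hjl ↦ ?_
  rw [Y.isUnit_monomialBasis_coeff ht hb hm (by omega), hjl]

end Main

/-! ### The counts as functions of the residue class of h -/

section Residues

variable {p n : ℕ} [hp : Fact p.Prime]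

lemma modEq_of_eq {a b q : ℤ} (h : a = b) : a ≡ b [ZMOD q] := congrArg (· % q) h

lemma exists_modEq_add_one (p n : ℕ) [hp : Fact p.Prime] (h : ℤ) :
    ∃ b < p ^ n, h ≡ (b : ℕ) + 1 [ZMOD (p : ℤ) ^ n] := by
  have hq : (0 : ℤ) < (p : ℤ) ^ n := pow_pos (by exact_mod_cast hp.out.pos) n
  refine ⟨((h - 1) % (p : ℤ) ^ n).toNat, ?_, ?_⟩
  · zify
    rw [Int.toNat_of_nonneg (Int.emod_nonneg _ hq.ne')]
    exact Int.emod_lt_of_pos _ hq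
  · rw [Int.toNat_of_nonneg (Int.emod_nonneg _ hq.ne')]
    have h1 : h - 1 ≡ (h - 1) % (p : ℤ) ^ n [ZMOD (p : ℤ) ^ n] := (Int.mod_modEq _ _).symm
    simpa using h1.add_right 1

omit hp in
lemma modEq_add_one_iff {h : ℤ} {b c : ℕ} (hb : b < p ^ n) (hc : c < p ^ n)
    (hh : h ≡ b + 1 [ZMOD (p : ℤ) ^ n]) : h ≡ c + 1 [ZMOD (p : ℤ) ^ n] ↔ b = c := by
  constructor
  · intro h1
    have h2 : (b : ℤ) ≡ c [ZMOD ((p ^ n : ℕ) : ℤ)] := by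
      push_cast
      exact (hh.symm.trans h1).add_right_cancel' 1
    exact ((Int.natCast_modEq_iff).1 h2).eq_of_lt_of_lt hb hc
  · rintro rfl
    exact hh

lemma max_sub_pos (b : ℕ) : 0 < max b (p ^ n - b) := by
  have : 0 < p ^ n := pow_pos hp.out.pos n
  omega

/-- For 0 < b, c = max(b, p^n - b) lies strictly between p^(n-1) and p^n, and then c itself is
counted. -/
lemma card_extraCotangent_eq_zero_iff (hp2 : p ≠ 2) (hn : 1 ≤ n) {b : ℕ} (hb : b < p ^ n) :
    (extraCotangent p n (max b (p ^ n - b))).card = 0 ↔ b = 0 := by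
  constructor
  · intro h0
    by_contra hb0
    have hq := two_mul_pow_pred_le (p := p) hn
    have hq' := odd_pow (p := p) hp2 n
    rw [Finset.card_eq_zero] at h0
    have h1 := self_mem_extraCotangent (p := p) (c := max b (p ^ n - b)) hn (by omega) (by omega)
    rw [h0] at h1
    exact Finset.notMem_empty _ h1
  · rintro rfl
    rw [Nat.sub_zero, Nat.max_eq_right (Nat.zero_le _), extraCotangent_self, Finset.card_empty]

/-- For p = 2 the threshold can also equal 2^(n-1), at b = 2^(n-1), where it is a power of p and is
not counted. -/
lemma card_extraCotangent_two_eq_zero_iff (hn : 1 ≤ n) {b : ℕ} (hb : b < 2 ^ n) :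
    (extraCotangent 2 n (max b (2 ^ n - b))).card = 0 ↔ b = 0 ∨ b = 2 ^ (n - 1) := by
  have hq := pow_eq_mul_pow_pred (p := 2) hn
  constructor
  · intro h0
    by_contra! hb0
    rw [Finset.card_eq_zero] at h0
    have h1 := self_mem_extraCotangent (p := 2) (c := max b (2 ^ n - b)) hn (by omega) (by omega)
    rw [h0] at h1
    exact Finset.notMem_empty _ h1
  · rintro (rfl | rfl)
    · rw [Nat.sub_zero, Nat.max_eq_right (Nat.zero_le _), extraCotangent_self, Finset.card_empty]
    · rw [show max (2 ^ (n - 1)) (2 ^ n - 2 ^ (n - 1)) = 2 ^ (n - 1) by omega,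
        extraCotangent_two_half hn, Finset.card_empty]

lemma card_extraCotangent_two_eq_pred_iff (hn : 1 < n) {b : ℕ} (hb : b < 2 ^ n) :
    (extraCotangent 2 n (max b (2 ^ n - b))).card = n - 1 ↔
      b = 2 ^ (n - 1) - 1 ∨ b = 2 ^ (n - 1) + 1 := by
  have hq := pow_eq_mul_pow_pred (p := 2) hn.le
  have h1 : 1 < 2 ^ (n - 1) := Nat.one_lt_pow (by omega) (by omega)
  constructor
  · intro h0
    have := eq_of_card_extraCotangent_two hn (by omega) h0
    omega
  · intro h0
    rw [show max b (2 ^ n - b) = 2 ^ n - 2 ^ (n - 1) + 1 by omega,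
      card_extraCotangent_sub_pow hn.le (by omega)]

/-- For r < n take b = p^r - 1, whose threshold is p^n - p^r + 1; the maximal count r = n needs the
middle value b = (p^n - 1)/2. -/
lemma exists_card_extraCotangent_eq (hp2 : p ≠ 2) (hn : 1 ≤ n) {r : ℕ} (hr : r ≤ n) :
    ∃ b < p ^ n, (extraCotangent p n (max b (p ^ n - b))).card = r := by
  have hq := two_mul_pow_pred_le (p := p) hn
  have hq' := odd_pow (p := p) hp2 n
  rcases hr.eq_or_lt with rfl | hr
  · refine ⟨(p ^ r - 1) / 2, by omega, ?_⟩
    rw [show max ((p ^ r - 1) / 2) (p ^ r - (p ^ r - 1) / 2) = (p ^ r + 1) / 2 by omega,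
      card_extraCotangent_half hp2 hn]
  · have h1 : p ^ r ≤ p ^ (n - 1) := Nat.pow_le_pow_right hp.out.pos (by omega)
    have h2 : 0 < p ^ r := pow_pos hp.out.pos r
    refine ⟨p ^ r - 1, by omega, ?_⟩
    rw [show max (p ^ r - 1) (p ^ n - (p ^ r - 1)) = p ^ n - p ^ r + 1 by omega,
      card_extraCotangent_sub_pow hn hr]

end Residues

/-! ### General bounds and the values for odd p -/

section Values

variable {OK : Type*} {K : Type*} {OL : Type*} {L : Type*}
  [CommRing OK] [IsDomain OK] [IsDiscreteValuationRing OK] [Field K] [Algebra OK K]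
  [IsFractionRing OK K] [CommRing OL] [IsDomain OL] [IsDiscreteValuationRing OL] [Field L]
  [Algebra OL L] [IsFractionRing OL L] [Algebra K L] [Algebra OK OL] [Algebra OK L]
  [IsScalarTower OK K L] [IsScalarTower OK OL L]
  [IsIntegralClosure OL OK L] [FiniteDimensional K L] [IsGalois K L]
  {p n : ℕ} [hp : Fact p.Prime] [CharP K p] (Y : TranslationGenerator OK K OL L p n)

include Y

theorem minGenerators_le (h : ℤ) : minGenerators OK K OL L h ≤ ((n + 1 : ℕ) : Cardinal) := by
  obtain ⟨b, hb, hh⟩ := exists_modEq_add_one p n h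
  rw [minGenerators_eq Y hb hh, Nat.cast_le]
  have := card_extraGenerators_le (p := p) (n := n) b
  omega

theorem minGenerators_two (hn : 1 ≤ n) (hpn : p ≠ 2 ∨ 1 < n) :
    minGenerators OK K OL L 2 = ((n + 1 : ℕ) : Cardinal) := by
  have h0 := pow_pred_add_one_lt hn hpn
  rw [minGenerators_eq Y (b := 1) (by omega) (by rfl), card_extraGenerators_one hn hpn, add_comm]

theorem minGenerators_values_odd (hn : 1 ≤ n) (hp2 : p ≠ 2) :
    (∀ h : ℤ, minGenerators OK K OL L h ≤ ((n + 1 : ℕ) : Cardinal)) ∧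
    (∃ h : ℤ, minGenerators OK K OL L h = ((n + 1 : ℕ) : Cardinal)) ∧
    (∀ h : ℤ, ¬ IsFreeIdeal OK K OL L h → 2 ≤ minGenerators OK K OL L h) ∧
    (¬ IsFreeIdeal OK K OL L (((p : ℤ) ^ n + 1) / 2) ∧
      minGenerators OK K OL L (((p : ℤ) ^ n + 1) / 2) = 2) := by
  refine ⟨minGenerators_le Y, ⟨2, minGenerators_two Y hn (Or.inl hp2)⟩, fun h hfree ↦ ?_, ?_⟩
  · obtain ⟨b, hb, hh⟩ := exists_modEq_add_one p n h
    rw [isFreeIdeal_iff Y hb hh] at hfree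
    rw [minGenerators_eq Y hb hh]
    exact_mod_cast (show 2 ≤ 1 + (extraGenerators p n b).card by omega)
  · have hodd := odd_pow (p := p) hp2 n
    have hb : (p ^ n - 1) / 2 < p ^ n := by omega
    have hh : ((p : ℤ) ^ n + 1) / 2 ≡ ((p ^ n - 1) / 2 : ℕ) + 1 [ZMOD (p : ℤ) ^ n] := by
      rw [← Nat.cast_pow]
      refine modEq_of_eq ?_
      omega
    rw [isFreeIdeal_iff Y hb hh, minGenerators_eq Y hb hh, card_extraGenerators_half hp2 hn]
    exact ⟨one_ne_zero, by norm_num⟩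

theorem embeddingDim_values_odd (hn : 1 ≤ n) (hp2 : p ≠ 2) :
    (∀ h : ℤ, ((n + 1 : ℕ) : Cardinal) ≤ embeddingDim (associatedOrder OK K OL L h) ∧
      embeddingDim (associatedOrder OK K OL L h) ≤ ((2 * n + 1 : ℕ) : Cardinal)) ∧
    (∀ d : ℕ, n + 1 ≤ d → d ≤ 2 * n + 1 → ∃ h : ℤ,
      embeddingDim (associatedOrder OK K OL L h) = (d : Cardinal)) ∧
    (∀ h : ℤ, embeddingDim (associatedOrder OK K OL L h) = ((n + 1 : ℕ) : Cardinal) ↔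
      h ≡ 1 [ZMOD (p : ℤ) ^ n]) ∧
    embeddingDim (associatedOrder OK K OL L 2) = ((n + 2 : ℕ) : Cardinal) ∧
    embeddingDim (associatedOrder OK K OL L ((p : ℤ) ^ n)) = ((n + 2 : ℕ) : Cardinal) ∧
    embeddingDim (associatedOrder OK K OL L (((p : ℤ) ^ n + 1) / 2)) =
      ((2 * n + 1 : ℕ) : Cardinal) := by
  have hlt := pow_pred_add_one_lt hn (Or.inl hp2)
  have hodd := odd_pow (p := p) hp2 n
  refine ⟨fun h ↦ ?_, fun d hd1 hd2 ↦ ?_, fun h ↦ ?_, ?_, ?_, ?_⟩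
  · obtain ⟨b, hb, hh⟩ := exists_modEq_add_one p n h
    rw [embeddingDim_associatedOrder Y hb hh, Nat.cast_le, Nat.cast_le]
    have := card_extraCotangent_le (p := p) (n := n) (max_sub_pos (p := p) (n := n) b)
    omega
  · obtain ⟨b, hb, hc⟩ := exists_card_extraCotangent_eq hp2 hn (show d - (n + 1) ≤ n by omega)
    refine ⟨b + 1, ?_⟩
    rw [embeddingDim_associatedOrder Y hb rfl, hc, Nat.cast_inj]
    omega
  · obtain ⟨b, hb, hh⟩ := exists_modEq_add_one p n h
    have h1 := modEq_add_one_iff hb (c := 0) (by omega) hh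
    rw [Nat.cast_zero, zero_add] at h1
    rw [h1, embeddingDim_associatedOrder Y hb hh, Nat.cast_inj,
      ← card_extraCotangent_eq_zero_iff hp2 hn hb]
    omega
  · rw [embeddingDim_associatedOrder Y (b := 1) (by omega) (by rfl),
      show max 1 (p ^ n - 1) = p ^ n - 1 by omega,
      card_extraCotangent_pred hn (by omega), Nat.cast_inj]
    omega
  · rw [embeddingDim_associatedOrder Y (b := p ^ n - 1) (by omega)
      (modEq_of_eq (by rw [← Nat.cast_pow]; omega)),
      show max (p ^ n - 1) (p ^ n - (p ^ n - 1)) = p ^ n - 1 by omega,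
      card_extraCotangent_pred hn (by omega), Nat.cast_inj]
    omega
  · rw [embeddingDim_associatedOrder Y (b := (p ^ n - 1) / 2) (by omega)
      (modEq_of_eq (by rw [← Nat.cast_pow]; omega)),
      show max ((p ^ n - 1) / 2) (p ^ n - (p ^ n - 1) / 2) = (p ^ n + 1) / 2 by omega,
      card_extraCotangent_half hp2 hn, Nat.cast_inj]
    omega

end Values

/-! ### The values for p = 2 -/

section EvenValues

variable {OK : Type*} {K : Type*} {OL : Type*} {L : Type*}
  [CommRing OK] [IsDomain OK] [IsDiscreteValuationRing OK] [Field K] [Algebra OK K]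
  [IsFractionRing OK K] [CommRing OL] [IsDomain OL] [IsDiscreteValuationRing OL] [Field L]
  [Algebra OL L] [IsFractionRing OL L] [Algebra K L] [Algebra OK OL] [Algebra OK L]
  [IsScalarTower OK K L] [IsScalarTower OK OL L]
  [IsIntegralClosure OL OK L] [FiniteDimensional K L] [IsGalois K L]
  {n : ℕ} [Fact (Nat.Prime 2)] [CharP K 2] (Y : TranslationGenerator OK K OL L 2 n)

include Y

theorem minGenerators_values_even (hn : 1 < n) :
    (∀ h : ℤ, minGenerators OK K OL L h ≤ ((n + 1 : ℕ) : Cardinal)) ∧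
    (∃ h : ℤ, minGenerators OK K OL L h = ((n + 1 : ℕ) : Cardinal)) ∧
    (∀ h : ℤ, minGenerators OK K OL L h ≠ 2) ∧
    (∀ h : ℤ, ¬ IsFreeIdeal OK K OL L h → 3 ≤ minGenerators OK K OL L h) ∧
    (¬ IsFreeIdeal OK K OL L (2 ^ (n - 1)) ∧
      minGenerators OK K OL L (2 ^ (n - 1)) = 3) := by
  refine ⟨minGenerators_le Y, ⟨2, minGenerators_two Y hn.le (Or.inr hn)⟩, fun h ↦ ?_,
    fun h hfree ↦ ?_, ?_⟩
  · obtain ⟨b, hb, hh⟩ := exists_modEq_add_one 2 n h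
    rw [minGenerators_eq Y hb hh]
    have := two_le_card_extraGenerators_two hn.le (b := b)
    exact_mod_cast (show 1 + (extraGenerators 2 n b).card ≠ 2 by omega)
  · obtain ⟨b, hb, hh⟩ := exists_modEq_add_one 2 n h
    rw [isFreeIdeal_iff Y hb hh] at hfree
    rw [minGenerators_eq Y hb hh]
    have := two_le_card_extraGenerators_two hn.le hfree
    exact_mod_cast (show 3 ≤ 1 + (extraGenerators 2 n b).card by omega)
  · have hq := pow_eq_mul_pow_pred (p := 2) hn.le
    have h1 : 1 < 2 ^ (n - 1) := Nat.one_lt_pow (by omega) (by omega)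
    have hb : 2 ^ (n - 1) - 1 < 2 ^ n := by omega
    have hh : (2 : ℤ) ^ (n - 1) ≡ (2 ^ (n - 1) - 1 : ℕ) + 1 [ZMOD ((2 : ℕ) : ℤ) ^ n] :=
      modEq_of_eq (by push_cast [h1.le]; ring)
    rw [isFreeIdeal_iff Y hb hh, minGenerators_eq Y hb hh, card_extraGenerators_two hn]
    exact ⟨two_ne_zero, by norm_num⟩

theorem embeddingDim_values_even (hn : 1 ≤ n) :
    (∀ h : ℤ, ((n + 1 : ℕ) : Cardinal) ≤ embeddingDim (associatedOrder OK K OL L h) ∧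
      embeddingDim (associatedOrder OK K OL L h) ≤ ((2 * n : ℕ) : Cardinal)) ∧
    (∀ h : ℤ, embeddingDim (associatedOrder OK K OL L h) = ((n + 1 : ℕ) : Cardinal) ↔
      (h ≡ 1 [ZMOD 2 ^ n] ∨ h ≡ 2 ^ (n - 1) + 1 [ZMOD 2 ^ n])) ∧
    (∀ h : ℤ, (h ≡ 2 ^ (n - 1) [ZMOD 2 ^ n] ∨ h ≡ 2 ^ (n - 1) + 2 [ZMOD 2 ^ n]) →
      embeddingDim (associatedOrder OK K OL L h) = ((2 * n : ℕ) : Cardinal)) ∧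
    (1 < n → ∀ h : ℤ, embeddingDim (associatedOrder OK K OL L h) = ((2 * n : ℕ) : Cardinal) →
      (h ≡ 2 ^ (n - 1) [ZMOD 2 ^ n] ∨ h ≡ 2 ^ (n - 1) + 2 [ZMOD 2 ^ n])) := by
  have hq := pow_eq_mul_pow_pred (p := 2) hn
  have hq0 : 0 < 2 ^ (n - 1) := by positivity
  have hbound : ∀ h : ℤ, ∀ b < 2 ^ n, h ≡ (b : ℕ) + 1 [ZMOD ((2 : ℕ) : ℤ) ^ n] →
      (embeddingDim (associatedOrder OK K OL L h) = ((2 * n : ℕ) : Cardinal) ↔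
        (extraCotangent 2 n (max b (2 ^ n - b))).card = n - 1) := by
    intro h b hb hh
    rw [embeddingDim_associatedOrder Y hb hh, Nat.cast_inj]
    omega
  have hiff : 1 < n → ∀ h : ℤ,
      (embeddingDim (associatedOrder OK K OL L h) = ((2 * n : ℕ) : Cardinal) ↔
        (h ≡ 2 ^ (n - 1) [ZMOD 2 ^ n] ∨ h ≡ 2 ^ (n - 1) + 2 [ZMOD 2 ^ n])) := by
    intro hn1 h
    have hq1 : 1 < 2 ^ (n - 1) := Nat.one_lt_pow (by omega) (by omega)
    obtain ⟨b, hb, hh⟩ := exists_modEq_add_one 2 n h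
    rw [hbound h b hb hh, card_extraCotangent_two_eq_pred_iff hn1 hb,
      ← modEq_add_one_iff hb (c := 2 ^ (n - 1) - 1) (by omega) hh,
      ← modEq_add_one_iff hb (c := 2 ^ (n - 1) + 1) (by omega) hh]
    push_cast [hq1.le]
    rw [sub_add_cancel, add_assoc, one_add_one_eq_two]
  refine ⟨fun h ↦ ?_, fun h ↦ ?_, fun h hh ↦ ?_, fun hn1 h ↦ (hiff hn1 h).1⟩
  · obtain ⟨b, hb, hh⟩ := exists_modEq_add_one 2 n h
    rw [embeddingDim_associatedOrder Y hb hh, Nat.cast_le, Nat.cast_le]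
    have := card_extraCotangent_two_le hn (c := max b (2 ^ n - b)) (by omega)
    omega
  · obtain ⟨b, hb, hh⟩ := exists_modEq_add_one 2 n h
    have h0 := modEq_add_one_iff hb (c := 0) (by omega) hh
    have h1 := modEq_add_one_iff hb (c := 2 ^ (n - 1)) (by omega) hh
    push_cast at h0 h1
    rw [h0, h1, ← card_extraCotangent_two_eq_zero_iff hn hb,
      embeddingDim_associatedOrder Y hb hh, Nat.cast_inj]
    omega
  · rcases hn.eq_or_lt with rfl | hn1
    -- For n = 1 the bounds n + 1 and 2n coincide, so the value is forced for every h.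
    · obtain ⟨b, hb, hh⟩ := exists_modEq_add_one 2 1 h
      rw [hbound h b hb hh, Nat.sub_self]
      have := card_extraCotangent_two_le (n := 1) le_rfl (c := max b (2 ^ 1 - b)) (by omega)
      omega
    · exact (hiff hn1 h).2 hh

end EvenValues

end GaloisModule

end

theorem corollary4p7
    (p : ℕ) [Fact p.Prime] (n : ℕ) (hn : 1 ≤ n)
    -- `K` is a local field of characteristic `p` with perfect residue field, `OK` its valuation ring
    (OK K : Type*) [CommRing OK] [IsDomain OK] [IsDiscreteValuationRing OK]
    [IsAdicComplete (IsLocalRing.maximalIdeal OK) OK] [PerfectField (IsLocalRing.ResidueField OK)]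
    [Field K] [Algebra OK K] [IsFractionRing OK K] [CharP K p]
    -- `L` is a finite Galois extension of `K`, `OL` its valuation ring
    (OL L : Type*) [CommRing OL] [IsDomain OL] [IsDiscreteValuationRing OL]
    [Field L] [Algebra OL L] [IsFractionRing OL L]
    [Algebra K L] [Algebra OK OL] [Algebra OK L]
    [IsScalarTower OK K L] [IsScalarTower OK OL L]
    [IsIntegralClosure OL OK L] [FiniteDimensional K L] [IsGalois K L]
    (hdeg : Module.finrank K L = p ^ n)
    (htot : GaloisModule.IsTotallyRamified OK K OL L)
    (hweak : GaloisModule.IsWeaklyRamified OK K OL L) :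
    -- every associated order is local with residue field that of `K`
    (∀ h : ℤ, GaloisModule.IsLocalWithResidueField OK
      (GaloisModule.associatedOrder OK K OL L h)) ∧
    -- (i)(a)
    (p ≠ 2 →
      (∀ h : ℤ, GaloisModule.minGenerators OK K OL L h ≤ ((n + 1 : ℕ) : Cardinal)) ∧
      (∃ h : ℤ, GaloisModule.minGenerators OK K OL L h = ((n + 1 : ℕ) : Cardinal)) ∧
      (∀ h : ℤ, ¬ GaloisModule.IsFreeIdeal OK K OL L h →
        2 ≤ GaloisModule.minGenerators OK K OL L h) ∧
      (¬ GaloisModule.IsFreeIdeal OK K OL L (((p : ℤ) ^ n + 1) / 2) ∧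
        GaloisModule.minGenerators OK K OL L (((p : ℤ) ^ n + 1) / 2) = 2)) ∧
    -- (i)(b)
    (p = 2 → 1 < n →
      (∀ h : ℤ, GaloisModule.minGenerators OK K OL L h ≤ ((n + 1 : ℕ) : Cardinal)) ∧
      (∃ h : ℤ, GaloisModule.minGenerators OK K OL L h = ((n + 1 : ℕ) : Cardinal)) ∧
      (∀ h : ℤ, GaloisModule.minGenerators OK K OL L h ≠ 2) ∧
      (∀ h : ℤ, ¬ GaloisModule.IsFreeIdeal OK K OL L h →
        3 ≤ GaloisModule.minGenerators OK K OL L h) ∧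
      (¬ GaloisModule.IsFreeIdeal OK K OL L (2 ^ (n - 1)) ∧
        GaloisModule.minGenerators OK K OL L (2 ^ (n - 1)) = 3)) ∧
    -- (ii)(a)
    (p ≠ 2 →
      (∀ h : ℤ, ((n + 1 : ℕ) : Cardinal) ≤
          GaloisModule.embeddingDim (GaloisModule.associatedOrder OK K OL L h) ∧
        GaloisModule.embeddingDim (GaloisModule.associatedOrder OK K OL L h) ≤
          ((2 * n + 1 : ℕ) : Cardinal)) ∧
      (∀ d : ℕ, n + 1 ≤ d → d ≤ 2 * n + 1 → ∃ h : ℤ,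
        GaloisModule.embeddingDim (GaloisModule.associatedOrder OK K OL L h) = (d : Cardinal)) ∧
      (∀ h : ℤ, GaloisModule.embeddingDim (GaloisModule.associatedOrder OK K OL L h) =
          ((n + 1 : ℕ) : Cardinal) ↔ h ≡ 1 [ZMOD (p : ℤ) ^ n]) ∧
      GaloisModule.embeddingDim (GaloisModule.associatedOrder OK K OL L 2) =
        ((n + 2 : ℕ) : Cardinal) ∧
      GaloisModule.embeddingDim (GaloisModule.associatedOrder OK K OL L ((p : ℤ) ^ n)) =
        ((n + 2 : ℕ) : Cardinal) ∧
      GaloisModule.embeddingDim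
          (GaloisModule.associatedOrder OK K OL L (((p : ℤ) ^ n + 1) / 2)) =
        ((2 * n + 1 : ℕ) : Cardinal)) ∧
    -- (ii)(b)
    (p = 2 →
      (∀ h : ℤ, ((n + 1 : ℕ) : Cardinal) ≤
          GaloisModule.embeddingDim (GaloisModule.associatedOrder OK K OL L h) ∧
        GaloisModule.embeddingDim (GaloisModule.associatedOrder OK K OL L h) ≤
          ((2 * n : ℕ) : Cardinal)) ∧
      (∀ h : ℤ, GaloisModule.embeddingDim (GaloisModule.associatedOrder OK K OL L h) =
          ((n + 1 : ℕ) : Cardinal) ↔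
        (h ≡ 1 [ZMOD 2 ^ n] ∨ h ≡ 2 ^ (n - 1) + 1 [ZMOD 2 ^ n])) ∧
      (∀ h : ℤ, (h ≡ 2 ^ (n - 1) [ZMOD 2 ^ n] ∨ h ≡ 2 ^ (n - 1) + 2 [ZMOD 2 ^ n]) →
        GaloisModule.embeddingDim (GaloisModule.associatedOrder OK K OL L h) =
          ((2 * n : ℕ) : Cardinal)) ∧
      (1 < n → ∀ h : ℤ,
        GaloisModule.embeddingDim (GaloisModule.associatedOrder OK K OL L h) =
          ((2 * n : ℕ) : Cardinal) →
        (h ≡ 2 ^ (n - 1) [ZMOD 2 ^ n] ∨ h ≡ 2 ^ (n - 1) + 2 [ZMOD 2 ^ n]))) := by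
  obtain ⟨Y⟩ := GaloisModule.nonempty_translationGenerator hdeg htot hweak
  refine ⟨GaloisModule.isLocalWithResidueField_associatedOrder Y,
    GaloisModule.minGenerators_values_odd Y hn, ?_, GaloisModule.embeddingDim_values_odd Y hn, ?_⟩
  · rintro rfl
    exact GaloisModule.minGenerators_values_even Y
  · rintro rfl
    exact GaloisModule.embeddingDim_values_even Y hn
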